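/- There are a single randomized algorithm $A$ and absolute constants $C>0$, $c\in\mathbb N$ with the following property. Let $q$ be a power of an odd prime $p$, let $\mathbb F=\mathbb F_q$ be presented as $\mathbb F_p(\theta)$ by $p$ and the minimal polynomial of a generator $\theta$ over $\mathbb F_p$, let $k=2^\ell$ with $\ell\in\mathbb N$, and let $0<\delta\le 1$. On input this presentation, $\ell$ and the integer $\lceil\log_2(1/\delta)\rceil$, the algorithm $A$ uses at most $C\,(k\log_2 q+\log_2(1/\delta))$ uniform random bits and always halts within time $C\,(k\log_2 q+\log_2(1/\delta))^c$, on a random access machine with logarithmic cost. On every string of random bits it either declares failure or outputs polynomials $p_1,\dots,p_\ell\in\mathbb F[w_1,\dots,w_\ell]$, written as lists of terms, such that - the ideal $P=(p_1,\dots,p_\ell)$ of $\mathbb F[w_1,\dots,w_\ell]$ is maximal, and $\mathbb F[w_1,\dots,w_\ell]/P$ is a field extension of $\mathbb F$ of degree $k$; - for every $1\le i\le\ell$, $p_i=w_i^2-h_i$, where $h_i\in\mathbb F[w_1,\dots,w_{i-1}]$ has total degree at most $i-1$. The probability that it outputs such polynomials is at least $1-\delta$. -/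

import Mathlib

/-! ### Probabilistic random access machines with logarithmic cost -/

namespace RAM

/-- Arithmetic instructions of the machine (subtraction is truncated at zero; division is
rounded down). -/
inductive Op where
  | add
  | sub
  | mul
  | div
  | mod

/-- The value of an arithmetic instruction. -/
def Op.apply : Op → ℕ → ℕ → ℕ
  | .add, x, y => x + y
  | .sub, x, y => x - y
  | .mul, x, y => x * y
  | .div, x, y => x / y
  | .mod, x, y => x % y

/-- Structured programs for a random access machine whose memory cells, indexed by `ℕ`, hold
natural numbers. The arguments `d`, `a`, `b` are fixed addresses of cells. -/
inductive Prog where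
  /-- do nothing -/
  | skip
  /-- `M[d] := n` -/
  | const (d n : ℕ)
  /-- `M[d] := M[a] o M[b]` -/
  | arith (o : Op) (d a b : ℕ)
  /-- `M[d] := M[M[a]]` -/
  | load (d a : ℕ)
  /-- `M[M[a]] := M[b]` -/
  | store (a b : ℕ)
  /-- read the next number of the input tape into `M[d]` -/
  | read (d : ℕ)
  /-- append `M[a]` to the output tape -/
  | write (a : ℕ)
  /-- toss a coin: store the next random bit in `M[d]` -/
  | toss (d : ℕ)
  /-- sequential composition -/
  | seq (c₁ c₂ : Prog)
  /-- if `M[a] ≠ 0` then `c₁` else `c₂` -/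
  | cond (a : ℕ) (c₁ c₂ : Prog)
  /-- while `M[a] ≠ 0` do `c` -/
  | loop (a : ℕ) (c : Prog)

/-- Configurations: the memory, the unread part of the input tape, the unused random bits, and
the numbers written so far on the output tape. -/
structure State where
  mem : ℕ → ℕ
  input : List ℕ
  coins : List Bool
  output : List ℕ

/-- The state in which `M[d]` has been set to `n`. -/
def State.put (s : State) (d n : ℕ) : State :=
  { s with mem := Function.update s.mem d n }

/-- The initial state: empty memory and output, the given input tape and random bits. -/
def State.init (input : List ℕ) (coins : List Bool) : State :=
  { mem := fun _ => 0, input := input, coins := coins, output := [] }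

/-- `Exec c s s' t`: the program `c`, started in `s`, halts in `s'`, and the run costs `t`.
Costs are logarithmic: each instruction is charged one plus the bit lengths of the numbers
(including computed addresses) that it handles. Reading from an exhausted input tape, or tossing
a coin when all random bits have been used, is not possible. -/
inductive Exec : Prog → State → State → ℕ → Prop
  | skip (s : State) : Exec .skip s s 1
  | const (d n : ℕ) (s : State) : Exec (.const d n) s (s.put d n) (1 + n.size)
  | arith (o : Op) (d a b : ℕ) (s : State) :
      Exec (.arith o d a b) s (s.put d (o.apply (s.mem a) (s.mem b)))
        (1 + (s.mem a).size + (s.mem b).size + (o.apply (s.mem a) (s.mem b)).size)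
  | load (d a : ℕ) (s : State) :
      Exec (.load d a) s (s.put d (s.mem (s.mem a)))
        (1 + (s.mem a).size + (s.mem (s.mem a)).size)
  | store (a b : ℕ) (s : State) :
      Exec (.store a b) s (s.put (s.mem a) (s.mem b)) (1 + (s.mem a).size + (s.mem b).size)
  | read (d n : ℕ) (rest : List ℕ) (s : State) (h : s.input = n :: rest) :
      Exec (.read d) s ({ s with input := rest }.put d n) (1 + n.size)
  | write (a : ℕ) (s : State) :
      Exec (.write a) s { s with output := s.output ++ [s.mem a] } (1 + (s.mem a).size)
  | toss (d : ℕ) (b : Bool) (rest : List Bool) (s : State) (h : s.coins = b :: rest) :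
      Exec (.toss d) s ({ s with coins := rest }.put d b.toNat) 2
  | seq {c₁ c₂ : Prog} {s₁ s₂ s₃ : State} {t₁ t₂ : ℕ}
      (h₁ : Exec c₁ s₁ s₂ t₁) (h₂ : Exec c₂ s₂ s₃ t₂) : Exec (.seq c₁ c₂) s₁ s₃ (t₁ + t₂)
  | condTrue {a : ℕ} {c₁ c₂ : Prog} {s s' : State} {t : ℕ}
      (h : s.mem a ≠ 0) (h₁ : Exec c₁ s s' t) :
      Exec (.cond a c₁ c₂) s s' (1 + (s.mem a).size + t)
  | condFalse {a : ℕ} {c₁ c₂ : Prog} {s s' : State} {t : ℕ}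
      (h : s.mem a = 0) (h₂ : Exec c₂ s s' t) :
      Exec (.cond a c₁ c₂) s s' (1 + (s.mem a).size + t)
  | loopStop {a : ℕ} {c : Prog} {s : State} (h : s.mem a = 0) :
      Exec (.loop a c) s s (1 + (s.mem a).size)
  | loopStep {a : ℕ} {c : Prog} {s₁ s₂ s₃ : State} {t₁ t₂ : ℕ} (h : s₁.mem a ≠ 0)
      (h₁ : Exec c s₁ s₂ t₁) (h₂ : Exec (.loop a c) s₂ s₃ t₂) :
      Exec (.loop a c) s₁ s₃ (1 + (s₁.mem a).size + t₁ + t₂)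

/-- On the given input and the given string of random bits, the program halts at cost exactly
`t`, having written exactly `out`. -/
def Prog.Outputs (c : Prog) (input : List ℕ) (coins : List Bool) (out : List ℕ) (t : ℕ) : Prop :=
  ∃ s' : State, Exec c (State.init input coins) s' t ∧ s'.output = out

end RAM

/-! ### Encodings of finite fields and of polynomials -/

namespace Tower

variable {p : ℕ} {F : Type*} [Field F] [Algebra (ZMod p) F]

/-- The input tape. The finite field `F = 𝔽_p(θ)` is presented, as usual, by `p` and the minimal
polynomial `X ^ u + c_{u-1} X ^ (u-1) + ⋯ + c_0` of `θ` over `𝔽_p`. The tape reads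
`p, u, ℓ, e, c_0, …, c_{u-1}`, with residues mod `p` written as numbers below `p`. -/
noncomputable def inputTape (θ : F) (ℓ e : ℕ) : List ℕ :=
  [p, (minpoly (ZMod p) θ).natDegree, ℓ, e] ++
    List.ofFn fun i : Fin (minpoly (ZMod p) θ).natDegree =>
      ((minpoly (ZMod p) θ).coeff i).val

/-- A term: the exponents of `w_1, …, w_ℓ` and the coordinates of the coefficient. -/
abbrev Term (p ℓ u : ℕ) := (Fin ℓ → ℕ) × (Fin u → ZMod p)

/-- The polynomial given by a list of terms; the coordinates `a_0, …, a_{u-1}` of a coefficient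
stand for the element `a_0 + a_1 θ + ⋯ + a_{u-1} θ ^ (u-1)` of `F`. -/
noncomputable def polyOf {ℓ u : ℕ} (θ : F) (T : List (Term p ℓ u)) : MvPolynomial (Fin ℓ) F :=
  (T.map fun t => MvPolynomial.monomial (Finsupp.equivFunOnFinite.symm t.1)
    (∑ j : Fin u, algebraMap (ZMod p) F (t.2 j) * θ ^ (j : ℕ))).sum

/-- A list of terms written as numbers: the number of terms, and then for each term its `ℓ`
exponents followed by the `u` coordinates of its coefficient. -/
def codeTerms {ℓ u : ℕ} (T : List (Term p ℓ u)) : List ℕ :=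
  T.length :: T.flatMap fun t => List.ofFn t.1 ++ List.ofFn fun j : Fin u => (t.2 j).val

/-- `IsCode θ P out`: the output `out` consists of the number `1`, followed by codes of the
polynomials `P_1, …, P_ℓ` over `F = 𝔽_p(θ)`. -/
def IsCode (p : ℕ) {F : Type*} [Field F] [Algebra (ZMod p) F] (θ : F) {ℓ : ℕ}
    (P : Fin ℓ → MvPolynomial (Fin ℓ) F) (out : List ℕ) : Prop :=
  ∃ T : Fin ℓ → List (Term p ℓ (minpoly (ZMod p) θ).natDegree),
    (∀ i, polyOf θ (T i) = P i) ∧ out = 1 :: (List.ofFn fun i => codeTerms (T i)).flatten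

/-- `P_1, …, P_ℓ ∈ F[w_1, …, w_ℓ]` generate a maximal ideal whose quotient is a field extension of
`F` of degree `2 ^ ℓ`, and `P_i = w_i ^ 2 - h_i` with `h_i ∈ F[w_1, …, w_{i-1}]` of total degree at
most `i - 1`. The variables are indexed from `0`, so that `i - 1` is the value of the index. -/
def IsQuadraticTower {F : Type*} [Field F] {ℓ : ℕ} (P : Fin ℓ → MvPolynomial (Fin ℓ) F) : Prop :=
  (Ideal.span (Set.range P)).IsMaximal ∧
  IsField (MvPolynomial (Fin ℓ) F ⧸ Ideal.span (Set.range P)) ∧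
  Module.finrank F (MvPolynomial (Fin ℓ) F ⧸ Ideal.span (Set.range P)) = 2 ^ ℓ ∧
  ∀ i, ∃ h : MvPolynomial (Fin ℓ) F,
    (∀ j ∈ h.vars, j < i) ∧ h.totalDegree ≤ (i : ℕ) ∧ P i = MvPolynomial.X i ^ 2 - h

/-- The output is a code of polynomials `P_1, …, P_ℓ` as required. -/
def IsSuccess (p : ℕ) {F : Type*} [Field F] [Algebra (ZMod p) F] (θ : F) (ℓ : ℕ)
    (out : List ℕ) : Prop :=
  ∃ P : Fin ℓ → MvPolynomial (Fin ℓ) F, IsCode p θ P out ∧ IsQuadraticTower P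

/-- The output by which the program declares failure. -/
def failure : List ℕ := [0]

end Tower

/-!
Let `q` be the order of `F`. Everything needed to build the tower is a pair `x, y ∈ F` for which
`x ^ 2 + y ^ 2` is not a square. If `q ≡ 1 mod 4`, take `w₁ ^ 2 = -(x ^ 2 + y ^ 2)`; if
`q ≡ 3 mod 4`, take `w₁ ^ 2 = -1` and `w₂ ^ 2 = -(x + y w₁)`, where `x ^ 2 + y ^ 2` is the norm of
`x + y w₁`. After that take `w_{i+1} ^ 2 = -w_i`. At each stage the norm of the new square is not
a square one level below, so that `w_i` changes its sign under the `2 ^ (i-1)`-th power of the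
Frobenius map and therefore has degree `2 ^ i` over `F`.

About half of all pairs are good, but independent trials would cost `log₂ q` random bits each,
which is too much when the failure probability has to be small. Instead, pairs of digit strings
are read as points of the torus `(ℤ / 2 ^ b) ^ 2`, one point is drawn at random, and the others
are visited by a random walk along translations and shears, at four bits per step. A function of
mean zero on the torus that is almost invariant under the translations has a Fourier transform
concentrated near the origin, whereas the shears move a neighbourhood of the origin off itself;
this gives a spectral gap independent of `q`, and the walk misses the good pairs with a
probability exponentially small in its length.
-/

/-! ### The memory cells of the program

They are notation for numerals, so that `simp` and `decide` can tell any two of them apart. -/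

local notation "zeroCell" => 0
local notation "oneCell" => 1
local notation "twoCell" => 2
local notation "primeCell" => 3
local notation "degreeCell" => 4
local notation "lengthCell" => 5
local notation "trialsCell" => 6
local notation "baseCell" => 7
local notation "tailCell" => 8
local notation "unitCell" => 9
local notation "orderCell" => 10
local notation "rangeCell" => 11
local notation "counterCell" => 20
local notation "productCell" => 21
local notation "digitCell" => 22
local notation "reducedCell" => 23
local notation "weightCell" => 24
local notation "numberCell" => 25
local notation "packedCell" => 26
local notation "powerCell" => 30
local notation "resultCell" => 31
local notation "exponentCell" => 32
local notation "parityCell" => 33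
local notation "minusOneCell" => 35
local notation "differenceCell" => 36
local notation "fstCell" => 40
local notation "sndCell" => 41
local notation "fstEltCell" => 42
local notation "sndEltCell" => 43
local notation "sumSqCell" => 44
local notation "foundFstCell" => 50
local notation "foundSndCell" => 51
local notation "foundSumSqCell" => 52
local notation "foundCell" => 53
local notation "walkCell" => 45
local notation "boundCell" => 46
local notation "remainingCell" => 47
local notation "bitCell" => 60
local notation "fstCoeffCell" => 70
local notation "sndCoeffCell" => 71
local notation "nextFstCoeffCell" => 72
local notation "nextSndCoeffCell" => 73
local notation "indexCell" => 74
local notation "polysLeftCell" => 75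
local notation "expCell" => 76
local notation "varCell" => 77
local notation "coeffCell" => 78
local notation "positionCell" => 79

/-! ### Runs within a bit bound and a step bound -/

namespace RAM

/-- Sequential composition of a list of programs. -/
def Prog.block : List Prog → Prog
  | [] => .skip
  | [c] => c
  | c :: d :: cs => .seq c (block (d :: cs))

attribute [local simp] Prog.block Op.apply

/-- Whether the text of the program shows that it may change the memory cell `r`; an indirect
`store` may change every cell. -/
def Prog.writes : Prog → ℕ → Bool
  | .const d _, r | .arith _ d _ _, r | .load d _, r | .read d, r | .toss d, r => r == d
  | .store _ _, _ => true
  | .seq c₁ c₂, r | .cond _ c₁ c₂, r => c₁.writes r || c₂.writes r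
  | .loop _ c, r => c.writes r
  | .skip, _ | .write _, _ => false

/-- Whether the program contains an instruction that uses the input tape. -/
def Prog.reads : Prog → Bool
  | .read _ => true
  | .seq c₁ c₂ | .cond _ c₁ c₂ => c₁.reads || c₂.reads
  | .loop _ c => c.reads
  | _ => false

/-- Whether the program contains an instruction that uses random bits. -/
def Prog.tosses : Prog → Bool
  | .toss _ => true
  | .seq c₁ c₂ | .cond _ c₁ c₂ => c₁.tosses || c₂.tosses
  | .loop _ c => c.tosses
  | _ => false

/-- Whether the program contains an instruction that uses the output tape. -/
def Prog.prints : Prog → Bool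
  | .write _ => true
  | .seq c₁ c₂ | .cond _ c₁ c₂ => c₁.prints || c₂.prints
  | .loop _ c => c.prints
  | _ => false

/-- What a run of `c` from `s` to `s'` leaves unchanged, judging by the text of `c`. -/
structure Frame (c : Prog) (s s' : State) : Prop where
  mem (r : ℕ) : c.writes r = false → s'.mem r = s.mem r
  input : c.reads = false → s'.input = s.input
  coins : c.tosses = false → s'.coins = s.coins
  output : c.prints = false → s'.output = s.output

theorem Frame.refl (c : Prog) (s : State) : Frame c s s :=
  ⟨fun _ _ => rfl, fun _ => rfl, fun _ => rfl, fun _ => rfl⟩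

theorem Frame.trans {c : Prog} {s₁ s₂ s₃ : State} (h : Frame c s₁ s₂) (h' : Frame c s₂ s₃) :
    Frame c s₁ s₃ :=
  ⟨fun r hr => (h'.mem r hr).trans (h.mem r hr), fun hc => (h'.input hc).trans (h.input hc),
    fun hc => (h'.coins hc).trans (h.coins hc), fun hc => (h'.output hc).trans (h.output hc)⟩

theorem Frame.weaken {c d : Prog} {s s' : State} (h : Frame c s s')
    (hw : ∀ r, d.writes r = false → c.writes r = false) (hr : d.reads = false → c.reads = false)
    (ht : d.tosses = false → c.tosses = false) (hp : d.prints = false → c.prints = false) :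
    Frame d s s' :=
  ⟨fun r h' => h.mem r (hw r h'), fun h' => h.input (hr h'), fun h' => h.coins (ht h'),
    fun h' => h.output (hp h')⟩

theorem Exec.frame {c : Prog} {s s' : State} {t : ℕ} (h : Exec c s s' t) : Frame c s s' := by
  induction h with
  | skip | loopStop => exact .refl _ _
  | const | arith | load | store | read | write | toss =>
    constructor <;> simp +contextual [Prog.writes, Prog.reads, Prog.tosses, Prog.prints, State.put]
  | seq _ _ h₁ h₂ =>
    refine .trans (h₁.weaken ?_ ?_ ?_ ?_) (h₂.weaken ?_ ?_ ?_ ?_) <;>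
      simp +contextual [Prog.writes, Prog.reads, Prog.tosses, Prog.prints]
  | condTrue _ _ h | condFalse _ _ h =>
    refine h.weaken ?_ ?_ ?_ ?_ <;>
      simp +contextual [Prog.writes, Prog.reads, Prog.tosses, Prog.prints]
  | loopStep _ _ _ h₁ h₂ =>
    exact .trans (h₁.weaken (fun _ h => h) (fun h => h) (fun h => h) fun h => h) h₂

@[simp] theorem State.put_mem (s : State) (d n r : ℕ) :
    (s.put d n).mem r = if r = d then n else s.mem r := Function.update_apply ..

@[simp] theorem State.put_input (s : State) (d n : ℕ) : (s.put d n).input = s.input := rfl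

@[simp] theorem State.put_coins (s : State) (d n : ℕ) : (s.put d n).coins = s.coins := rfl

@[simp] theorem State.put_output (s : State) (d n : ℕ) : (s.put d n).output = s.output := rfl

/-- All numbers in the memory have at most `L` bits. -/
def State.Bounded (L : ℕ) (s : State) : Prop := ∀ r, s.mem r < 2 ^ L

theorem State.Bounded.put {L : ℕ} {s : State} (h : s.Bounded L) (d : ℕ) {n : ℕ} (hn : n < 2 ^ L) :
    (s.put d n).Bounded L := fun r => by
  rw [put_mem]
  split_ifs
  exacts [hn, h r]

theorem State.Bounded.size_le {L : ℕ} {s : State} (h : s.Bounded L) (r : ℕ) :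
    (s.mem r).size ≤ L := Nat.size_le.2 (h r)

/-- Started in `s` with numbers of at most `L` bits, the program `c` halts at the cost of at most
`k` instructions on numbers of at most `L` bits, in a state with the property `Q`. -/
def Runs (L : ℕ) (c : Prog) (s : State) (k : ℕ) (Q : State → Prop) : Prop :=
  s.Bounded L → ∃ s' t, Exec c s s' t ∧ t ≤ k * (3 * L + 1) ∧ s'.Bounded L ∧ Q s'

section

variable {L : ℕ} {c c₁ c₂ : Prog} {s : State}

theorem Runs.mono {k k' : ℕ} {Q Q' : State → Prop} (h : Runs L c s k Q) (hk : k ≤ k')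
    (hQ : ∀ s', Frame c s s' → Q s' → Q' s') : Runs L c s k' Q' := fun hs => by
  obtain ⟨s', t, he, ht, hs', hq⟩ := h hs
  exact ⟨s', t, he, ht.trans (Nat.mul_le_mul_right _ hk), hs', hQ s' he.frame hq⟩

theorem Runs.seq {k₁ k₂ : ℕ} {Q₁ Q : State → Prop} (h₁ : Runs L c₁ s k₁ Q₁)
    (h₂ : ∀ s', Frame c₁ s s' → Q₁ s' → Runs L c₂ s' k₂ Q) :
    Runs L (.seq c₁ c₂) s (k₁ + k₂) Q := fun hs => by
  obtain ⟨s', t, he, ht, hs', hq⟩ := h₁ hs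
  obtain ⟨s'', t', he', ht', hs'', hq'⟩ := h₂ s' he.frame hq hs'
  exact ⟨s'', t + t', .seq he he', by rw [add_mul]; omega, hs'', hq'⟩

theorem Runs.cond {a k : ℕ} {Q : State → Prop} (h₁ : s.mem a ≠ 0 → Runs L c₁ s k Q)
    (h₂ : s.mem a = 0 → Runs L c₂ s k Q) : Runs L (.cond a c₁ c₂) s (1 + k) Q := fun hs => by
  have ha := hs.size_le a
  by_cases h0 : s.mem a = 0
  · obtain ⟨s', t, he, ht, hq⟩ := h₂ h0 hs
    exact ⟨s', _, .condFalse h0 he, by rw [add_mul]; omega, hq⟩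
  · obtain ⟨s', t, he, ht, hq⟩ := h₁ h0 hs
    exact ⟨s', _, .condTrue h0 he, by rw [add_mul]; omega, hq⟩

/-- In the rule for loops, `I n` is the property that holds before the last `n` rounds. -/
theorem Runs.loop {a k : ℕ} (I : ℕ → State → Prop) {n : ℕ} (hI : I n s)
    (step : ∀ i s', i < n → Frame c s s' → I (i + 1) s' → s'.mem a ≠ 0 ∧ Runs L c s' k (I i))
    (halt : ∀ s', Frame c s s' → I 0 s' → s'.mem a = 0) :
    Runs L (.loop a c) s (1 + n * (1 + k)) (I 0) := fun hs => by
  induction n generalizing s with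
  | zero =>
    have h := halt s (.refl c s) hI
    exact ⟨s, _, .loopStop h, by simp [h], hs, hI⟩
  | succ n ih =>
    obtain ⟨h0, hrun⟩ := step n s n.lt_succ_self (.refl c s) hI
    obtain ⟨s', t, he, ht, hs', hq⟩ := hrun hs
    obtain ⟨s'', t', he', ht', hq'⟩ := ih hq
      (fun i s₁ hi hf h => step i s₁ (hi.trans n.lt_succ_self) (he.frame.trans hf) h)
      (fun s₁ hf h => halt s₁ (he.frame.trans hf) h) hs'
    refine ⟨s'', _, .loopStep h0 he he', ?_, hq'⟩
    have ha := hs.size_le a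
    calc 1 + (s.mem a).size + t + t'
        ≤ (3 * L + 1) + k * (3 * L + 1) + (1 + n * (1 + k)) * (3 * L + 1) := by omega
      _ = (1 + (n + 1) * (1 + k)) * (3 * L + 1) := by ring

end

/-- The result of the instruction has at most `L` bits, for operands of at most `L` bits. -/
def Op.Fits (L : ℕ) : Op → ℕ → ℕ → Prop
  | .add, x, y => x + y < 2 ^ L
  | .mul, x, y => x * y < 2 ^ L
  | .sub, _, _ | .div, _, _ | .mod, _, _ => True

attribute [local simp] Op.Fits

theorem Op.Fits.apply_lt {L : ℕ} {o : Op} {x y : ℕ} (h : o.Fits L x y) (hx : x < 2 ^ L) :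
    o.apply x y < 2 ^ L := by
  cases o with
  | add | mul => exact h
  | sub => exact (Nat.sub_le x y).trans_lt hx
  | div => exact (Nat.div_le_self x y).trans_lt hx
  | mod => exact (Nat.mod_le x y).trans_lt hx

/-- A condition on the initial state under which a program without loops and indirect addressing
halts in a state with the property `Q`, all numbers having at most `L` bits. -/
def Prog.wp (L : ℕ) : Prog → (State → Prop) → State → Prop
  | .skip, Q, s => Q s
  | .const d n, Q, s => n < 2 ^ L ∧ Q (s.put d n)
  | .arith o d a b, Q, s =>
    o.Fits L (s.mem a) (s.mem b) ∧ Q (s.put d (o.apply (s.mem a) (s.mem b)))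
  | .read d, Q, s =>
    ∃ n rest, s.input = n :: rest ∧ n < 2 ^ L ∧ Q ({ s with input := rest }.put d n)
  | .write a, Q, s => Q { s with output := s.output ++ [s.mem a] }
  | .toss d, Q, s => ∃ b rest, s.coins = b :: rest ∧ b.toNat < 2 ^ L ∧
    Q ({ s with coins := rest }.put d b.toNat)
  | .seq c₁ c₂, Q, s => c₁.wp L (c₂.wp L Q) s
  | .cond a c₁ c₂, Q, s => (s.mem a ≠ 0 → c₁.wp L Q s) ∧ (s.mem a = 0 → c₂.wp L Q s)
  | .load _ _, _, _ | .store _ _, _, _ | .loop _ _, _, _ => False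

/-- A bound for the number of instructions that a program without loops executes. A coin toss
counts twice, because it costs `2` even if no number has a digit. -/
def Prog.len : Prog → ℕ
  | .toss _ => 2
  | .seq c₁ c₂ => c₁.len + c₂.len
  | .cond _ c₁ c₂ => 1 + max c₁.len c₂.len
  | _ => 1

theorem Runs.of_wp {L : ℕ} {c : Prog} {s : State} {Q : State → Prop} (h : c.wp L Q s) :
    Runs L c s c.len Q := by
  induction c generalizing s Q with
  | skip => exact fun hs => ⟨s, _, .skip s, by simp [Prog.len], hs, h⟩
  | const d n =>
    have hn := Nat.size_le.2 h.1
    exact fun hs => ⟨_, _, .const d n s, by simp only [Prog.len]; omega, hs.put d h.1, h.2⟩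
  | arith o d a b =>
    refine fun hs => ⟨_, _, .arith o d a b s, ?_, hs.put d (h.1.apply_lt (hs a)), h.2⟩
    have ha := hs.size_le a
    have hb := hs.size_le b
    have ho := Nat.size_le.2 (h.1.apply_lt (hs a))
    simp only [Prog.len]; omega
  | read d =>
    obtain ⟨n, rest, hi, hn, h⟩ := h
    have hn' := Nat.size_le.2 hn
    exact fun hs => ⟨_, _, .read d n rest s hi, by simp only [Prog.len]; omega,
      State.Bounded.put (s := { s with input := rest }) hs d hn, h⟩
  | write a =>
    refine fun hs => ⟨_, _, .write a s, ?_, hs, h⟩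
    have ha := hs.size_le a
    simp only [Prog.len]; omega
  | toss d =>
    obtain ⟨b, rest, hc, hb, h⟩ := h
    exact fun hs => ⟨_, _, .toss d b rest s hc, by simp only [Prog.len]; omega,
      State.Bounded.put (s := { s with coins := rest }) hs d hb, h⟩
  | seq c₁ c₂ ih₁ ih₂ => exact (ih₁ h).seq fun s' _ h' => ih₂ h'
  | cond a c₁ c₂ ih₁ ih₂ =>
    exact .cond (fun ha => (ih₁ (h.1 ha)).mono (le_max_left ..) fun _ _ h => h)
      fun ha => (ih₂ (h.2 ha)).mono (le_max_right ..) fun _ _ h => h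
  | load | store | loop => exact h.elim

/-- `M[d] := M[a]`, as a subtraction, which cannot overflow. -/
def Prog.copy (d a : ℕ) : Prog := .arith .sub d a zeroCell

/-- Repeat `c` as often as the number in the cell `a` says, counting down in `a`. -/
def Prog.times (a : ℕ) (c : Prog) : Prog := .loop a (.seq c (.arith .sub a a oneCell))

/-- In the rule for counting loops, `I n` is the property that holds before the last `n` rounds. -/
theorem Runs.times {L a k n : ℕ} {c : Prog} {s : State} (I : ℕ → State → Prop)
    (hn : s.mem a = n) (hone : s.mem oneCell = 1) (hI : I n s)
    (step : ∀ i < n, ∀ s', Frame (.times a c) s s' → s'.mem a = i + 1 → I (i + 1) s' →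
      Runs L c s' k fun s'' => I i (s''.put a i))
    (ha : c.writes a = false := by rfl) (hc : (Prog.times a c).writes oneCell = false := by rfl) :
    Runs L (.times a c) s (1 + n * (2 + k)) (I 0) := by
  have hc' : c.writes oneCell = false := (Bool.or_eq_false_iff.1 hc).1
  refine (Runs.loop (k := k + 1) (fun i s' => s'.mem a = i ∧ I i s') ⟨hn, hI⟩ ?_
    fun s' _ h => h.1).mono (by rw [← add_assoc, add_right_comm 1 k, one_add_one_eq_two])
      fun s' _ h => h.2
  rintro i s' hi hf ⟨hi', hIi⟩
  refine ⟨by omega, (step i hi s' ⟨hf.mem, hf.input, hf.coins, hf.output⟩ hi' hIi).seq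
    fun s'' hf' hI' => Runs.of_wp ?_⟩
  have h₁ : s''.mem a - s''.mem oneCell = i := by
    rw [hf'.mem a ha, hf'.mem _ hc', hi', hf.mem _ hc, hone, Nat.add_sub_cancel]
  simpa [Prog.wp, h₁] using hI'

end RAM

/-! ### Packed representations -/

namespace Tower

open Finset

/-- The number with the digits `f 0, …, f (D - 1)` in base `B`, the most significant digit first,
so that dividing by `B` with remainder splits off the coefficient of the highest power of `θ` when
the digits are the coefficients of `1, θ, θ ^ 2, …`. -/
def pack (B D : ℕ) (f : ℕ → ℕ) : ℕ := ∑ i ∈ range D, f i * B ^ (D - 1 - i)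

theorem pack_zero (B : ℕ) (f : ℕ → ℕ) : pack B 0 f = 0 := by simp [pack]

theorem pack_succ (B D : ℕ) (f : ℕ → ℕ) : pack B (D + 1) f = f D + B * pack B D f := by
  rw [pack, sum_range_succ, pack, mul_sum, add_comm, Nat.add_sub_cancel, Nat.sub_self, pow_zero,
    mul_one]
  congr 1
  refine sum_congr rfl fun i hi => ?_
  have hi' := mem_range.1 hi
  rw [show D - i = D - 1 - i + 1 by omega, pow_succ]
  ring

theorem pack_succ' (B D : ℕ) (f : ℕ → ℕ) :
    pack B (D + 1) f = f 0 * B ^ D + pack B D fun i => f (i + 1) := by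
  rw [pack, sum_range_succ', add_comm, Nat.add_sub_cancel, Nat.sub_zero, pack]
  congr 1
  refine sum_congr rfl fun i _ => ?_
  rw [show D - (i + 1) = D - 1 - i by omega]

theorem pack_congr {B D : ℕ} {f g : ℕ → ℕ} (h : ∀ i < D, f i = g i) : pack B D f = pack B D g :=
  sum_congr rfl fun i hi => by rw [h i (mem_range.1 hi)]

theorem pack_lt {B D : ℕ} {f : ℕ → ℕ} (h : ∀ i < D, f i < B) : pack B D f < B ^ D := by
  induction D with
  | zero => simp [pack]
  | succ D ih =>
    have hlast := h D D.lt_succ_self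
    rw [pack_succ, pow_succ']
    calc f D + B * pack B D f < B + B * pack B D f := by omega
      _ = B * (pack B D f + 1) := by ring
      _ ≤ B * B ^ D := Nat.mul_le_mul_left _ (ih fun i hi => h i (by omega))

theorem pack_add (B D : ℕ) (f g : ℕ → ℕ) :
    pack B D (fun i => f i + g i) = pack B D f + pack B D g := by
  simp [pack, add_mul, sum_add_distrib]

theorem pack_mod {B D : ℕ} {f : ℕ → ℕ} (h : f D < B) : pack B (D + 1) f % B = f D := by
  rw [pack_succ, Nat.add_mul_mod_self_left, Nat.mod_eq_of_lt h]

theorem pack_div {B D : ℕ} {f : ℕ → ℕ} (h : f D < B) : pack B (D + 1) f / B = pack B D f := by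
  rw [pack_succ, Nat.add_mul_div_left _ _ (by omega), Nat.div_eq_of_lt h, zero_add]

theorem pack_inj {B D : ℕ} {f g : ℕ → ℕ} (hf : ∀ i < D, f i < B) (hg : ∀ i < D, g i < B)
    (h : pack B D f = pack B D g) : ∀ i < D, f i = g i := by
  induction D with
  | zero => simp
  | succ D ih =>
    have hmod := congrArg (· % B) h
    have hdiv := congrArg (· / B) h
    simp only [pack_mod (hf D D.lt_succ_self), pack_mod (hg D D.lt_succ_self),
      pack_div (hf D D.lt_succ_self), pack_div (hg D D.lt_succ_self)] at hmod hdiv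
    intro i hi
    rcases Nat.lt_succ_iff_lt_or_eq.1 hi with hi | rfl
    · exact ih (fun i hi => hf i (by omega)) (fun i hi => hg i (by omega)) hdiv i hi
    · exact hmod

theorem sum_range_add_ite {S : Type*} [AddCommMonoid S] (k u : ℕ) (f : ℕ → S) :
    (∑ i ∈ range (k + u), if k ≤ i then f i else 0) = ∑ j ∈ range u, f (k + j) := by
  rw [sum_range_add, sum_eq_zero fun i hi => if_neg (by have := mem_range.1 hi; omega), zero_add]
  exact sum_congr rfl fun j _ => if_pos (Nat.le_add_right k j)

/-- The digits of the product of two packed numbers whose base is so large that no carry occurs. -/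
def convolution (u : ℕ) (f g : ℕ → ℕ) (k : ℕ) : ℕ :=
  ∑ x ∈ range u ×ˢ range u with x.1 + x.2 = k, f x.1 * g x.2

theorem convolution_lt {u p : ℕ} {f g : ℕ → ℕ} (hu : 0 < u) (hf : ∀ i < u, f i < p)
    (hg : ∀ i < u, g i < p) (k : ℕ) : convolution u f g k < u * p ^ 2 := by
  have hp : p - 1 < p := Nat.sub_one_lt_of_lt (hf 0 hu)
  have hcard : #{x ∈ range u ×ˢ range u | x.1 + x.2 = k} ≤ u := by
    refine (card_le_card_of_injOn Prod.fst (fun x hx => ?_) fun x hx y hy hxy => ?_).trans_eq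
      (card_range u)
    · exact (mem_product.1 (mem_filter.1 hx).1).1
    · have := (mem_filter.1 hx).2.trans (mem_filter.1 hy).2.symm
      exact Prod.ext hxy (by omega)
  calc convolution u f g k ≤ _ • (p - 1) ^ 2 := sum_le_card_nsmul _ _ _ fun x hx => by
        obtain ⟨h₁, h₂⟩ := mem_product.1 (mem_filter.1 hx).1
        rw [sq]
        exact Nat.mul_le_mul (Nat.le_sub_one_of_lt (hf _ (mem_range.1 h₁)))
          (Nat.le_sub_one_of_lt (hg _ (mem_range.1 h₂)))
    _ ≤ u * (p - 1) ^ 2 := Nat.mul_le_mul_right _ hcard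
    _ < u * p ^ 2 := Nat.mul_lt_mul_of_pos_left (Nat.pow_lt_pow_left hp two_ne_zero) hu

theorem sum_mul_sum_eq_convolution {S : Type*} [CommSemiring S] (u : ℕ) (f g : ℕ → ℕ)
    (a b c : ℕ → S) (h : ∀ i < u, ∀ j < u, a i * b j = c (i + j)) :
    (∑ i ∈ range u, (f i : S) * a i) * (∑ j ∈ range u, (g j : S) * b j) =
      ∑ k ∈ range (2 * u - 1), (convolution u f g k : S) * c k := by
  have hmaps : ∀ x ∈ range u ×ˢ range u, x.1 + x.2 ∈ range (2 * u - 1) := fun x hx => by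
    simp only [mem_product, mem_range] at hx ⊢
    omega
  rw [sum_mul_sum, ← sum_product', ← sum_fiberwise_of_maps_to hmaps]
  refine sum_congr rfl fun k _ => ?_
  rw [convolution, Nat.cast_sum, sum_mul]
  refine sum_congr rfl fun x hx => ?_
  simp only [mem_filter, mem_product, mem_range] at hx
  rw [← hx.2, ← h _ hx.1.1 _ hx.1.2, Nat.cast_mul]
  ring

section

variable {F : Type*} [CommSemiring F]

/-- The number `Z` is a packed representation, with digits below `R`, of the element `x`, as a
combination of `1, θ, …, θ ^ (D - 1)`. -/
def Rep (θ : F) (B D R Z : ℕ) (x : F) : Prop :=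
  ∃ f : ℕ → ℕ, (∀ i < D, f i < R) ∧ Z = pack B D f ∧ x = ∑ i ∈ range D, (f i : F) * θ ^ i

namespace Rep

variable {θ x x' : F} {B D R R' Z Z' u p : ℕ}

theorem lt (h : Rep θ B D R Z x) (hR : R ≤ B) : Z < B ^ D := by
  obtain ⟨f, hf, rfl, -⟩ := h
  exact pack_lt fun i hi => (hf i hi).trans_le hR

theorem val_inj (h : Rep θ B D R Z x) (h' : Rep θ B D R Z x') (hR : R ≤ B) : x = x' := by
  obtain ⟨f, hf, rfl, rfl⟩ := h
  obtain ⟨g, hg, hfg, rfl⟩ := h'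
  have heq := pack_inj (fun i hi => (hf i hi).trans_le hR) (fun i hi => (hg i hi).trans_le hR) hfg
  exact sum_congr rfl fun i hi => by rw [heq i (mem_range.1 hi)]

theorem add (h : Rep θ B D R Z x) (h' : Rep θ B D R' Z' x') :
    Rep θ B D (R + R') (Z + Z') (x + x') := by
  obtain ⟨f, hf, rfl, rfl⟩ := h
  obtain ⟨g, hg, rfl, rfl⟩ := h'
  exact ⟨fun i => f i + g i, fun i hi => Nat.add_lt_add (hf i hi) (hg i hi),
    (pack_add _ _ _ _).symm, by simp [add_mul, sum_add_distrib]⟩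

theorem natCast_mul {d : ℕ} (h : Rep θ B D R Z x) (hd : ∀ n < R, d * n < R') :
    Rep θ B D R' (d * Z) (d * x) := by
  obtain ⟨f, hf, rfl, rfl⟩ := h
  exact ⟨fun i => d * f i, fun i hi => hd _ (hf i hi), by simp [pack, mul_sum, mul_assoc],
    by simp [mul_sum, mul_assoc]⟩

theorem pow_mul (h : Rep θ B D R Z x) (hR : 0 < R) (k : ℕ) :
    Rep θ B (k + D) R Z (θ ^ k * x) := by
  obtain ⟨f, hf, rfl, rfl⟩ := h
  refine ⟨fun i => if k ≤ i then f (i - k) else 0, fun i hi => ?_, ?_, ?_⟩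
  · dsimp only
    split_ifs
    exacts [hf _ (by omega), hR]
  · simp only [pack, ite_mul, zero_mul]
    rw [sum_range_add_ite]
    refine sum_congr rfl fun j _ => ?_
    rw [Nat.add_sub_cancel_left, show k + D - 1 - (k + j) = D - 1 - j by omega]
  · simp only [Nat.cast_ite, Nat.cast_zero, ite_mul, zero_mul]
    rw [sum_range_add_ite, mul_sum]
    refine sum_congr rfl fun j _ => ?_
    rw [Nat.add_sub_cancel_left, pow_add]
    ring

theorem split_top (h : Rep θ B (D + 1) R Z x) (hR : R ≤ B) :
    ∃ y, Rep θ B D R (Z / B) y ∧ x = y + (Z % B : ℕ) * θ ^ D := by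
  obtain ⟨f, hf, rfl, rfl⟩ := h
  have hD : f D < B := (hf D D.lt_succ_self).trans_le hR
  rw [pack_mod hD, pack_div hD]
  exact ⟨_, ⟨f, fun i hi => hf i (by omega), rfl, rfl⟩, sum_range_succ _ _⟩

theorem mul (hu : 0 < u) (h : Rep θ B u p Z x) (h' : Rep θ B u p Z' x') :
    Rep θ B (2 * u - 1) (u * p ^ 2) (Z * Z') (x * x') := by
  obtain ⟨f, hf, rfl, rfl⟩ := h
  obtain ⟨g, hg, rfl, rfl⟩ := h'
  refine ⟨convolution u f g, fun k _ => convolution_lt hu hf hg k, ?_,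
    sum_mul_sum_eq_convolution u f g _ _ _ fun i _ j _ => (pow_add θ i j).symm⟩
  have hexp : ∀ i < u, ∀ j < u,
      B ^ (u - 1 - i) * B ^ (u - 1 - j) = B ^ (2 * u - 1 - 1 - (i + j)) := fun i hi j hj => by
    rw [← pow_add]
    congr 1
    omega
  exact sum_mul_sum_eq_convolution (S := ℕ) u f g _ _ (fun k => B ^ (2 * u - 1 - 1 - k)) hexp

theorem natCast {n : ℕ} (hu : 0 < u) (hn : n < p) :
    Rep θ B u p (n * B ^ (u - 1)) (n : F) := by
  obtain ⟨v, rfl⟩ := Nat.exists_eq_add_of_lt hu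
  refine ⟨Pi.single 0 n, fun i _ => ?_, ?_, ?_⟩
  · rcases eq_or_ne i 0 with rfl | hi
    · simpa using hn
    · simpa [hi] using n.zero_le.trans_lt hn
  · rw [zero_add, pack_succ']
    simp [pack]
  · rw [zero_add, sum_range_succ']
    simp

end Rep

/-- The element given by the lowest `u` digits of `n` in base `p`. -/
def elt (θ : F) (p u n : ℕ) : F := ∑ i ∈ range u, ((n / p ^ i % p : ℕ) : F) * θ ^ i

theorem rep_elt {p : ℕ} (hp : 0 < p) (θ : F) (B u n : ℕ) :
    Rep θ B u p (pack B u fun i => n / p ^ i % p) (elt θ p u n) :=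
  ⟨_, fun _ _ => Nat.mod_lt _ hp, rfl, rfl⟩

end

variable {F : Type*} [CommRing F] {p u : ℕ} {c : ℕ → ℕ} {θ : F}

/-- The powers `1, θ, …, θ ^ (u - 1)` are linearly independent over the residues modulo the odd
number `p`, which vanishes in `F`, and `θ` is a zero of the monic polynomial of degree `u` with the
lower coefficients `c 0, …, c (u - 1)`. -/
structure Presents (p u : ℕ) (c : ℕ → ℕ) (θ : F) : Prop where
  two_lt : 2 < p
  pos : 0 < u
  lt : ∀ j < u, c j < p
  cast_eq : (p : F) = 0
  rel : θ ^ u + ∑ j ∈ range u, (c j : F) * θ ^ j = 0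
  inj : ∀ f g : ℕ → ℕ, (∀ i < u, f i < p) → (∀ i < u, g i < p) →
    ∑ i ∈ range u, (f i : F) * θ ^ i = ∑ i ∈ range u, (g i : F) * θ ^ i → ∀ i < u, f i = g i

namespace Presents

theorem cast_mod (h : Presents p u c θ) (n : ℕ) : ((n % p : ℕ) : F) = n := by
  conv_rhs => rw [← Nat.mod_add_div n p]
  simp [h.cast_eq]

theorem code_inj (h : Presents p u c θ) {B Z Z' : ℕ} {x : F} (hZ : Rep θ B u p Z x)
    (hZ' : Rep θ B u p Z' x) : Z = Z' := by
  obtain ⟨f, hf, rfl, rfl⟩ := hZ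
  obtain ⟨g, hg, rfl, hfg⟩ := hZ'
  exact pack_congr (h.inj f g hf hg hfg)

theorem rep_one (h : Presents p u c θ) (B : ℕ) : Rep θ B u p (B ^ (u - 1)) 1 := by
  simpa using Rep.natCast (θ := θ) (B := B) h.pos (one_lt_two.trans h.two_lt)

theorem rep_neg_one (h : Presents p u c θ) (B : ℕ) :
    Rep θ B u p ((p - 1) * B ^ (u - 1)) (-1) := by
  have hp := h.two_lt
  simpa [Nat.cast_sub (show 1 ≤ p by omega), h.cast_eq] using
    Rep.natCast (θ := θ) (B := B) (n := p - 1) h.pos (by omega)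

theorem rep_pow (h : Presents p u c θ) (B : ℕ) :
    Rep θ B u (p + 1) (pack B u (p - c ·)) (θ ^ u) := by
  refine ⟨_, fun j _ => Nat.lt_succ_of_le (Nat.sub_le p (c j)), rfl, ?_⟩
  rw [eq_neg_of_add_eq_zero_left h.rel, ← sum_neg_distrib]
  refine sum_congr rfl fun j hj => ?_
  rw [Nat.cast_sub (h.lt j (mem_range.1 hj)).le, h.cast_eq]
  ring

/-- The highest power of `θ` is rewritten by means of the relation that `θ` satisfies. -/
theorem rep_reduce (h : Presents p u c θ) {B D R Z : ℕ} {x : F} (hZ : Rep θ B (D + 1) R Z x)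
    (hD : u ≤ D) (hR : R ≤ B) :
    Rep θ B D (R + p ^ 2) (Z / B + Z % B % p * pack B u (p - c ·)) x := by
  obtain ⟨k, rfl⟩ := Nat.exists_eq_add_of_le' hD
  obtain ⟨y, hy, rfl⟩ := hZ.split_top hR
  have hd : Z % B % p < p := Nat.mod_lt _ (by have := h.two_lt; omega)
  have hmul : ∀ n < p + 1, Z % B % p * n < p ^ 2 := fun n hn => by
    rw [sq]
    exact (Nat.mul_le_mul_left _ (Nat.le_of_lt_succ hn)).trans_lt
      (Nat.mul_lt_mul_of_pos_right hd (by omega))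
  convert hy.add (((h.rep_pow B).natCast_mul hmul).pow_mul (pow_pos (by omega) 2) k) using 2
  rw [h.cast_mod, pow_add]
  ring

end Presents

end Tower

/-! ### Field arithmetic -/

namespace Tower

open RAM Finset

attribute [local simp] Prog.block Prog.wp Prog.copy Op.apply Op.Fits

/-- A base in which no carry occurs when two products of packed elements are added and reduced. -/
abbrev base (p u : ℕ) : ℕ := 4 * u * p ^ 2

/-- The bit bound `L` suffices for the computation in the field with the given presentation, with
`ℓ` variables and failure probability at most `2 ^ (-e)`. -/
structure Setup {F : Type*} [CommRing F] (p u ℓ e L : ℕ) (c : ℕ → ℕ) (θ : F) : Prop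
    extends Presents p u c θ where
  base_pow_le : base p u ^ (2 * u + 2) ≤ 2 ^ L
  trials_le : (e + 1) * 2 ^ 20 ≤ 2 ^ L
  length_le : ℓ + 4 ≤ 2 ^ L

/-- The contents of the cells that are computed once for all. -/
structure Constants (p u ℓ e : ℕ) (c : ℕ → ℕ) (s : State) : Prop where
  zero : s.mem zeroCell = 0
  one : s.mem oneCell = 1
  two : s.mem twoCell = 2
  prime : s.mem primeCell = p
  degree : s.mem degreeCell = u
  length : s.mem lengthCell = ℓ
  trials : s.mem trialsCell = e
  base : s.mem baseCell = base p u
  tail : s.mem tailCell = pack (Tower.base p u) u (p - c ·)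
  unit : s.mem unitCell = Tower.base p u ^ (u - 1)
  order : s.mem orderCell = p ^ u

theorem Constants.frame {p u ℓ e : ℕ} {c : ℕ → ℕ} {P : Prog} {s s' : State}
    (h : Constants p u ℓ e c s) (hf : Frame P s s')
    (hP : ∀ r < 11, P.writes r = false := by decide) : Constants p u ℓ e c s' := by
  constructor <;> rw [hf.mem _ (hP _ (by norm_num))]
  exacts [h.zero, h.one, h.two, h.prime, h.degree, h.length, h.trials, h.base, h.tail, h.unit,
    h.order]

variable {F : Type*} [CommRing F] {p u ℓ e L : ℕ} {c : ℕ → ℕ} {θ : F}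

namespace Setup

theorem three_mul_mul_lt_base (h : Setup p u ℓ e L c θ) : 3 * (p * u) < base p u := by
  have hp := h.two_lt
  have hpu := Nat.mul_pos (zero_lt_two.trans hp) h.pos
  calc 3 * (p * u) < 4 * p * (p * u) := Nat.mul_lt_mul_of_pos_right (by omega) hpu
    _ = base p u := by rw [base]; ring

theorem p_lt_base (h : Setup p u ℓ e L c θ) : p < base p u :=
  (Nat.le_mul_of_pos_right p h.pos).trans_lt
    ((Nat.le_mul_of_pos_left _ three_pos).trans_lt h.three_mul_mul_lt_base)

theorem u_lt_base (h : Setup p u ℓ e L c θ) : u < base p u :=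
  (Nat.le_mul_of_pos_left u (zero_lt_two.trans h.two_lt)).trans_lt
    ((Nat.le_mul_of_pos_left _ three_pos).trans_lt h.three_mul_mul_lt_base)

theorem nine_lt_base (h : Setup p u ℓ e L c θ) : 9 < base p u := by
  have hp := h.two_lt
  have hpu := Nat.le_mul_of_pos_right p h.pos
  have := h.three_mul_mul_lt_base
  omega

theorem lt_of_lt_pow (h : Setup p u ℓ e L c θ) {n k : ℕ} (hn : n < base p u ^ k)
    (hk : k ≤ 2 * u + 2) : n < 2 ^ L :=
  hn.trans_le ((Nat.pow_le_pow_right (by have := h.nine_lt_base; omega) hk).trans h.base_pow_le)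

theorem base_pow_lt (h : Setup p u ℓ e L c θ) {k : ℕ} (hk : k ≤ 2 * u + 1) :
    base p u ^ k < 2 ^ L :=
  h.lt_of_lt_pow (Nat.pow_lt_pow_right (by have := h.nine_lt_base; omega) k.lt_succ_self)
    (by omega)

theorem base_lt (h : Setup p u ℓ e L c θ) : base p u < 2 ^ L := by
  simpa using h.base_pow_lt (k := 1) (by omega)

theorem rep_lt (h : Setup p u ℓ e L c θ) {D R Z : ℕ} {x : F} (hZ : Rep θ (base p u) D R Z x)
    (hR : R ≤ base p u) (hD : D ≤ 2 * u + 2) : Z < 2 ^ L := h.lt_of_lt_pow (hZ.lt hR) hD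

end Setup

/-- Rewrite the highest power of `θ` in the unreduced element in `productCell`. -/
def reduceTop : Prog := .block
  [.arith .mod digitCell productCell baseCell, .arith .mod digitCell digitCell primeCell,
    .arith .div productCell productCell baseCell, .arith .mul digitCell digitCell tailCell,
    .arith .add productCell productCell digitCell]

theorem reduceTop_runs (h : Setup p u ℓ e L c θ) {s : State} (hc : Constants p u ℓ e c s)
    {D R : ℕ} {x : F} (hx : Rep θ (base p u) (D + 1) R (s.mem productCell) x) (hD : u ≤ D)
    (hD' : D ≤ 2 * u) (hR : R + p ^ 2 ≤ base p u) :
    Runs L reduceTop s 5 fun s' => Rep θ (base p u) D (R + p ^ 2) (s'.mem productCell) x := by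
  have hnew := h.rep_reduce hx hD (by omega)
  have hlt := h.rep_lt hnew hR (by omega)
  refine Runs.of_wp ?_
  simpa [reduceTop, hc.base, hc.prime, hc.tail, hlt, hnew] using
    (Nat.le_add_left _ _).trans_lt hlt

/-- Rewrite all powers of `θ` with exponents at least `u` in the product in `productCell`. -/
def reduceDegree : Prog := .block
  [.arith .sub counterCell degreeCell oneCell, .times counterCell reduceTop]

theorem reduceDegree_runs (h : Setup p u ℓ e L c θ) {s : State} (hc : Constants p u ℓ e c s)
    {R : ℕ} (hR : R ≤ 3 * u * p ^ 2) {x : F}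
    (hx : Rep θ (base p u) (2 * u - 1) R (s.mem productCell) x) :
    Runs L reduceDegree s (2 + 7 * (u - 1)) fun s' =>
      Rep θ (base p u) u (base p u) (s'.mem productCell) x := by
  have hu := h.pos
  have hbound : ∀ n < u, R + n * p ^ 2 ≤ base p u := fun n hn => by
    have : n * p ^ 2 ≤ u * p ^ 2 := Nat.mul_le_mul_right _ hn.le
    rw [base]
    nlinarith
  have hsucc : ∀ n < u - 1, R + (u - 1 - (n + 1)) * p ^ 2 + p ^ 2 = R + (u - 1 - n) * p ^ 2 :=
    fun n hn => by rw [add_assoc, ← Nat.succ_mul, show (u - 1 - (n + 1)).succ = u - 1 - n by omega]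
  refine Runs.mono (k := 1 + (1 + (u - 1) * (2 + 5)))
    (Q := fun t => Rep θ (base p u) (u + 0) (R + (u - 1 - 0) * p ^ 2) (t.mem productCell) x)
    (Runs.seq (Q₁ := fun t => t.mem counterCell = u - 1 ∧ t.mem productCell = s.mem productCell)
      (.of_wp (by simp [hc.degree, hc.one])) fun s₁ hf₁ ⟨hn, hprod⟩ => ?_) (by omega)
    fun _ _ ⟨f, hf, hrep⟩ => ⟨f, fun i hi => (hf i hi).trans_le (hbound _ (by omega)), hrep⟩
  have hc₁ := hc.frame hf₁
  refine Runs.times (fun n t => Rep θ (base p u) (u + n) (R + (u - 1 - n) * p ^ 2)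
    (t.mem productCell) x) hn hc₁.one ?_ fun n hn t hf _ ht => ?_
  · rw [Nat.sub_self, zero_mul, add_zero, ← Nat.add_sub_assoc hu, ← two_mul, hprod]
    exact hx
  · refine (reduceTop_runs h (hc₁.frame hf) (D := u + n) ht (by omega) (by omega) ?_).mono le_rfl
      fun t' _ ht' => ?_
    · rw [hsucc n hn]
      exact hbound _ (by omega)
    · rw [hsucc n hn] at ht'
      simpa using ht'

/-- The state of `reduceDigit` when the lowest `n` of the digits `f` are still to be reduced. -/
def DigitsReduced (p u : ℕ) (f : ℕ → ℕ) (n : ℕ) (s : State) : Prop :=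
  s.mem productCell = pack (base p u) n f ∧
  s.mem reducedCell = pack (base p u) (u - n) (fun i => f (n + i) % p) ∧
  s.mem weightCell = base p u ^ (u - n)

/-- Move the last digit from `productCell` to `reducedCell`, reducing it modulo `p`. -/
def reduceDigit : Prog := .block
  [.arith .mod digitCell productCell baseCell, .arith .mod digitCell digitCell primeCell,
    .arith .div productCell productCell baseCell, .arith .mul digitCell digitCell weightCell,
    .arith .add reducedCell reducedCell digitCell, .arith .mul weightCell weightCell baseCell]

theorem reduceDigit_runs (h : Setup p u ℓ e L c θ) {s : State} (hc : Constants p u ℓ e c s)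
    {f : ℕ → ℕ} (hf : ∀ i < u, f i < base p u) {n : ℕ} (hn : n < u)
    (hs : DigitsReduced p u f (n + 1) s) :
    Runs L reduceDigit s 6 (DigitsReduced p u f n) := by
  obtain ⟨hprod, hred, hweight⟩ := hs
  have hsub : u - n = u - (n + 1) + 1 := by omega
  have hstep : pack (base p u) (u - (n + 1)) (fun i => f (n + 1 + i) % p) +
      f n % p * base p u ^ (u - (n + 1)) = pack (base p u) (u - n) fun i => f (n + i) % p := by
    rw [hsub, pack_succ', add_comm, add_zero]
    simp only [add_assoc, add_comm 1]
  have hlt : pack (base p u) (u - n) (fun i => f (n + i) % p) < 2 ^ L :=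
    h.lt_of_lt_pow (pack_lt fun i _ => (Nat.mod_lt _ (zero_lt_two.trans h.two_lt)).trans
      h.p_lt_base) (by omega)
  have hweight' : base p u ^ (u - (n + 1)) * base p u = base p u ^ (u - n) := by
    rw [hsub, pow_succ]
  have hpow := h.base_pow_lt (k := u - n) (by omega)
  refine Runs.of_wp ?_
  simpa [reduceDigit, DigitsReduced, hc.base, hc.prime, hprod, hred, hweight, pack_mod (hf n hn),
    pack_div (hf n hn), hstep, hweight', hlt, hpow] using
    (Nat.le_add_left _ _).trans_lt (hstep.trans_lt hlt)

/-- Reduce the digits of the number in `productCell` modulo `p`, in `reducedCell`. -/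
def reduceDigits : Prog := .block
  [.block [.copy counterCell degreeCell, .const reducedCell 0, .copy weightCell oneCell],
    .times counterCell reduceDigit]

theorem reduceDigits_runs (h : Setup p u ℓ e L c θ) {s : State} (hc : Constants p u ℓ e c s) {x : F}
    (hx : Rep θ (base p u) u (base p u) (s.mem productCell) x) :
    Runs L reduceDigits s (4 + 8 * u) fun s' => Rep θ (base p u) u p (s'.mem reducedCell) x := by
  obtain ⟨f, hf, hZ, rfl⟩ := hx
  refine (Runs.seq (Q₁ := fun t => t.mem counterCell = u ∧ DigitsReduced p u f u t)
    (.of_wp (by simp [DigitsReduced, hc.degree, hc.zero, hc.one, hZ, pack_zero]))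
    fun s₁ hf₁ ⟨hn, hdig⟩ => ?_).mono (k := 3 + (1 + u * (2 + 6))) (by omega) fun _ _ h => h
  have hc₁ := hc.frame hf₁
  refine (Runs.times (DigitsReduced p u f) hn hc₁.one hdig fun n hn t hf' _ ht =>
    (reduceDigit_runs h (hc₁.frame hf') hf hn ht).mono le_rfl fun t' _ ht' => by
      simpa [DigitsReduced] using ht').mono le_rfl fun s' _ hs' => ?_
  exact ⟨fun i => f i % p, fun i _ => Nat.mod_lt _ (zero_lt_two.trans h.two_lt),
    by simpa using hs'.2.1, by simp only [h.cast_mod]⟩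

/-- Replace the unreduced element in `productCell` by its reduced representation, in
`reducedCell`. -/
def reduce : Prog := .seq reduceDegree reduceDigits

theorem reduce_runs (h : Setup p u ℓ e L c θ) {s : State} (hc : Constants p u ℓ e c s) {R : ℕ}
    (hR : R ≤ 3 * u * p ^ 2) {x : F} (hx : Rep θ (base p u) (2 * u - 1) R (s.mem productCell) x) :
    Runs L reduce s (15 * u + 6) fun s' => Rep θ (base p u) u p (s'.mem reducedCell) x :=
  ((reduceDegree_runs h hc hR hx).seq fun _ hf hs => reduceDigits_runs h (hc.frame hf) hs).mono
    (by omega) fun _ _ h => h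

/-- `M[d] := M[a] * M[b]`, for packed elements. -/
def fieldMul (d a b : ℕ) : Prog := .block
  [.arith .mul productCell a b, reduce, .copy d reducedCell]

theorem fieldMul_runs (h : Setup p u ℓ e L c θ) {s : State} (hc : Constants p u ℓ e c s)
    {d a b : ℕ} {x y : F} (hx : Rep θ (base p u) u p (s.mem a) x)
    (hy : Rep θ (base p u) u p (s.mem b) y) :
    Runs L (fieldMul d a b) s (15 * u + 8) fun s' => Rep θ (base p u) u p (s'.mem d) (x * y) := by
  have hR : u * p ^ 2 ≤ 3 * u * p ^ 2 := Nat.mul_le_mul_right _ (by omega)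
  have hxy := hx.mul h.pos hy
  have hlt := h.rep_lt hxy (by rw [base]; nlinarith) (by omega)
  refine (Runs.seq (Q₁ := fun t => t.mem productCell = s.mem a * s.mem b)
    (.of_wp (by simpa using hlt)) fun s₁ hf₁ hprod => ?_).mono
      (k := 1 + ((15 * u + 6) + 1)) (by omega) fun _ _ h => h
  have hc₁ := hc.frame hf₁ fun r hr => beq_false_of_ne (by omega)
  exact (reduce_runs h hc₁ hR (by rwa [hprod])).seq fun s₂ hf₂ hred =>
    .of_wp (by simpa [(hc₁.frame hf₂).zero] using hred)

/-- Move the lowest digit from `numberCell` to `packedCell`. -/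
def packDigit : Prog := .block
  [.arith .mod digitCell numberCell primeCell, .arith .div numberCell numberCell primeCell,
    .arith .mul packedCell packedCell baseCell, .arith .add packedCell packedCell digitCell]

/-- The state of `packDigit` when `n` of the digits of `m` have been moved. -/
def DigitsPacked (p u m n : ℕ) (s : State) : Prop :=
  s.mem numberCell = m / p ^ n ∧ s.mem packedCell = pack (base p u) n fun i => m / p ^ i % p

theorem packDigit_runs (h : Setup p u ℓ e L c θ) {s : State} (hc : Constants p u ℓ e c s)
    {m n : ℕ} (hn : n < u) (hs : DigitsPacked p u m n s) :
    Runs L packDigit s 4 (DigitsPacked p u m (n + 1)) := by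
  have hstep : pack (base p u) (n + 1) (fun i => m / p ^ i % p) =
      pack (base p u) n (fun i => m / p ^ i % p) * base p u + m / p ^ n % p := by
    rw [pack_succ]
    ring
  have hlt : pack (base p u) (n + 1) (fun i => m / p ^ i % p) < 2 ^ L :=
    h.rep_lt (rep_elt (zero_lt_two.trans h.two_lt) θ _ _ _) h.p_lt_base.le (by omega)
  have hdiv : m / p ^ n / p = m / p ^ (n + 1) := by rw [Nat.div_div_eq_div_mul, pow_succ]
  refine Runs.of_wp ?_
  simpa [packDigit, DigitsPacked, hc.base, hc.prime, hs.1, hs.2, ← hstep, hdiv, hlt] using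
    (Nat.le_add_right _ _).trans_lt (hstep ▸ hlt)

/-- `M[d] :=` the packed element whose coordinates are the digits of `M[a]` in base `p`. -/
def toField (d a : ℕ) : Prog := .block
  [.block [.copy counterCell degreeCell, .copy numberCell a, .const packedCell 0],
    .times counterCell packDigit, .copy d packedCell]

theorem toField_runs (h : Setup p u ℓ e L c θ) {s : State} (hc : Constants p u ℓ e c s) {d a : ℕ}
    (ha : counterCell ≠ a) :
    Runs L (toField d a) s (6 * u + 5) fun s' =>
      Rep θ (base p u) u p (s'.mem d) (elt θ p u (s.mem a)) := by
  refine (Runs.seq (Q₁ := fun t => t.mem counterCell = u ∧ DigitsPacked p u (s.mem a) 0 t)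
    (.of_wp (by simp [DigitsPacked, hc.degree, hc.zero, pack_zero, ha.symm]))
    fun s₁ hf₁ ⟨hn, hdig⟩ => ?_).mono (k := 3 + (1 + u * (2 + 4) + 1)) (by omega) fun _ _ h => h
  have hc₁ := hc.frame hf₁ fun r hr => by interval_cases r <;> rfl
  refine (Runs.times (fun n => DigitsPacked p u (s.mem a) (u - n)) hn hc₁.one
    (by rwa [Nat.sub_self]) fun n hn t hf _ ht =>
      (packDigit_runs h (hc₁.frame hf) (by omega) ht).mono le_rfl fun t' _ ht' => ?_).seq
        fun s₂ hf₂ hs₂ => .of_wp ?_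
  · rw [show u - (n + 1) + 1 = u - n by omega] at ht'
    simpa [DigitsPacked] using ht'
  · rw [tsub_zero] at hs₂
    simpa [(hc₁.frame hf₂).zero, hs₂.2] using rep_elt (zero_lt_two.trans h.two_lt) θ (base p u) u _

end Tower

/-! ### Testing a pair of field elements -/

namespace Tower

open RAM Finset

attribute [local simp] Prog.block Prog.wp Prog.copy Op.apply Op.Fits

variable {F : Type*} [CommRing F] {p u ℓ e L : ℕ} {c : ℕ → ℕ} {θ : F}

/-- The state of the exponentiation by squaring that computes `y`. -/
def PowersTo (θ : F) (p u : ℕ) (y : F) (s : State) : Prop :=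
  ∃ r b, Rep θ (base p u) u p (s.mem resultCell) r ∧ Rep θ (base p u) u p (s.mem powerCell) b ∧
    r * b ^ s.mem exponentCell = y

/-- A round of the exponentiation by squaring. -/
def squareMultiply : Prog := .block
  [.arith .mod parityCell exponentCell twoCell,
    .cond parityCell (fieldMul resultCell resultCell powerCell) .skip,
    fieldMul powerCell powerCell powerCell, .arith .div exponentCell exponentCell twoCell]

theorem squareMultiply_runs (h : Setup p u ℓ e L c θ) {s : State} (hc : Constants p u ℓ e c s)
    {y : F} (hs : PowersTo θ p u y s) :
    Runs L squareMultiply s (30 * u + 19) fun s' =>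
      s'.mem exponentCell = s.mem exponentCell / 2 ∧ PowersTo θ p u y s' := by
  obtain ⟨r, b, hr, hb, hy⟩ := hs
  have hdiv := Nat.mod_add_div (s.mem exponentCell) 2
  refine (Runs.seq (Q₁ := fun t => t.mem parityCell = s.mem exponentCell % 2)
    (.of_wp (by simp [hc.two])) fun s₁ hf₁ hpar => ?_).mono
      (k := 1 + ((1 + (15 * u + 8)) + ((15 * u + 8) + 1))) (by omega) fun _ _ h => h
  have hc₁ := hc.frame hf₁
  rw [← hf₁.mem resultCell rfl] at hr
  rw [← hf₁.mem powerCell rfl] at hb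
  rw [← hf₁.mem exponentCell rfl] at hpar hdiv hy ⊢
  refine Runs.seq (Q₁ := fun t => ∃ r', Rep θ (base p u) u p (t.mem resultCell) r' ∧
    r' * (b * b) ^ (s₁.mem exponentCell / 2) = y) (.cond (fun hodd => ?_) fun heven => ?_)
      fun s₂ hf₂ ⟨r', hr', hy'⟩ => ?_
  · refine (fieldMul_runs h hc₁ hr hb).mono le_rfl fun t _ ht => ⟨r * b, ht, ?_⟩
    rw [← hy, mul_assoc, ← sq, ← pow_mul, ← pow_succ']
    congr 2
    omega
  · refine Runs.mono (k := 1) (.of_wp (c := .skip) ?_) (Nat.le_add_left 1 _) fun _ _ ht => ht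
    refine ⟨r, hr, ?_⟩
    rw [← hy, ← sq, ← pow_mul]
    congr 2
    omega
  · have hc₂ := hc₁.frame hf₂
    rw [← hf₂.mem powerCell rfl] at hb
    rw [← hf₂.mem exponentCell rfl] at hy' ⊢
    refine (fieldMul_runs h hc₂ hb hb).seq fun s₃ hf₃ hbb => .of_wp ?_
    rw [← hf₃.mem resultCell rfl] at hr'
    rw [← hf₃.mem exponentCell rfl] at hy' ⊢
    simpa [PowersTo, (hc₂.frame hf₃).two] using ⟨r', hr', b * b, hbb, hy'⟩

theorem size_div_two {m n : ℕ} (h : m.size = n + 1) : (m / 2).size = n := by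
  have hbit : Nat.bit m.bodd (m / 2) = m := by rw [← Nat.div2_val, Nat.bit_bodd_div2]
  have hm : m ≠ 0 := by
    rintro rfl
    simp at h
  have hsize := Nat.size_bit (hbit ▸ hm)
  rw [hbit, h] at hsize
  omega

/-- `M[resultCell] := M[powerCell] ^ (p ^ u / 2)`, for packed elements. -/
def halfPow : Prog := .block
  [.block [.arith .div exponentCell orderCell twoCell, .copy resultCell unitCell],
    .loop exponentCell squareMultiply]

theorem halfPow_runs (h : Setup p u ℓ e L c θ) {s : State} (hc : Constants p u ℓ e c s) {x : F}
    (hx : Rep θ (base p u) u p (s.mem powerCell) x) :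
    Runs L halfPow s (3 + (p ^ u / 2).size * (30 * u + 20)) fun s' =>
      Rep θ (base p u) u p (s'.mem resultCell) (x ^ (p ^ u / 2)) := by
  refine (Runs.seq (Q₁ := fun t => t.mem exponentCell = p ^ u / 2 ∧
    PowersTo θ p u (x ^ (p ^ u / 2)) t) (.of_wp ?_) fun s₁ hf₁ ⟨hexp, hpow⟩ => ?_).mono
      (k := 2 + (1 + (p ^ u / 2).size * (1 + (30 * u + 19)))) (by ring_nf; rfl) fun _ _ h => h
  · simpa [PowersTo, hc.order, hc.two, hc.zero, hc.unit] using
      ⟨1, h.rep_one _, x, hx, one_mul _⟩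
  have hc₁ := hc.frame hf₁
  refine (Runs.loop (fun n t => (t.mem exponentCell).size = n ∧
    PowersTo θ p u (x ^ (p ^ u / 2)) t) ⟨congrArg _ hexp, hpow⟩ (fun n t _ hf ht => ⟨?_, ?_⟩)
      fun t _ ht => Nat.size_eq_zero.1 ht.1).mono le_rfl fun t _ ht => ?_
  · exact fun h0 => absurd ht.1 (by simp [h0])
  · exact (squareMultiply_runs h (hc₁.frame hf) ht.2).mono le_rfl fun t' _ ht' =>
      ⟨ht'.1 ▸ size_div_two ht.1, ht'.2⟩
  · obtain ⟨r, b, hr, -, heq⟩ := ht.2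
    rw [Nat.size_eq_zero.1 ht.1, pow_zero, mul_one] at heq
    rwa [← heq]

/-- The sum of the squares of the elements given by the digits of `x` and of `y`. -/
def sumSq (θ : F) (p u x y : ℕ) : F :=
  elt θ p u x * elt θ p u x + elt θ p u y * elt θ p u y

/-- A pair of numbers is good if the sum of the squares of its elements is not a square; this is
decided by Euler's criterion. -/
def Good (θ : F) (p u x y : ℕ) : Prop := sumSq θ p u x y ^ (p ^ u / 2) = -1

/-- A good pair and its sum of squares have been stored, and the flag has been set. -/
def Found (θ : F) (p u : ℕ) (s : State) : Prop :=
  s.mem foundCell = 1 ∧ ∃ x y, Good θ p u x y ∧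
    Rep θ (base p u) u p (s.mem foundFstCell) (elt θ p u x) ∧
    Rep θ (base p u) u p (s.mem foundSndCell) (elt θ p u y) ∧
    Rep θ (base p u) u p (s.mem foundSumSqCell) (sumSq θ p u x y)

/-- The cells of `Found` have the same contents in both states. -/
def SameFound (s s' : State) : Prop := ∀ r, 50 ≤ r → r < 54 → s'.mem r = s.mem r

theorem SameFound.trans {s₁ s₂ s₃ : State} (h : SameFound s₁ s₂) (h' : SameFound s₂ s₃) :
    SameFound s₁ s₃ := fun r h₁ h₂ => (h' r h₁ h₂).trans (h r h₁ h₂)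

theorem SameFound.of_frame {P : Prog} {s s' : State} (h : Frame P s s')
    (hP : ∀ r < 54, 50 ≤ r → P.writes r = false := by decide) : SameFound s s' :=
  fun r h₁ h₂ => h.mem r (hP r h₂ h₁)

theorem SameFound.found {s s' : State} (h : SameFound s s') (hs : Found θ p u s) :
    Found θ p u s' := by
  rw [Found] at hs ⊢
  rwa [h 50 (by norm_num) (by norm_num), h 51 (by norm_num) (by norm_num),
    h 52 (by norm_num) (by norm_num), h 53 (by norm_num) (by norm_num)]

/-- The elements given by `x` and `y`, and the sum of their squares, have been computed. -/
def SquaresAdded (θ : F) (p u x y : ℕ) (s : State) : Prop :=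
  Rep θ (base p u) u p (s.mem fstEltCell) (elt θ p u x) ∧
  Rep θ (base p u) u p (s.mem sndEltCell) (elt θ p u y) ∧
  Rep θ (base p u) u p (s.mem sumSqCell) (sumSq θ p u x y)

theorem SquaresAdded.frame {x y : ℕ} {P : Prog} {s s' : State} (h : SquaresAdded θ p u x y s)
    (hf : Frame P s s') (hP : ∀ r < 45, 42 ≤ r → P.writes r = false := by decide) :
    SquaresAdded θ p u x y s' := by
  rw [SquaresAdded] at h ⊢
  rwa [hf.mem 42 (hP 42 (by norm_num) (by norm_num)), hf.mem 43 (hP 43 (by norm_num) (by norm_num)),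
    hf.mem 44 (hP 44 (by norm_num) (by norm_num))]

/-- Convert the pair of numbers to field elements, and add the squares. -/
def addSquares : Prog := .block
  [toField fstEltCell fstCell, toField sndEltCell sndCell,
    .block [.arith .mul productCell fstEltCell fstEltCell,
      .arith .mul digitCell sndEltCell sndEltCell, .arith .add productCell productCell digitCell],
    reduce, .copy sumSqCell reducedCell]

theorem addSquares_runs (h : Setup p u ℓ e L c θ) {s : State} (hc : Constants p u ℓ e c s) :
    Runs L addSquares s (27 * u + 20) (SquaresAdded θ p u (s.mem fstCell) (s.mem sndCell)) := by
  have hR : u * p ^ 2 + u * p ^ 2 ≤ 3 * u * p ^ 2 := by nlinarith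
  refine Runs.mono (k := (6 * u + 5) + ((6 * u + 5) + (3 + ((15 * u + 6) + 1))))
    ((toField_runs h hc (by decide)).seq fun s₁ hf₁ hx => ?_) (by omega) fun _ _ h => h
  have hc₁ := hc.frame hf₁
  refine (toField_runs h hc₁ (by decide)).seq fun s₂ hf₂ hy => ?_
  have hc₂ := hc₁.frame hf₂
  rw [← hf₂.mem fstEltCell rfl] at hx
  rw [hf₁.mem sndCell rfl] at hy
  have hsum := (hx.mul h.pos hx).add (hy.mul h.pos hy)
  have hlt := h.rep_lt hsum (hR.trans (by rw [base]; nlinarith)) (by omega)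
  refine Runs.seq (Q₁ := fun t => t.mem productCell = s₂.mem fstEltCell * s₂.mem fstEltCell +
    s₂.mem sndEltCell * s₂.mem sndEltCell) (.of_wp ?_) fun s₃ hf₃ hprod => ?_
  · simpa [hlt] using ⟨(Nat.le_add_right _ _).trans_lt hlt, (Nat.le_add_left _ _).trans_lt hlt⟩
  have hc₃ := hc₂.frame hf₃
  rw [← hf₃.mem fstEltCell rfl] at hx
  rw [← hf₃.mem sndEltCell rfl] at hy
  refine (reduce_runs h hc₃ hR (by rwa [hprod])).seq fun s₄ hf₄ hred => .of_wp ?_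
  rw [← hf₄.mem fstEltCell rfl] at hx
  rw [← hf₄.mem sndEltCell rfl] at hy
  simpa [SquaresAdded, (hc₃.frame hf₄).zero] using ⟨hx, hy, hred⟩

/-- Compare the result of `halfPow` with `-1`. -/
def compareNegOne : Prog := .block
  [.arith .sub minusOneCell primeCell oneCell, .arith .mul minusOneCell minusOneCell unitCell,
    .arith .sub differenceCell resultCell minusOneCell,
    .arith .sub minusOneCell minusOneCell resultCell,
    .arith .add differenceCell differenceCell minusOneCell]

theorem compareNegOne_runs (h : Setup p u ℓ e L c θ) {s : State} (hc : Constants p u ℓ e c s)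
    {x : F} (hx : Rep θ (base p u) u p (s.mem resultCell) x) :
    Runs L compareNegOne s 5 fun s' => s'.mem differenceCell = 0 ↔ x = -1 := by
  have hneg := h.rep_neg_one (base p u)
  have heq : s.mem resultCell = (p - 1) * base p u ^ (u - 1) ↔ x = -1 :=
    ⟨fun heq => hx.val_inj (heq ▸ hneg) h.p_lt_base.le, fun heq => h.code_inj hx (heq ▸ hneg)⟩
  have hlt := h.rep_lt hx h.p_lt_base.le (by omega)
  have hlt' := h.rep_lt hneg h.p_lt_base.le (by omega)
  refine Runs.of_wp ?_
  simp only [compareNegOne, Prog.block, Prog.wp, Op.Fits, Op.apply, State.put_mem, reduceIte,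
    Nat.reduceEqDiff, hc.prime, hc.one, hc.unit, ← heq]
  exact ⟨trivial, hlt', trivial, trivial, by omega, by omega⟩

/-- Store a good pair and the sum of its squares. -/
def store : Prog := .block
  [.copy foundFstCell fstEltCell, .copy foundSndCell sndEltCell, .copy foundSumSqCell sumSqCell,
    .copy foundCell oneCell]

theorem store_runs {s : State} (hc : Constants p u ℓ e c s) {x y : ℕ}
    (hs : SquaresAdded θ p u x y s) (hxy : Good θ p u x y) : Runs L store s 4 (Found θ p u) :=
  .of_wp (by simpa [store, Found, hc.zero, hc.one] using ⟨x, y, hxy, hs⟩)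

/-- Test the pair of numbers in `fstCell` and `sndCell`, and store it if it is good. -/
def testPair : Prog := .block
  [addSquares, .copy powerCell sumSqCell, halfPow, compareNegOne, .cond differenceCell .skip store]

theorem testPair_runs (h : Setup p u ℓ e L c θ) {s : State} (hc : Constants p u ℓ e c s) :
    Runs L testPair s (34 + 27 * u + (p ^ u / 2).size * (30 * u + 20)) fun s' =>
      (Good θ p u (s.mem fstCell) (s.mem sndCell) → Found θ p u s') ∧
      (¬ Good θ p u (s.mem fstCell) (s.mem sndCell) → SameFound s s') := by
  refine Runs.mono (k := (27 * u + 20) + (1 + ((3 + (p ^ u / 2).size * (30 * u + 20)) +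
    (5 + (1 + 4))))) ((addSquares_runs h hc).seq fun s₁ hf₁ hs₁ => ?_) (by omega) fun _ _ h => h
  have hc₁ := hc.frame hf₁
  refine Runs.seq (Q₁ := fun t => t.mem powerCell = s₁.mem sumSqCell)
    (.of_wp (by simp [hc₁.zero])) fun s₂ hf₂ hpow => ?_
  have hc₂ := hc₁.frame hf₂
  refine (halfPow_runs h hc₂ (hpow ▸ hs₁.2.2)).seq fun s₃ hf₃ hres => ?_
  have hc₃ := hc₂.frame hf₃
  refine (compareNegOne_runs h hc₃ hres).seq fun s₄ hf₄ hdiff => ?_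
  have hsame : SameFound s s₄ :=
    ((SameFound.of_frame hf₁).trans (.of_frame hf₂)).trans ((SameFound.of_frame hf₃).trans
      (.of_frame hf₄))
  refine .cond (fun hne => ?_) fun h0 => ?_
  · refine Runs.mono (k := 1) (.of_wp (c := .skip) ?_) (by decide) fun _ _ ht => ht
    exact ⟨fun hgood => absurd (hdiff.2 hgood) hne, fun _ => hsame⟩
  · have hgood := hdiff.1 h0
    exact (store_runs (hc₃.frame hf₄) (((hs₁.frame hf₂).frame hf₃).frame hf₄) hgood).mono le_rfl
      fun _ _ ht => ⟨fun _ => ht, fun hbad => absurd hgood hbad⟩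

end Tower

/-! ### Searching for a good pair -/

namespace Tower

open RAM Finset

attribute [local simp] Prog.block Prog.wp Prog.copy Op.apply Op.Fits

variable {F : Type*} [CommRing F] {p u ℓ e L M : ℕ} {c : ℕ → ℕ} {θ : F}

/-- The coordinate `x` after a step of the walk, in which the bits `b₁` and `b₂` decide whether
`y` and whether `1` is added. -/
def shifted (M x y : ℕ) (b₁ b₂ : Bool) : ℕ := (x + b₁.toNat * y + b₂.toNat) % M

theorem shifted_lt (hM : 0 < M) (x y : ℕ) (b₁ b₂ : Bool) : shifted M x y b₁ b₂ < M :=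
  Nat.mod_lt _ hM

/-- Some of the first `n` pairs of the walk from `(x, y)` with the given random bits satisfies
`good`. -/
def Walk (good : ℕ → ℕ → Prop) (M : ℕ) : ℕ → ℕ → ℕ → List Bool → Prop
  | n + 1, x, y, b₁ :: b₂ :: b₃ :: b₄ :: w => good x y ∨
      Walk good M n (shifted M x y b₁ b₂) (shifted M y (shifted M x y b₁ b₂) b₃ b₄) w
  | _, _, _, _ => False

/-- Apply a random step of the walk to the coordinate in `a`, the other one being in `b`. -/
def shift (a b : ℕ) : Prog := .block
  [.toss bitCell, .arith .mul bitCell bitCell b, .arith .add a a bitCell, .toss bitCell,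
    .arith .add a a bitCell, .arith .mod a a rangeCell]

theorem shift_runs {s : State} {a b : ℕ} {b₁ b₂ : Bool} {w : List Bool} (hM : 4 * M ≤ 2 ^ L)
    (hrange : s.mem rangeCell = M) (ha : s.mem a < M) (hb : s.mem b < M)
    (hw : s.coins = b₁ :: b₂ :: w) (ha' : a ≠ bitCell ∧ a ≠ rangeCell := by decide)
    (hb' : b ≠ bitCell := by decide) :
    Runs L (shift a b) s 8 fun s' =>
      s'.mem a = shifted M (s.mem a) (s.mem b) b₁ b₂ ∧ s'.coins = w := by
  have hb₁ := b₁.toNat_le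
  have hb₂ := b₂.toNat_le
  have hmul : b₁.toNat * s.mem b ≤ 1 * M := Nat.mul_le_mul hb₁ hb.le
  refine Runs.of_wp ?_
  simp only [shift, Prog.block, Prog.wp, State.put_mem, State.put_coins, Op.apply, Op.Fits,
    reduceIte, hw, List.cons.injEq, exists_and_left, exists_eq_left', and_assoc,
    ha'.1, ha'.1.symm, ha'.2.symm, hb', hrange, shifted, Nat.reduceEqDiff, true_and, and_true]
  omega

/-- The invariant of the search, before its last `n` rounds: a good pair among the first ones of
the walk has been stored. Here `W` says that there is a good pair in the whole walk. -/
structure Searching (θ : F) (p u M : ℕ) (W : Prop) (n : ℕ) (s : State) : Prop where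
  fst_lt : s.mem fstCell < M
  snd_lt : s.mem sndCell < M
  coins_length : s.coins.length = 4 * n
  flag : s.mem foundCell = 0 ∨ Found θ p u s
  found_or : W → Found θ p u s ∨ Walk (Good θ p u) M n (s.mem fstCell) (s.mem sndCell) s.coins

/-- A round of the search. -/
def searchStep : Prog := .block [testPair, shift fstCell sndCell, shift sndCell fstCell]

theorem exists_bits {w : List Bool} {n : ℕ} (h : w.length = 4 * (n + 1)) :
    ∃ b₁ b₂ b₃ b₄ w', w = b₁ :: b₂ :: b₃ :: b₄ :: w' ∧ w'.length = 4 * n := by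
  match w, h with
  | b₁ :: b₂ :: b₃ :: b₄ :: w', h =>
    exact ⟨b₁, b₂, b₃, b₄, w', rfl, by simp only [List.length_cons] at h; omega⟩
  | [_, _, _], h | [_, _], h | [_], h | [], h =>
    simp only [List.length_cons, List.length_nil] at h; omega

theorem searchStep_runs (h : Setup p u ℓ e L c θ) {s : State} (hc : Constants p u ℓ e c s)
    (hM : 4 * M ≤ 2 ^ L) (hrange : s.mem rangeCell = M) {W : Prop} {n : ℕ}
    (hs : Searching θ p u M W (n + 1) s) :
    Runs L searchStep s (50 + 27 * u + (p ^ u / 2).size * (30 * u + 20))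
      (Searching θ p u M W n) := by
  obtain ⟨b₁, b₂, b₃, b₄, w, hw, hwn⟩ := exists_bits hs.coins_length
  have hM0 : 0 < M := (Nat.zero_le _).trans_lt hs.fst_lt
  refine ((testPair_runs h hc).seq fun s₁ hf₁ ⟨hgood, hbad⟩ => ?_).mono
    (k := (34 + 27 * u + (p ^ u / 2).size * (30 * u + 20)) + (8 + 8)) (by omega) fun _ _ h => h
  have hfst := hf₁.mem fstCell rfl
  have hsnd := hf₁.mem sndCell rfl
  have hkeep : Found θ p u s → Found θ p u s₁ := fun hfound => by
    by_cases hg : Good θ p u (s.mem fstCell) (s.mem sndCell)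
    exacts [hgood hg, (hbad hg).found hfound]
  have hflag : s₁.mem foundCell = 0 ∨ Found θ p u s₁ := by
    by_cases hg : Good θ p u (s.mem fstCell) (s.mem sndCell)
    exacts [.inr (hgood hg), hs.flag.imp (hbad hg foundCell (by decide) (by decide)).trans hkeep]
  refine (shift_runs hM ((hf₁.mem rangeCell rfl).trans hrange) (hfst.trans_lt hs.fst_lt)
    (hsnd.trans_lt hs.snd_lt) ((hf₁.coins rfl).trans hw)).seq fun s₂ hf₂ ⟨hx, hw₂⟩ => ?_
  have hsnd₂ := (hf₂.mem sndCell rfl).trans hsnd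
  rw [hfst, hsnd] at hx
  refine (shift_runs hM ((hf₂.mem rangeCell rfl).trans ((hf₁.mem rangeCell rfl).trans hrange))
    (hsnd₂.trans_lt hs.snd_lt) (hx ▸ shifted_lt hM0 ..) hw₂).mono le_rfl
      fun s₃ hf₃ ⟨hy, hw₃⟩ => ?_
  have hsame : SameFound s₁ s₃ := .trans (.of_frame hf₂) (.of_frame hf₃)
  rw [← hf₃.mem fstCell rfl] at hx hy
  rw [hsnd₂, hx] at hy
  refine ⟨hx ▸ shifted_lt hM0 .., hy ▸ shifted_lt hM0 .., by rw [hw₃, hwn],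
    hflag.imp (hsame foundCell (by decide) (by decide)).trans hsame.found, fun hW => ?_⟩
  rcases hs.found_or hW with hfound | hwalk
  · exact .inl (hsame.found (hkeep hfound))
  rw [hw] at hwalk
  exact hwalk.imp (fun hg => hsame.found (hgood hg)) fun hwalk => by rwa [hw₃, hy, hx]

/-- The number of pairs of the walk that are tested if the failure probability may be at most
`2 ^ (-e)`. -/
def walkLength (e : ℕ) : ℕ := e * 2 ^ 19 + 1

/-- Test the pairs of the walk that starts with the pair in `fstCell` and `sndCell`. -/
def search : Prog := .block
  [.block [.const digitCell (2 ^ 19), .arith .mul walkCell trialsCell digitCell,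
    .arith .add walkCell walkCell oneCell], .times walkCell searchStep]

theorem search_runs (h : Setup p u ℓ e L c θ) {s : State} (hc : Constants p u ℓ e c s)
    (hM : 4 * M ≤ 2 ^ L) (hrange : s.mem rangeCell = M) (hx : s.mem fstCell < M)
    (hy : s.mem sndCell < M) (hflag : s.mem foundCell = 0)
    (hw : s.coins.length = 4 * walkLength e) :
    Runs L search s (4 + walkLength e *
      (52 + 27 * u + (p ^ u / 2).size * (30 * u + 20))) fun s' =>
      (Walk (Good θ p u) M (walkLength e) (s.mem fstCell) (s.mem sndCell) s.coins →
        Found θ p u s') ∧ (s'.mem foundCell = 0 ∨ Found θ p u s') := by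
  have hL := h.trials_le
  refine (Runs.seq (k₁ := 3) (Q₁ := fun t => t.mem walkCell = walkLength e) (.of_wp ?_)
    fun s₁ hf₁ hwalk => Runs.times (k := 50 + 27 * u + (p ^ u / 2).size * (30 * u + 20))
      (Searching θ p u M (Walk (Good θ p u) M (walkLength e)
      (s.mem fstCell) (s.mem sndCell) s.coins)) hwalk (hc.frame hf₁).one ?_
        fun n _ s₂ hf₂ _ hs₂ => ?_).mono (by ring_nf; rfl) fun s' _ hs' =>
          ⟨fun hW => (hs'.found_or hW).resolve_right (by simp [Walk]), hs'.flag⟩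
  · simp only [Prog.block, Prog.wp, State.put_mem, Op.apply, Op.Fits, reduceIte, Nat.reduceEqDiff,
      hc.trials, hc.one, walkLength, and_true]
    omega
  · rw [← hf₁.mem fstCell rfl] at hx ⊢
    rw [← hf₁.mem sndCell rfl] at hy ⊢
    rw [← hf₁.coins rfl] at hw ⊢
    exact ⟨hx, hy, hw, .inl ((hf₁.mem foundCell rfl).trans hflag), .inr⟩
  · refine (searchStep_runs h ((hc.frame hf₁).frame hf₂) hM ((hf₂.mem rangeCell rfl).trans
      ((hf₁.mem rangeCell rfl).trans hrange)) hs₂).mono le_rfl fun s₃ _ hs₃ => ?_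
    have hsame : SameFound s₃ (s₃.put walkCell n) := fun r h₁ _ => by simp; omega
    exact ⟨hs₃.fst_lt, hs₃.snd_lt, hs₃.coins_length, hs₃.flag.imp_right hsame.found,
      fun hW => (hs₃.found_or hW).imp_left hsame.found⟩

/-- The pair of numbers with the given leading parts and `n` further binary digits each that are
read from a string of random bits, and the rest of the string. -/
def draw : ℕ → ℕ → ℕ → List Bool → ℕ × ℕ × List Bool
  | n + 1, x, y, b₁ :: b₂ :: w => draw n (x * 2 + b₁.toNat) (y * 2 + b₂.toNat) w
  | _, x, y, w => (x, y, w)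

/-- Double the range of the random pair, and append a random binary digit to each number. -/
def drawRound : Prog := .block
  [.arith .mul rangeCell rangeCell twoCell,
    .toss bitCell, .arith .mul fstCell fstCell twoCell, .arith .add fstCell fstCell bitCell,
    .toss bitCell, .arith .mul sndCell sndCell twoCell, .arith .add sndCell sndCell bitCell,
    .arith .sub remainingCell boundCell rangeCell]

/-- Draw a random pair of numbers below the smallest power of two that is at least `16 * p ^ u`. -/
def drawPair : Prog := .block
  [.block [.const digitCell 16, .arith .mul boundCell digitCell orderCell,
      .copy rangeCell oneCell, .copy fstCell zeroCell, .copy sndCell zeroCell,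
      .arith .sub remainingCell boundCell rangeCell],
    .loop remainingCell drawRound]

/-- The invariant of `drawPair`, before its last `n` rounds, if it uses `b` rounds on the random
bits `w` and leaves `R` of them. -/
structure Drawing (N b R : ℕ) (w : List Bool) (n : ℕ) (s : State) : Prop where
  le : n ≤ b
  remaining : s.mem remainingCell = N - 2 ^ (b - n)
  range : s.mem rangeCell = 2 ^ (b - n)
  fst_lt : s.mem fstCell < 2 ^ (b - n)
  snd_lt : s.mem sndCell < 2 ^ (b - n)
  coins_length : s.coins.length = 2 * n + R
  draw_eq : draw b 0 0 w = draw n (s.mem fstCell) (s.mem sndCell) s.coins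

theorem exists_two_bits {w : List Bool} {m : ℕ} (h : w.length = m + 2) :
    ∃ b₁ b₂ w', w = b₁ :: b₂ :: w' ∧ w'.length = m := by
  match w, h with
  | b₁ :: b₂ :: w', h => exact ⟨b₁, b₂, w', rfl, by simpa using h⟩
  | [_], h | [], h => simp at h

theorem drawRound_runs {N b R : ℕ} {w : List Bool} {n : ℕ} {s : State}
    (htwo : s.mem twoCell = 2) (hbound : s.mem boundCell = N) (hbL : 2 ^ b < 2 ^ L)
    (hs : Drawing N b R w (n + 1) s) : Runs L drawRound s 10 (Drawing N b R w n) := by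
  obtain ⟨b₁, b₂, w', hw, hw'⟩ := exists_two_bits
    (hs.coins_length.trans (by ring : _ = 2 * n + R + 2))
  have hle := hs.le
  have hrange := hs.range
  have hx := hs.fst_lt
  have hy := hs.snd_lt
  have hdraw := hs.draw_eq
  rw [hw, draw] at hdraw
  have hpow : 2 ^ (b - n) ≤ 2 ^ b := Nat.pow_le_pow_right two_pos (Nat.sub_le _ _)
  have htwice : 2 ^ (b - (n + 1)) * 2 = 2 ^ (b - n) := by
    rw [← pow_succ]
    congr 1
    omega
  have hb₁ := b₁.toNat_le
  have hb₂ := b₂.toNat_le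
  refine (Runs.of_wp (Q := fun t => t.mem remainingCell = N - 2 ^ (b - n) ∧
    t.mem rangeCell = 2 ^ (b - n) ∧ t.mem fstCell = s.mem fstCell * 2 + b₁.toNat ∧
    t.mem sndCell = s.mem sndCell * 2 + b₂.toNat ∧ t.coins = w') ?_).mono le_rfl
      fun t _ ⟨h₁, h₂, h₃, h₄, h₅⟩ => ⟨by omega, h₁, h₂, by omega, by omega, by rw [h₅, hw'],
        by rwa [h₃, h₄, h₅]⟩
  simp only [drawRound, Prog.block, Prog.wp, State.put_mem, State.put_coins, Op.apply, Op.Fits,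
    reduceIte, Nat.reduceEqDiff, hrange, htwo, hbound, hw, htwice, List.cons.injEq,
    exists_and_left, exists_eq_left', and_assoc, true_and, and_true]
  omega

theorem drawPair_runs (h : Setup p u ℓ e L c θ) {s : State} (hc : Constants p u ℓ e c s)
    {b R : ℕ} (hb : 16 * p ^ u ≤ 2 ^ b) (hb' : ∀ j < b, 2 ^ j < 16 * p ^ u)
    (hbL : 2 ^ b < 2 ^ L) (hw : s.coins.length = 2 * b + R) :
    Runs L drawPair s (7 + b * 11) fun s' => s'.mem rangeCell = 2 ^ b ∧
      s'.mem fstCell < 2 ^ b ∧ s'.mem sndCell < 2 ^ b ∧ s'.coins.length = R ∧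
      draw b 0 0 s.coins = (s'.mem fstCell, s'.mem sndCell, s'.coins) := by
  have hL := h.trials_le
  refine (Runs.seq (k₁ := 6) (Q₁ := fun t => t.mem boundCell = 16 * p ^ u ∧
    Drawing (16 * p ^ u) b R s.coins b t) ?_ fun s₁ hf₁ ⟨hbound, hs₁⟩ => Runs.loop (k := 10)
      (Drawing (16 * p ^ u) b R s.coins) hs₁ (fun n s₂ _ hf₂ hs₂ => ⟨?_, ?_⟩) fun t _ ht => ?_).mono
        (by ring_nf; rfl) fun t _ ht => ?_
  · refine (Runs.of_wp (Q := fun t => t.mem boundCell = 16 * p ^ u ∧ t.mem rangeCell = 1 ∧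
      t.mem fstCell = 0 ∧ t.mem sndCell = 0 ∧ t.mem remainingCell = 16 * p ^ u - 1) ?_).mono
        le_rfl fun t hf ⟨h₁, h₂, h₃, h₄, h₅⟩ => ⟨h₁, ?_⟩
    · simp only [Prog.block, Prog.wp, Prog.copy, State.put_mem, Op.apply, Op.Fits, reduceIte,
        Nat.reduceEqDiff, hc.order, hc.one, hc.zero, and_true]
      omega
    · constructor <;> simp_all [hf.coins rfl]
  · have := hb' (b - (n + 1)) (Nat.sub_lt_self n.succ_pos hs₂.le)
    rw [hs₂.remaining]
    omega
  · exact drawRound_runs ((hc.frame hf₁).frame hf₂).two ((hf₂.mem boundCell rfl).trans hbound) hbL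
      hs₂
  · rw [ht.remaining, Nat.sub_zero, Nat.sub_eq_zero_of_le hb]
  · exact ⟨ht.range, ht.fst_lt, ht.snd_lt, by simpa using ht.coins_length,
      ht.draw_eq.trans (by simp [draw])⟩

end Tower

/-! ### Writing the polynomials -/

namespace Tower

open RAM Finset

attribute [local simp] Prog.block Prog.wp Prog.copy Op.apply Op.Fits

theorem pack_div_pow {B D : ℕ} {f : ℕ → ℕ} (h : ∀ i < D, f (i + 1) < B) :
    pack B (D + 1) f / B ^ D = f 0 := by
  have hlt := pack_lt h
  rw [pack_succ', add_comm, Nat.add_mul_div_right _ _ ((Nat.zero_le _).trans_lt hlt),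
    Nat.div_eq_of_lt hlt, zero_add]

theorem pack_mod_pow {B D : ℕ} {f : ℕ → ℕ} (h : ∀ i < D, f (i + 1) < B) :
    pack B (D + 1) f % B ^ D = pack B D fun i => f (i + 1) := by
  rw [pack_succ', Nat.mul_comm, Nat.mul_add_mod, Nat.mod_eq_of_lt (pack_lt h)]

variable {F : Type*} [CommRing F] {p u ℓ e L : ℕ} {c : ℕ → ℕ} {θ : F}

/-- The code of a term in which only the variable with the index `i` occurs, with exponent `v`,
and whose coefficient has the coordinates `f 0, …, f (u - 1)`. -/
def termCode (ℓ u v i : ℕ) (f : ℕ → ℕ) : List ℕ :=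
  (List.range ℓ).map (fun j => if j = i then v else 0) ++ (List.range u).map f

/-- Write the exponents of a term in which the variable in `varCell` has the exponent in
`expCell`. -/
def writeExponents : Prog := .block
  [.block [.copy counterCell lengthCell, .copy positionCell zeroCell],
    .times counterCell (.block
      [.arith .sub digitCell positionCell varCell, .arith .sub reducedCell varCell positionCell,
        .arith .add digitCell digitCell reducedCell, .arith .sub digitCell oneCell digitCell,
        .arith .mul digitCell digitCell expCell, .write digitCell,
        .arith .add positionCell positionCell oneCell])]

theorem one_sub_dist_mul (i j v : ℕ) :
    (1 - (j - i + (i - j))) * v = if j = i then v else 0 := by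
  split_ifs with h
  · simp [h]
  · rw [show 1 - (j - i + (i - j)) = 0 by omega, zero_mul]

theorem writeExponents_runs (h : Setup p u ℓ e L c θ) {s : State} (hc : Constants p u ℓ e c s)
    (hv : s.mem expCell < 3) (hi : s.mem varCell ≤ ℓ) :
    Runs L writeExponents s (3 + ℓ * 9) fun s' => s'.output = s.output ++
      (List.range ℓ).map fun j => if j = s.mem varCell then s.mem expCell else 0 := by
  have hL := h.length_le
  refine (Runs.seq (k₁ := 2) (Q₁ := fun t => t.mem counterCell = ℓ ∧ t.mem positionCell = 0 ∧
    t.output = s.output) (.of_wp (by simp [hc.length, hc.zero])) fun s₁ hf₁ ⟨hn, hpos, hout⟩ =>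
      Runs.times (k := 7) (fun n t => n ≤ ℓ ∧ t.mem positionCell = ℓ - n ∧ t.output = s.output ++
        (List.range (ℓ - n)).map fun j => if j = s.mem varCell then s.mem expCell else 0)
        hn (hc.frame hf₁).one (by simp [hpos, hout]) fun n hnℓ t hf _ ⟨_, hpos, hout⟩ =>
          .of_wp ?_).mono (by ring_nf; rfl) fun t _ ht => by simpa using ht.2.2
  have hvar : t.mem varCell = s.mem varCell := (hf.mem _ rfl).trans (hf₁.mem _ rfl)
  have hexp : t.mem expCell = s.mem expCell := (hf.mem _ rfl).trans (hf₁.mem _ rfl)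
  have hnext : ℓ - n = ℓ - (n + 1) + 1 := by omega
  have hval : (if ℓ - (n + 1) = s.mem varCell then s.mem expCell else 0) < 2 ^ L := by
    split_ifs <;> omega
  simp only [Prog.block, Prog.wp, State.put_mem, State.put_output, Op.apply, Op.Fits, reduceIte,
    Nat.reduceEqDiff, ((hc.frame hf₁).frame hf).one, hpos, hvar, hexp, hout, one_sub_dist_mul,
    true_and]
  refine ⟨by omega, hval, by omega, hnℓ.le, hnext.symm, ?_⟩
  simp [hnext, List.range_succ]

/-- Write the coordinates of the element in `coeffCell`. -/
def writeCoefficient : Prog := .block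
  [.block [.copy counterCell degreeCell, .copy weightCell unitCell],
    .times counterCell (.block
      [.arith .div digitCell coeffCell weightCell, .write digitCell,
        .arith .mod coeffCell coeffCell weightCell, .arith .div weightCell weightCell baseCell])]

theorem writeCoefficient_runs (h : Setup p u ℓ e L c θ) {s : State}
    (hc : Constants p u ℓ e c s) {f : ℕ → ℕ} (hf : ∀ j < u, f j < p)
    (hs : s.mem coeffCell = pack (base p u) u f) :
    Runs L writeCoefficient s (3 + u * 6) fun s' =>
      s'.output = s.output ++ (List.range u).map f := by
  have hB : 0 < base p u := (Nat.zero_le _).trans_lt h.p_lt_base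
  refine (Runs.seq (k₁ := 2) (Q₁ := fun t => t.mem counterCell = u ∧
    t.mem weightCell = base p u ^ (u - 1) ∧ t.mem coeffCell = pack (base p u) u f ∧
    t.output = s.output) (.of_wp (by simp [hc.degree, hc.unit, hc.zero, hs]))
      fun s₁ hf₁ ⟨hn, hweight, hcoeff, hout⟩ =>
      Runs.times (k := 4) (fun n t => n ≤ u ∧ t.mem weightCell = base p u ^ n / base p u ∧
        t.mem coeffCell = pack (base p u) n (fun j => f (u - n + j)) ∧
        t.output = s.output ++ (List.range (u - n)).map f)
        hn (hc.frame hf₁).one ?_ fun n hnu t hft _ ⟨_, hweight, hcoeff, hout⟩ =>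
          .of_wp ?_).mono (by ring_nf; rfl) fun t _ ht => by simpa using ht.2.2.2
  · simp [hweight, hcoeff, hout, ← Nat.pow_sub_one hB.ne' h.pos.ne']
  have hnext : u - n = u - (n + 1) + 1 := by omega
  have hlt : ∀ i < n, f (u - (n + 1) + (i + 1)) < base p u :=
    fun i hi => (hf _ (by omega)).trans h.p_lt_base
  rw [Nat.pow_succ, Nat.mul_div_cancel _ hB] at hweight
  simp only [Prog.block, Prog.wp, State.put_mem, State.put_output, Op.apply, Op.Fits, reduceIte,
    Nat.reduceEqDiff, ((hc.frame hf₁).frame hft).base, hweight, hcoeff, hout,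
    pack_div_pow (f := fun j => f (u - (n + 1) + j)) hlt,
    pack_mod_pow (f := fun j => f (u - (n + 1) + j)) hlt, true_and, add_zero]
  refine ⟨hnu.le, ?_, by simp [hnext, List.range_succ]⟩
  simp only [hnext, add_assoc, add_comm 1]

/-- Write the term with the variable in `varCell`, the exponent in `expCell`, and the coefficient
in `coeffCell`. -/
def writeTerm : Prog := .block [writeExponents, writeCoefficient]

theorem writeTerm_runs (h : Setup p u ℓ e L c θ) {s : State} (hc : Constants p u ℓ e c s)
    {f : ℕ → ℕ} {v i : ℕ} (hf : ∀ j < u, f j < p) (hcoeff : s.mem coeffCell = pack (base p u) u f)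
    (hexp : s.mem expCell = v) (hvar : s.mem varCell = i) (hv : v < 3) (hi : i ≤ ℓ) :
    Runs L writeTerm s (6 + ℓ * 9 + u * 6) fun s' =>
      s'.output = s.output ++ termCode ℓ u v i f := by
  subst hexp hvar
  refine ((writeExponents_runs h hc hv hi).seq fun s₁ hf₁ hout₁ =>
    (writeCoefficient_runs h (hc.frame hf₁) hf ((hf₁.mem coeffCell rfl).trans hcoeff)).mono le_rfl
      fun s₂ _ hout₂ => ?_).mono (by ring_nf; rfl) fun _ _ h => h
  rw [hout₂, hout₁, termCode, List.append_assoc]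

/-- The digits of `1`. -/
def oneDigits (i : ℕ) : ℕ := if i = 0 then 1 else 0

theorem oneDigits_lt (h : 1 < p) (j : ℕ) : oneDigits j < p := by
  unfold oneDigits
  split_ifs <;> omega

theorem pack_oneDigits (B : ℕ) {u : ℕ} (hu : 0 < u) : pack B u oneDigits = B ^ (u - 1) := by
  obtain ⟨v, rfl⟩ := Nat.exists_eq_succ_of_ne_zero hu.ne'
  rw [Nat.succ_eq_add_one, pack_succ', add_tsub_cancel_right]
  simp [pack, oneDigits]

theorem pack_const_zero (B D : ℕ) : pack B D (fun _ => 0) = 0 := by simp [pack]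

/-- The code of the polynomial `w_i ^ 2 + A + B * w_{i-1}`, where `A` and `B` have the digits `f`
and `g`. -/
def polyCode (ℓ u i : ℕ) (f g : ℕ → ℕ) : List ℕ :=
  3 :: (termCode ℓ u 2 i oneDigits ++ (termCode ℓ u 0 i f ++ termCode ℓ u 1 (i - 1) g))

/-- Write the polynomial with the number in `indexCell` and the coefficients in `fstCoeffCell` and
`sndCoeffCell`. -/
def writePoly : Prog := .block
  [.block [.const digitCell 3, .write digitCell, .copy expCell twoCell, .copy varCell indexCell,
      .copy coeffCell unitCell], writeTerm,
    .block [.copy expCell zeroCell, .copy coeffCell fstCoeffCell], writeTerm,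
    .block [.copy expCell oneCell, .arith .sub varCell indexCell oneCell,
      .copy coeffCell sndCoeffCell], writeTerm]

theorem writePoly_runs (h : Setup p u ℓ e L c θ) {s : State} (hc : Constants p u ℓ e c s)
    {f g : ℕ → ℕ} {i : ℕ} (hi : s.mem indexCell = i) (hiℓ : i ≤ ℓ)
    (hf : ∀ j < u, f j < p) (hg : ∀ j < u, g j < p)
    (hfst : s.mem fstCoeffCell = pack (base p u) u f)
    (hsnd : s.mem sndCoeffCell = pack (base p u) u g) :
    Runs L writePoly s (28 + ℓ * 27 + u * 18) fun s' =>
      s'.output = s.output ++ polyCode ℓ u i f g := by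
  have hL := h.length_le
  have hone : ∀ j < u, oneDigits j < p := fun j _ =>
    oneDigits_lt (one_lt_two.trans h.two_lt) j
  refine Runs.mono (k := 5 + ((6 + ℓ * 9 + u * 6) + (2 + ((6 + ℓ * 9 + u * 6) + (3 +
    (6 + ℓ * 9 + u * 6)))))) (Runs.seq (Q₁ := fun t => t.mem coeffCell =
      pack (base p u) u oneDigits ∧ t.mem expCell = 2 ∧ t.mem varCell = i ∧
      t.output = s.output ++ [3]) (.of_wp ?_) fun s₁ hf₁ ⟨hcoeff₁, hexp₁, hvar₁, hout₁⟩ => ?_)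
        (by omega) fun _ _ h => h
  · simpa [hc.two, hc.zero, hc.unit, hi, pack_oneDigits _ h.pos] using by omega
  have hc₁ := hc.frame hf₁
  refine (writeTerm_runs h hc₁ hone hcoeff₁ hexp₁ hvar₁ (by decide) hiℓ).seq
    fun s₂ hf₂ hout₂ => ?_
  have hc₂ := hc₁.frame hf₂
  rw [← hf₁.mem _ rfl, ← hf₂.mem _ rfl] at hfst
  refine Runs.seq (Q₁ := fun t => t.mem coeffCell = pack (base p u) u f ∧ t.mem expCell = 0 ∧
    t.output = s₂.output) (.of_wp (by simp [hc₂.zero, hfst]))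
      fun s₃ hf₃ ⟨hcoeff₃, hexp₃, hout₃⟩ => ?_
  have hc₃ := hc₂.frame hf₃
  refine (writeTerm_runs h hc₃ hf hcoeff₃ hexp₃ ((hf₃.mem _ rfl).trans ((hf₂.mem _ rfl).trans
    hvar₁)) (by decide) hiℓ).seq fun s₄ hf₄ hout₄ => ?_
  have hc₄ := hc₃.frame hf₄
  rw [← hf₁.mem _ rfl, ← hf₂.mem _ rfl, ← hf₃.mem _ rfl, ← hf₄.mem _ rfl] at hsnd hi
  refine Runs.seq (Q₁ := fun t => t.mem coeffCell = pack (base p u) u g ∧ t.mem expCell = 1 ∧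
    t.mem varCell = i - 1 ∧ t.output = s₄.output) (.of_wp (by simp [hc₄.zero, hc₄.one, hsnd, hi]))
      fun s₅ hf₅ ⟨hcoeff₅, hexp₅, hvar₅, hout₅⟩ => ?_
  refine (writeTerm_runs h (hc₄.frame hf₅) hg hcoeff₅ hexp₅ hvar₅ (by decide)
    ((Nat.sub_le _ _).trans hiℓ)).mono le_rfl fun s₆ _ hout₆ => ?_
  simp [hout₆, hout₅, hout₄, hout₃, hout₂, hout₁, polyCode]

/-- The digits of the coefficients that belong to the variables with the indices `0, 1, 2, …`;
they are constant from the index `2` on. -/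
def coeffs (a b d : ℕ → ℕ) : ℕ → ℕ → ℕ
  | 0 => a
  | 1 => b
  | _ => d

theorem coeffs_lt {a b d : ℕ → ℕ} (ha : ∀ j < u, a j < p) (hb : ∀ j < u, b j < p)
    (hd : ∀ j < u, d j < p) : ∀ i, ∀ j < u, coeffs a b d i j < p
  | 0 => ha
  | 1 => hb
  | _ + 2 => hd

/-- Pass to the next polynomial. -/
def nextCoeffs : Prog := .block
  [.copy fstCoeffCell nextFstCoeffCell, .copy sndCoeffCell nextSndCoeffCell,
    .copy nextFstCoeffCell zeroCell, .copy nextSndCoeffCell unitCell,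
    .arith .add indexCell indexCell oneCell]

/-- Write all the polynomials. -/
def writePolys : Prog := .times polysLeftCell (.block [writePoly, nextCoeffs])

/-- The state of `writePolys` when `n` of the polynomials with the coefficients `f` and `g` are
still to be written. -/
structure WritingPolys (p u ℓ : ℕ) (f g : ℕ → ℕ → ℕ) (out : List ℕ) (n : ℕ) (s : State) :
    Prop where
  index : s.mem indexCell = ℓ - n
  fst : s.mem fstCoeffCell = pack (base p u) u (f (ℓ - n))
  snd : s.mem sndCoeffCell = pack (base p u) u (g (ℓ - n))
  nextFst : s.mem nextFstCoeffCell = pack (base p u) u (f (ℓ - n + 1))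
  nextSnd : s.mem nextSndCoeffCell = pack (base p u) u (g (ℓ - n + 1))
  output_eq : s.output =
    out ++ (List.range (ℓ - n)).flatMap fun i => polyCode ℓ u i (f i) (g i)

theorem writePolys_runs (h : Setup p u ℓ e L c θ) {s : State} (hc : Constants p u ℓ e c s)
    {f₀ f₁ g₀ g₁ : ℕ → ℕ} (hf₀ : ∀ j < u, f₀ j < p) (hf₁ : ∀ j < u, f₁ j < p)
    (hg₀ : ∀ j < u, g₀ j < p) (hg₁ : ∀ j < u, g₁ j < p) (hleft : s.mem polysLeftCell = ℓ)
    (hs : WritingPolys p u ℓ (coeffs f₀ f₁ fun _ => 0) (coeffs g₀ g₁ oneDigits) s.output ℓ s) :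
    Runs L writePolys s (1 + ℓ * (35 + ℓ * 27 + u * 18)) fun s' => s'.output = s.output ++
      (List.range ℓ).flatMap fun i =>
        polyCode ℓ u i (coeffs f₀ f₁ (fun _ => 0) i) (coeffs g₀ g₁ oneDigits i) := by
  have hL := h.length_le
  have hp := h.two_lt
  refine (Runs.times (k := 28 + ℓ * 27 + u * 18 + 5) _ hleft hc.one hs
    fun n hn t hft _ ht => ?_).mono (by ring_nf; rfl) fun t _ ht => by
      simpa using ht.output_eq
  have hct := hc.frame hft
  refine (writePoly_runs h hct ht.index (Nat.sub_le _ _)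
    (coeffs_lt hf₀ hf₁ (fun _ _ => zero_lt_two.trans hp) _)
    (coeffs_lt hg₀ hg₁ (fun j _ => oneDigits_lt (one_lt_two.trans hp) j) _) ht.fst
    ht.snd).seq fun t₁ hft₁ hout => .of_wp ?_
  have hc₁ := hct.frame hft₁
  have hindex := (hft₁.mem indexCell rfl).trans ht.index
  have hfst := (hft₁.mem nextFstCoeffCell rfl).trans ht.nextFst
  have hsnd := (hft₁.mem nextSndCoeffCell rfl).trans ht.nextSnd
  have hnext : ℓ - n = ℓ - (n + 1) + 1 := by omega
  simp only [nextCoeffs, Prog.block, Prog.wp, Prog.copy, State.put_mem, Op.apply, Op.Fits,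
    reduceIte, Nat.reduceEqDiff, hc₁.one, hc₁.zero, hc₁.unit, hindex, Nat.sub_zero, true_and]
  refine ⟨by omega, ⟨?_, ?_, ?_, ?_, ?_, ?_⟩⟩
  · simp [hnext]
  · simp [hnext, hfst]
  · simp [hnext, hsnd]
  · simp [hnext, coeffs, pack_const_zero]
  · simp [hnext, coeffs, pack_oneDigits _ h.pos]
  · simp [hout, ht.output_eq, hnext, List.range_succ]

end Tower

/-! ### The program -/

namespace Tower

open RAM Finset

attribute [local simp] Prog.block Prog.wp Prog.copy Op.apply Op.Fits

variable {F : Type*} [CommRing F] {p u ℓ e L : ℕ} {c : ℕ → ℕ} {θ : F}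

/-- Read the parameters, and compute the base. -/
def readParameters : Prog := .block
  [.read primeCell, .read degreeCell, .read lengthCell, .read trialsCell, .const oneCell 1,
    .const twoCell 2, .const baseCell 4, .arith .mul baseCell baseCell degreeCell,
    .arith .mul baseCell baseCell primeCell, .arith .mul baseCell baseCell primeCell,
    .const tailCell 0, .copy unitCell oneCell, .copy orderCell oneCell,
    .copy counterCell degreeCell]

/-- Read a coefficient of the minimal polynomial. -/
def readCoefficient : Prog := .block
  [.read digitCell, .arith .sub digitCell primeCell digitCell,
    .arith .mul tailCell tailCell baseCell, .arith .add tailCell tailCell digitCell,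
    .arith .mul unitCell unitCell baseCell, .arith .mul orderCell orderCell primeCell]

/-- Read the input, and compute the constants. -/
def readInput : Prog := .block
  [readParameters, .times counterCell readCoefficient, .arith .div unitCell unitCell baseCell]

/-- The state of `readInput` when `n` coefficients are still to be read. -/
structure Reading (p u ℓ e : ℕ) (c : ℕ → ℕ) (w : List Bool) (n : ℕ) (s : State) : Prop where
  le : n ≤ u
  zero : s.mem zeroCell = 0
  one : s.mem oneCell = 1
  two : s.mem twoCell = 2
  prime : s.mem primeCell = p
  degree : s.mem degreeCell = u
  length : s.mem lengthCell = ℓ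
  trials : s.mem trialsCell = e
  base : s.mem baseCell = base p u
  tail : s.mem tailCell = pack (Tower.base p u) (u - n) (p - c ·)
  unit : s.mem unitCell = Tower.base p u ^ (u - n)
  order : s.mem orderCell = p ^ (u - n)
  input_eq : s.input = (List.range' (u - n) n).map c
  coins_eq : s.coins = w

theorem readParameters_runs (h : Setup p u ℓ e L c θ) (w : List Bool) :
    Runs L readParameters (State.init ([p, u, ℓ, e] ++ (List.range u).map c) w) 14 fun s =>
      s.mem counterCell = u ∧ Reading p u ℓ e c w u s := by
  have hp := h.p_lt_base
  have hp' := h.two_lt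
  have hu := h.u_lt_base
  have hB := h.base_lt
  have he := h.trials_le
  have hℓ := h.length_le
  have hbase : 4 * u * p * p = base p u := by rw [base]; ring
  have hle : 4 * u * p ≤ base p u := hbase ▸ Nat.le_mul_of_pos_right _ (by omega)
  have hle' : 4 * u ≤ 4 * u * p := Nat.le_mul_of_pos_right _ (by omega)
  refine .of_wp ?_
  simp only [readParameters, Prog.block, Prog.wp, Prog.copy, State.put_mem, Op.apply, Op.Fits,
    State.init, reduceIte, Nat.reduceEqDiff, List.cons_append, List.nil_append, List.cons.injEq,
    State.put_input, exists_and_left, exists_eq_left', and_assoc, hbase, true_and, Nat.sub_zero]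
  refine ⟨by omega, by omega, by omega, by omega, by omega, by omega, by omega, by omega,
    by omega, by omega, by omega, ?_⟩
  constructor <;> simp [pack_zero, List.range_eq_range']

theorem readCoefficient_runs (h : Setup p u ℓ e L c θ) {w : List Bool} {n : ℕ} {s : State}
    (hs : Reading p u ℓ e c w (n + 1) s) :
    Runs L readCoefficient s 6 (Reading p u ℓ e c w n) := by
  have hn := hs.le
  have hsub : u - n = u - (n + 1) + 1 := by omega
  have htail : pack (base p u) (u - (n + 1)) (p - c ·) * base p u + (p - c (u - (n + 1))) =
      pack (base p u) (u - n) (p - c ·) := by rw [hsub, pack_succ, mul_comm, add_comm]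
  have hlt : pack (base p u) (u - n) (p - c ·) < 2 ^ L :=
    h.lt_of_lt_pow (pack_lt fun j _ => (Nat.sub_le _ _).trans_lt h.p_lt_base) (by omega)
  have hpow := h.base_pow_lt (k := u - n) (by omega)
  have hpow' : p ^ (u - n) ≤ base p u ^ (u - n) := Nat.pow_le_pow_left h.p_lt_base.le _
  have hinput : s.input = c (u - (n + 1)) :: (List.range' (u - n) n).map c := by
    rw [hs.input_eq, List.range'_succ, hsub]; rfl
  have hc := (h.lt (u - (n + 1)) (by omega)).trans (h.p_lt_base.trans h.base_lt)
  refine .of_wp ?_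
  simp only [readCoefficient, Prog.block, Prog.wp, State.put_mem, Op.apply, Op.Fits, reduceIte,
    Nat.reduceEqDiff, hinput, List.cons.injEq, exists_and_left, exists_eq_left', and_assoc,
    hs.prime, hs.tail, hs.base, hs.unit, hs.order, htail, ← pow_succ, ← hsub, true_and]
  refine ⟨hc, (Nat.le_add_right _ _).trans_lt (htail.trans_lt hlt), hlt, hpow,
    hpow'.trans_lt hpow, ?_⟩
  constructor <;> simp [hs.zero, hs.one, hs.two, hs.prime, hs.degree, hs.length, hs.trials,
    hs.base, hs.coins_eq, (Nat.le_of_succ_le hn)]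

theorem readInput_runs (h : Setup p u ℓ e L c θ) (w : List Bool) :
    Runs L readInput (State.init ([p, u, ℓ, e] ++ (List.range u).map c) w) (16 + u * 8)
      fun s => Constants p u ℓ e c s ∧ s.coins = w := by
  refine ((readParameters_runs h w).seq fun s₁ _ ⟨hn, hs₁⟩ => Runs.seq
    (Runs.times (k := 6) (Reading p u ℓ e c w) hn hs₁.one hs₁ fun n _ s₂ _ _ hs₂ =>
      (readCoefficient_runs h hs₂).mono le_rfl fun s₃ _ hs₃ => ?_) fun s₄ _ hs₄ => .of_wp ?_).mono
    (k := 14 + (1 + u * 8 + 1)) (by omega) fun _ _ h => h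
  · constructor <;> simp [hs₃.zero, hs₃.one, hs₃.two, hs₃.prime, hs₃.degree, hs₃.length,
      hs₃.trials, hs₃.base, hs₃.tail, hs₃.unit, hs₃.order, hs₃.input_eq, hs₃.coins_eq, hs₃.le]
  · have hB : 0 < base p u := (Nat.zero_le _).trans_lt h.p_lt_base
    refine ⟨trivial, ?_, hs₄.coins_eq⟩
    constructor <;> simp [hs₄.zero, hs₄.one, hs₄.two, hs₄.prime, hs₄.degree, hs₄.length,
      hs₄.trials, hs₄.base, hs₄.tail, hs₄.unit, hs₄.order, Nat.pow_sub_one hB.ne' h.pos.ne']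

/-- The code of the polynomials `w_i ^ 2 + A_i + B_i * w_{i-1}`, where `A₀`, `A₁` and `B₁` have the
digits `f₀`, `f₁` and `g₁`, and `B₀ = 0`, and `A_i = 0` and `B_i = 1` for `2 ≤ i`. -/
def towerCode (ℓ u : ℕ) (f₀ f₁ g₁ : ℕ → ℕ) : List ℕ :=
  1 :: (List.range ℓ).flatMap fun i =>
    polyCode ℓ u i (coeffs f₀ f₁ (fun _ => 0) i) (coeffs (fun _ => 0) g₁ oneDigits i)

/-- The digits of the coefficients `A₀`, `A₁` and `B₁` that belong to a good pair, whose elements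
are `x` and `y`. If `q` is `1` modulo `4`, the tower starts with a square root of `-(x² + y²)`. If
`q` is `3` modulo `4`, it starts with a square root `w₀` of `-1`, followed by one of
`-(x + y * w₀)`, whose norm is the nonsquare `x² + y²`. -/
structure IsTowerCoeffs (θ : F) (p u : ℕ) (f₀ f₁ g₁ : ℕ → ℕ) : Prop where
  fst_zero_lt : ∀ j < u, f₀ j < p
  fst_one_lt : ∀ j < u, f₁ j < p
  snd_one_lt : ∀ j < u, g₁ j < p
  of_good : ∃ x y, Good θ p u x y ∧
    (p ^ u % 4 = 1 ∧ ∑ j ∈ range u, (f₀ j : F) * θ ^ j = sumSq θ p u x y ∧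
        (f₁ = fun _ => 0) ∧ g₁ = oneDigits ∨
      p ^ u % 4 = 3 ∧ f₀ = oneDigits ∧ ∑ j ∈ range u, (f₁ j : F) * θ ^ j = elt θ p u x ∧
        ∑ j ∈ range u, (g₁ j : F) * θ ^ j = elt θ p u y)

/-- A correct output of the program. -/
def IsTowerCode (θ : F) (p u ℓ : ℕ) (out : List ℕ) : Prop :=
  ∃ f₀ f₁ g₁, IsTowerCoeffs θ p u f₀ f₁ g₁ ∧ out = towerCode ℓ u f₀ f₁ g₁

/-- Compute the coefficients of the first two polynomials from the good pair. -/
def initCoeffs : Prog := .block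
  [.const digitCell 4, .arith .mod digitCell orderCell digitCell,
    .arith .sub digitCell digitCell oneCell,
    .cond digitCell
      (.block [.copy fstCoeffCell unitCell, .copy nextFstCoeffCell foundFstCell,
        .copy nextSndCoeffCell foundSndCell])
      (.block [.copy fstCoeffCell foundSumSqCell, .copy nextFstCoeffCell zeroCell,
        .copy nextSndCoeffCell unitCell]),
    .copy sndCoeffCell zeroCell, .write oneCell, .copy indexCell zeroCell,
    .copy polysLeftCell lengthCell]

theorem initCoeffs_runs (h : Setup p u ℓ e L c θ) {s : State} (hc : Constants p u ℓ e c s)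
    (hodd : p ^ u % 2 = 1) (hs : Found θ p u s) (hout : s.output = []) :
    Runs L initCoeffs s 11 fun s' => s'.mem polysLeftCell = ℓ ∧ ∃ f₀ f₁ g₁,
      IsTowerCoeffs θ p u f₀ f₁ g₁ ∧ WritingPolys p u ℓ (coeffs f₀ f₁ fun _ => 0)
        (coeffs (fun _ => 0) g₁ oneDigits) [1] ℓ s' := by
  have hp := h.two_lt
  have hzero : ∀ j < u, 0 < p := fun _ _ => zero_lt_two.trans hp
  have hone : ∀ j < u, oneDigits j < p := fun j _ => oneDigits_lt (one_lt_two.trans hp) j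
  obtain ⟨-, x, y, hgood, ⟨f₁, hf₁, hfst, hx⟩, ⟨g₁, hg₁, hsnd, hy⟩, ⟨f₀, hf₀, hsum, hxy⟩⟩ := hs
  have hunit := pack_oneDigits (base p u) h.pos
  refine .of_wp ?_
  simp only [initCoeffs, Prog.block, Prog.wp, Prog.copy, Op.apply, Op.Fits, State.put_mem,
    State.put_output, reduceIte, Nat.reduceEqDiff, hc.order, hc.one, hc.zero, hc.unit, hc.length,
    hfst, hsnd, hsum, hout, true_and, Nat.sub_zero]
  refine ⟨(by norm_num : 4 < 9).trans (h.nine_lt_base.trans h.base_lt), fun hq => ?_,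
    fun hq => ?_⟩
  · refine ⟨oneDigits, f₁, g₁, ⟨hone, hf₁, hg₁, x, y, hgood, .inr ⟨by omega, rfl, hx.symm,
      hy.symm⟩⟩, ?_⟩
    constructor <;> simp [coeffs, hunit, pack_const_zero]
  · refine ⟨f₀, fun _ => 0, oneDigits, ⟨hf₀, hzero, hone, x, y, hgood, .inl ⟨by omega, hxy.symm,
      rfl, rfl⟩⟩, ?_⟩
    constructor <;> simp [coeffs, hunit, pack_const_zero]

/-- Write the polynomials that belong to the good pair. -/
def writeSuccess : Prog := .block [initCoeffs, writePolys]

theorem writeSuccess_runs (h : Setup p u ℓ e L c θ) {s : State} (hc : Constants p u ℓ e c s)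
    (hodd : p ^ u % 2 = 1) (hs : Found θ p u s) (hout : s.output = []) :
    Runs L writeSuccess s (12 + ℓ * (35 + ℓ * 27 + u * 18)) fun s' =>
      IsTowerCode θ p u ℓ s'.output := by
  have hp := zero_lt_two.trans h.two_lt
  refine ((initCoeffs_runs h hc hodd hs hout).seq fun s₁ hf₁ ⟨hleft, f₀, f₁, g₁, hcoeffs, hs₁⟩ =>
    (writePolys_runs h (hc.frame hf₁) hcoeffs.fst_zero_lt hcoeffs.fst_one_lt (fun _ _ => hp)
      hcoeffs.snd_one_lt hleft ?_).mono le_rfl fun s₂ _ hout₂ =>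
        ⟨f₀, f₁, g₁, hcoeffs, ?_⟩).mono (by omega) fun _ _ h => h
  · simpa [hs₁.output_eq] using hs₁
  · simp [hout₂, hs₁.output_eq, towerCode]

/-- The algorithm. -/
def towerProgram : Prog := .block
  [readInput, drawPair, search,
    .cond foundCell writeSuccess (.block [.copy digitCell zeroCell, .write digitCell])]

/-- A bound for the number of instructions. -/
def stepBound (u ℓ e b k : ℕ) : ℕ :=
  40 + u * 8 + b * 11 + walkLength e * (52 + 27 * u + k * (30 * u + 20)) +
    ℓ * (35 + ℓ * 27 + u * 18)

theorem four_mul_two_pow_le (h : Setup p u ℓ e L c θ) {b : ℕ}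
    (hb : ∀ j < b, 2 ^ j < 16 * p ^ u) : 4 * 2 ^ b ≤ 2 ^ L := by
  have hpow : 2 ^ b ≤ 32 * p ^ u := by
    cases b with
    | zero =>
      have := Nat.pow_pos (n := u) (zero_lt_two.trans h.two_lt)
      omega
    | succ b =>
      have := hb b b.lt_succ_self
      rw [pow_succ]
      omega
  have hB := h.nine_lt_base
  have hsq : 36 ≤ base p u ^ 2 := by nlinarith
  calc 4 * 2 ^ b ≤ 36 * 4 * p ^ u := by omega
    _ ≤ base p u ^ 2 * base p u * base p u ^ u := by
      gcongr
      · omega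
      · exact h.p_lt_base.le
    _ = base p u ^ (u + 3) := by ring
    _ ≤ 2 ^ L := (Nat.pow_le_pow_right (by omega) (by have := h.pos; omega)).trans h.base_pow_le

theorem towerProgram_runs (h : Setup p u ℓ e L c θ) (hodd : p ^ u % 2 = 1) {b : ℕ}
    (hb : 16 * p ^ u ≤ 2 ^ b) (hb' : ∀ j < b, 2 ^ j < 16 * p ^ u) {w : List Bool}
    (hw : w.length = 2 * b + 4 * walkLength e) :
    Runs L towerProgram (State.init ([p, u, ℓ, e] ++ (List.range u).map c) w)
      (stepBound u ℓ e b (p ^ u / 2).size) fun s =>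
      (IsTowerCode θ p u ℓ s.output ∨ s.output = failure) ∧
      (Walk (Good θ p u) (2 ^ b) (walkLength e) (draw b 0 0 w).1 (draw b 0 0 w).2.1
        (draw b 0 0 w).2.2 → IsTowerCode θ p u ℓ s.output) := by
  have hbL := four_mul_two_pow_le h hb'
  refine Runs.mono (k := (16 + u * 8) + ((7 + b * 11) + ((4 + walkLength e *
    (52 + 27 * u + (p ^ u / 2).size * (30 * u + 20))) + (1 + (12 +
      ℓ * (35 + ℓ * 27 + u * 18)))))) ((readInput_runs h w).seq fun s₁ hf₁ ⟨hc₁, hw₁⟩ => ?_)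
        (by unfold stepBound; omega) fun _ _ h => h
  refine (drawPair_runs h hc₁ (R := 4 * walkLength e) hb hb' (by omega) (by rwa [hw₁])).seq
    fun s₂ hf₂ ⟨hrange, hx, hy, hcoins, hdraw⟩ => ?_
  have hc₂ := hc₁.frame hf₂
  have hflag : s₂.mem foundCell = 0 := (hf₂.mem _ rfl).trans (hf₁.mem _ rfl)
  refine (search_runs h hc₂ hbL hrange hx hy hflag hcoins).seq
    fun s₃ hf₃ ⟨hwalk, hfound⟩ => ?_
  have hc₃ := hc₂.frame hf₃
  have hout : s₃.output = [] := (hf₃.output rfl).trans ((hf₂.output rfl).trans (hf₁.output rfl))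
  rw [← hw₁, hdraw]
  refine .cond (fun hne => ?_) fun h0 => ?_
  · exact (writeSuccess_runs h hc₃ hodd (hfound.resolve_left hne) hout).mono le_rfl
      fun _ _ hcode => ⟨.inl hcode, fun _ => hcode⟩
  · refine Runs.mono (k := 2) (Q := fun s => s.output = failure) (.of_wp ?_) (by omega)
      fun _ _ hfail => ⟨.inr hfail, fun hW => ?_⟩
    · simp [hc₃.zero, hout, failure]
    · exact absurd ((hwalk hW).1.symm.trans h0) one_ne_zero

theorem towerProgram_outputs (h : Setup p u ℓ e L c θ) (hodd : p ^ u % 2 = 1) {b : ℕ}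
    (hb : 16 * p ^ u ≤ 2 ^ b) (hb' : ∀ j < b, 2 ^ j < 16 * p ^ u) {w : List Bool}
    (hw : w.length = 2 * b + 4 * walkLength e) :
    ∃ out t, towerProgram.Outputs ([p, u, ℓ, e] ++ (List.range u).map c) w out t ∧
      t ≤ stepBound u ℓ e b (p ^ u / 2).size * (3 * L + 1) ∧
      (IsTowerCode θ p u ℓ out ∨ out = failure) ∧
      (Walk (Good θ p u) (2 ^ b) (walkLength e) (draw b 0 0 w).1 (draw b 0 0 w).2.1
        (draw b 0 0 w).2.2 → IsTowerCode θ p u ℓ out) := by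
  obtain ⟨s, t, hexec, ht, -, hs⟩ := towerProgram_runs h hodd hb hb' hw fun _ => Nat.two_pow_pos L
  exact ⟨s.output, t, ⟨s, hexec, rfl⟩, ht, hs⟩

end Tower

/-! ### Towers of quadratic extensions -/

namespace Tower

open MvPolynomial

section Roots

variable {K : Type*} [Field K]

theorem pow_sub_one_of_sq_pow_half {Q : ℕ} {v : K} (hQ : Q % 2 = 1)
    (hv : (v ^ 2) ^ (Q / 2) = -1) : v ^ (Q - 1) = -1 := by
  rw [← hv, ← pow_mul]
  congr 1
  omega

theorem pow_sq_sub_one_of_sq_eq_neg {Q : ℕ} {v w : K} (hQ : Q % 4 = 1) (hw : w ^ (Q - 1) = -1)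
    (hv : v ^ 2 = -w) : v ^ (Q ^ 2 - 1) = -1 := by
  obtain ⟨k, rfl⟩ : ∃ k, Q = 4 * k + 1 := ⟨Q / 4, by omega⟩
  have hexp : (4 * k + 1) ^ 2 - 1 = 2 * (4 * k) * (2 * k + 1) := by
    rw [Nat.sub_eq_iff_eq_add (Nat.one_le_pow _ _ (by omega))]
    ring
  have heven : Even (4 * k) := ⟨2 * k, by ring⟩
  rw [hexp, pow_mul, pow_mul, hv, heven.neg_pow, ← Nat.add_sub_cancel (n := 4 * k) (m := 1), hw,
    Odd.neg_one_pow ⟨k, rfl⟩]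

theorem pow_self_of_pow_sub_one {Q : ℕ} {w : K} (hQ : Q ≠ 0) (hw : w ^ (Q - 1) = -1) :
    w ^ Q = -w := by
  rw [← Nat.sub_add_cancel (Nat.one_le_iff_ne_zero.2 hQ), pow_succ, hw, neg_one_mul]

theorem pow_two_pow_mod_four {q : ℕ} (hq : q % 2 = 1) (n : ℕ) (h : q % 4 = 1 ∨ n ≠ 0) :
    q ^ 2 ^ n % 4 = 1 := by
  have hsq : q ^ 2 % 4 = 1 := by
    rcases (by omega : q % 4 = 1 ∨ q % 4 = 3) with h | h <;> simp [Nat.pow_mod, h]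
  rcases n with _ | n
  · simpa using h
  · rw [pow_succ', pow_mul, Nat.pow_mod, hsq]
    simp

/-- If `x` changes its sign under the `2 ^ n`-th power of the Frobenius map, then its orbit has
`2 ^ (n + 1)` elements. -/
theorem two_pow_dvd_of_pow_eq {q n d : ℕ} {x : K} (htwo : (2 : K) ≠ 0) (hq : q % 2 = 1)
    (hx : x ^ (q ^ 2 ^ n - 1) = -1) (hd : x ^ q ^ d = x) : 2 ^ (n + 1) ∣ d := by
  have hx0 : x ≠ 0 := by
    rintro rfl
    rw [zero_pow_eq] at hx
    split_ifs at hx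
    · exact htwo (by linear_combination hx)
    · exact neg_ne_zero.2 one_ne_zero hx.symm
  have hneg : x ^ q ^ 2 ^ n = -x := pow_self_of_pow_sub_one (pow_ne_zero _ (by omega)) hx
  have hiter (m : ℕ) : (· ^ q)^[m] x = x ^ q ^ m := congrFun (pow_iterate q m) x
  have not_periodic : ¬ Function.IsPeriodicPt (· ^ q) (2 ^ n) x := by
    rw [Function.IsPeriodicPt, Function.IsFixedPt, hiter, hneg]
    exact fun h => mul_ne_zero htwo hx0 (by linear_combination -h)
  have periodic : Function.IsPeriodicPt (· ^ q) (2 ^ (n + 1)) x := by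
    rw [Function.IsPeriodicPt, Function.IsFixedPt, hiter, pow_succ 2 n, pow_mul, sq, pow_mul, hneg,
      Odd.neg_pow (.pow (Nat.odd_iff.2 hq)), hneg, neg_neg]
  rw [← Function.minimalPeriod_eq_prime_pow (hp := ⟨Nat.prime_two⟩) not_periodic periodic]
  refine Function.IsPeriodicPt.minimalPeriod_dvd ?_
  rw [Function.IsPeriodicPt, Function.IsFixedPt, hiter, hd]

variable {F : Type*} [Field F] [Algebra F K]

theorem exists_sq_eq_neg_add_mul [IsAlgClosed K] (α β : ℕ → F) (hβ : β 0 = 0) :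
    ∃ w : ℕ → K, ∀ i, w i ^ 2 = -(algebraMap F K (α i) + algebraMap F K (β i) * w (i - 1)) := by
  choose sqrt hsqrt using fun x : K => IsAlgClosed.exists_pow_nat_eq x two_pos
  refine ⟨fun n => n.rec (sqrt (-algebraMap F K (α 0)))
    fun n y => sqrt (-(algebraMap F K (α (n + 1)) + algebraMap F K (β (n + 1)) * y)), fun i => ?_⟩
  cases i <;> simp [hβ, hsqrt]

variable [Fintype F]

local notation "q" => Fintype.card F

theorem two_pow_dvd_finrank (hq : q % 2 = 1) {B : Subalgebra F K} [Finite B] {n : ℕ} {x : K}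
    (hxB : x ∈ B) (hx : x ^ (q ^ 2 ^ n - 1) = -1) : 2 ^ (n + 1) ∣ Module.finrank F B := by
  have htwo : (2 : K) ≠ 0 := by
    have : (2 : F) ≠ 0 := Ring.two_ne_zero fun h => by
      have := FiniteField.even_card_iff_char_two.1 h
      omega
    rw [← map_ofNat (algebraMap F K)]
    exact (map_ne_zero _).2 this
  have := Fintype.ofFinite B
  let _ : Field B := (Finite.isField_of_domain B).toField
  refine two_pow_dvd_of_pow_eq htwo hq hx ?_
  rw [← Module.card_eq_pow_finrank (K := F) (V := B)]
  exact congrArg Subtype.val (FiniteField.pow_card (⟨x, hxB⟩ : B))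

theorem add_mul_pow_card {w : K} (hw : w ^ (q - 1) = -1) (a b : F) :
    (algebraMap F K a + algebraMap F K b * w) ^ q = algebraMap F K a - algebraMap F K b * w := by
  have := map_add (FiniteField.frobeniusAlgHom F K) (algebraMap F K a) (algebraMap F K b * w)
  simp only [map_mul, AlgHom.commutes, FiniteField.coe_frobeniusAlgHom] at this
  rw [this, pow_self_of_pow_sub_one Fintype.card_ne_zero hw]
  ring

/-- The coefficients `α`, `β` of the polynomials `w_i ^ 2 + α_i + β_i w_{i-1}` for which each of
the polynomials is irreducible over the field defined by the preceding ones. -/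
structure QuadraticCoeffs (α β : ℕ → F) : Prop where
  left : ∀ i, 2 ≤ i → α i = 0
  right : ∀ i, 2 ≤ i → β i = 1
  zero : β 0 = 0
  cases : q % 4 = 1 ∧ α 0 ^ (q / 2) = -1 ∧ α 1 = 0 ∧ β 1 = 1 ∨
    q % 4 = 3 ∧ α 0 = 1 ∧ (α 1 * α 1 + β 1 * β 1) ^ (q / 2) = -1

variable {α β : ℕ → F} {w : ℕ → K}

theorem root_one_pow (hq : q % 4 = 3)
    (hα : (α 1 * α 1 + β 1 * β 1) ^ (q / 2) = -1) (h₀ : w 0 ^ 2 = -1)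
    (h₁ : w 1 ^ 2 = -(algebraMap F K (α 1) + algebraMap F K (β 1) * w 0)) :
    w 1 ^ (q ^ 2 - 1) = -1 := by
  have h₀' : w 0 ^ (q - 1) = -1 :=
    pow_sub_one_of_sq_pow_half (by omega) (by rw [h₀, Odd.neg_one_pow ⟨q / 4, by omega⟩])
  have norm_eq : (w 1 ^ 2) ^ (q + 1) = algebraMap F K (α 1 * α 1 + β 1 * β 1) := by
    rw [h₁, Even.neg_pow ⟨(q + 1) / 2, by omega⟩, pow_succ, add_mul_pow_card h₀']
    simp only [map_add, map_mul]
    linear_combination -algebraMap F K (β 1) ^ 2 * h₀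
  have hexp : q ^ 2 - 1 = 2 * (q + 1) * (q / 2) := by
    obtain ⟨k, hk⟩ : ∃ k, q = 2 * k + 1 := ⟨q / 2, by omega⟩
    rw [hk, show (2 * k + 1) / 2 = k by omega,
      Nat.sub_eq_iff_eq_add (Nat.one_le_pow _ _ (by omega))]
    ring
  rw [hexp, pow_mul, pow_mul, norm_eq, ← map_pow, hα, map_neg, map_one]

theorem QuadraticCoeffs.root_pow (h : QuadraticCoeffs α β)
    (hw : ∀ i, w i ^ 2 = -(algebraMap F K (α i) + algebraMap F K (β i) * w (i - 1))) (n : ℕ) :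
    w n ^ (q ^ 2 ^ n - 1) = -1 := by
  have hq : q % 2 = 1 := by rcases h.cases with ⟨h, -⟩ | ⟨h, -⟩ <;> omega
  have succ_pow (n : ℕ) (hn : q % 4 = 1 ∨ n ≠ 0) (hα : α (n + 1) = 0) (hβ : β (n + 1) = 1)
      (ih : w n ^ (q ^ 2 ^ n - 1) = -1) : w (n + 1) ^ (q ^ 2 ^ (n + 1) - 1) = -1 := by
    rw [pow_succ 2 n, pow_mul]
    exact pow_sq_sub_one_of_sq_eq_neg (pow_two_pow_mod_four hq n hn) ih
      (by simpa [hα, hβ] using hw (n + 1))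
  have of_two_le (n : ℕ) (h₁ : w 1 ^ (q ^ 2 ^ 1 - 1) = -1) :
      w (n + 1) ^ (q ^ 2 ^ (n + 1) - 1) = -1 := by
    induction n with
    | zero => exact h₁
    | succ n ih =>
      exact succ_pow _ (.inr n.succ_ne_zero) (h.left _ (by omega)) (h.right _ (by omega)) ih
  have h₀ : w 0 ^ 2 = -algebraMap F K (α 0) := by simpa [h.zero] using hw 0
  have zero_pow (hα : (-α 0) ^ (q / 2) = -1) : w 0 ^ (q ^ 2 ^ 0 - 1) = -1 := by
    rw [pow_zero, pow_one]
    refine pow_sub_one_of_sq_pow_half hq ?_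
    rw [h₀, ← map_neg, ← map_pow, hα, map_neg, map_one]
  rcases h.cases with ⟨hq4, hα, hα₁, hβ₁⟩ | ⟨hq4, hα, hnorm⟩
  · have hw₀ := zero_pow (by rw [Even.neg_pow ⟨q / 4, by omega⟩, hα])
    cases n with
    | zero => exact hw₀
    | succ n => exact of_two_le n (succ_pow 0 (.inl hq4) hα₁ hβ₁ hw₀)
  · cases n with
    | zero => exact zero_pow (by rw [hα, Odd.neg_one_pow ⟨q / 4, by omega⟩])
    | succ n => exact of_two_le n (root_one_pow hq4 hnorm (by simpa [hα] using h₀) (hw 1))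

theorem QuadraticCoeffs.two_pow_le_finrank (h : QuadraticCoeffs α β)
    (hw : ∀ i, w i ^ 2 = -(algebraMap F K (α i) + algebraMap F K (β i) * w (i - 1)))
    {B : Subalgebra F K} [Finite B] {ℓ : ℕ} (hB : ∀ i < ℓ, w i ∈ B) :
    2 ^ ℓ ≤ Module.finrank F B := by
  have : Module.Finite F B := .of_finite
  have hpos : 0 < Module.finrank F B := Module.finrank_pos
  cases ℓ with
  | zero => exact hpos
  | succ n =>
    have hq : q % 2 = 1 := by rcases h.cases with ⟨h, -⟩ | ⟨h, -⟩ <;> omega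
    exact Nat.le_of_dvd hpos (two_pow_dvd_finrank hq (hB n n.lt_succ_self) (h.root_pow hw n))

end Roots

section Quotient

theorem submodule_eq_top_of_mul_mem {R A : Type*} [CommSemiring R] [Semiring A] [Algebra R A]
    {S : Set A} (hS : Algebra.adjoin R S = ⊤) {V : Submodule R A} (hone : 1 ∈ V)
    (hmul : ∀ x ∈ S, ∀ y ∈ V, x * y ∈ V) : V = ⊤ := by
  have mul_mem (z : A) (hz : z ∈ Algebra.adjoin R S) : ∀ y ∈ V, z * y ∈ V := by
    induction hz using Algebra.adjoin_induction with
    | mem x hx => exact hmul x hx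
    | algebraMap r =>
      intro y hy
      rw [← Algebra.smul_def]
      exact V.smul_mem r hy
    | add z z' _ _ hz hz' =>
      intro y hy
      rw [add_mul]
      exact V.add_mem (hz y hy) (hz' y hy)
    | mul z z' _ _ hz hz' =>
      intro y hy
      rw [mul_assoc]
      exact hz _ (hz' y hy)
  exact eq_top_iff.2 fun z _ => by simpa using mul_mem z (hS ▸ trivial) 1 hone

section Squarefree

variable {R A : Type*} [CommRing R] [CommRing A] [Algebra R A] {ℓ : ℕ} {α β : ℕ → R} {x : Fin ℓ → A}

theorem mul_prod_mem_span (hβ : β 0 = 0)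
    (hrel : ∀ i : Fin ℓ, x i * x i = -(algebraMap R A (α i) +
      algebraMap R A (β i) * x ⟨i - 1, (Nat.sub_le _ _).trans_lt i.2⟩))
    (i : Fin ℓ) (s : Finset (Fin ℓ)) :
    x i * ∏ j ∈ s, x j ∈ Submodule.span R (Set.range fun s : Finset (Fin ℓ) => ∏ j ∈ s, x j) := by
  set V := Submodule.span R (Set.range fun s : Finset (Fin ℓ) => ∏ j ∈ s, x j)
  have hmem (s : Finset (Fin ℓ)) : ∏ j ∈ s, x j ∈ V := Submodule.subset_span ⟨s, rfl⟩
  obtain ⟨n, hi⟩ : ∃ n, (i : ℕ) = n := ⟨i, rfl⟩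
  induction n generalizing i s with
  | zero =>
    by_cases his : i ∈ s
    · rw [← Finset.mul_prod_erase s _ his, ← mul_assoc, hrel i, (by rw [hi, hβ] : β i = 0),
        map_zero, zero_mul, add_zero, neg_mul, ← Algebra.smul_def]
      exact V.neg_mem (V.smul_mem _ (hmem _))
    · rw [← Finset.prod_insert his]
      exact hmem _
  | succ n ih =>
    by_cases his : i ∈ s
    · rw [← Finset.mul_prod_erase s _ his, ← mul_assoc, hrel i, neg_mul, add_mul, mul_assoc,
        ← Algebra.smul_def, ← Algebra.smul_def]
      exact V.neg_mem (V.add_mem (V.smul_mem _ (hmem _)) (V.smul_mem _ (ih _ _ (by simp [hi]))))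
    · rw [← Finset.prod_insert his]
      exact hmem _

theorem span_squarefree_eq_top (hβ : β 0 = 0)
    (hrel : ∀ i : Fin ℓ, x i * x i = -(algebraMap R A (α i) +
      algebraMap R A (β i) * x ⟨i - 1, (Nat.sub_le _ _).trans_lt i.2⟩))
    (htop : Algebra.adjoin R (Set.range x) = ⊤) :
    Submodule.span R (Set.range fun s : Finset (Fin ℓ) => ∏ j ∈ s, x j) = ⊤ := by
  refine submodule_eq_top_of_mul_mem htop (Submodule.subset_span ⟨∅, by simp⟩) ?_
  rintro _ ⟨i, rfl⟩ y hy
  suffices h : Submodule.span R (Set.range fun s : Finset (Fin ℓ) => ∏ j ∈ s, x j) ≤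
      (Submodule.span R _).comap (LinearMap.mulLeft R (x i)) from h hy
  rw [Submodule.span_le]
  rintro _ ⟨s, rfl⟩
  exact mul_prod_mem_span hβ hrel i s

end Squarefree

variable {F : Type*} [Field F]

theorem isField_of_finrank_le_finrank_range {A K : Type*} [CommRing A] [Algebra F A] [Field K]
    [Algebra F K] [Finite A] (φ : A →ₐ[F] K)
    (h : Module.finrank F A ≤ Module.finrank F φ.range) :
    IsField A ∧ Module.finrank F A = Module.finrank F φ.range := by
  have : Module.Finite F A := .of_finite
  have : Finite φ.range := .of_surjective _ φ.rangeRestrict_surjective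
  have : Module.Finite F φ.range := .of_finite
  have heq := h.antisymm <| LinearMap.finrank_le_finrank_of_surjective
    (f := φ.rangeRestrict.toLinearMap) φ.rangeRestrict_surjective
  have hinj : Function.Injective φ.rangeRestrict :=
    (LinearMap.injective_iff_surjective_of_finrank_eq_finrank
      (f := φ.rangeRestrict.toLinearMap) heq).2 φ.rangeRestrict_surjective
  have : IsDomain A := hinj.isDomain φ.rangeRestrict.toRingHom
  exact ⟨Finite.isField_of_domain A, heq⟩

/-- The polynomials `w_i ^ 2 + α_i + β_i * w_{i-1}`. When they are used, `β_0` is zero, so that it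
does not matter that the index `i - 1` is truncated. -/
noncomputable def quadratic (ℓ : ℕ) (α β : ℕ → F) (i : Fin ℓ) : MvPolynomial (Fin ℓ) F :=
  X i ^ 2 + (C (α i) + C (β i) * X ⟨i - 1, (Nat.sub_le _ _).trans_lt i.2⟩)

variable {ℓ : ℕ} {α β : ℕ → F}

theorem exists_quadratic_eq_sub (hβ : β 0 = 0) (i : Fin ℓ) :
    ∃ h : MvPolynomial (Fin ℓ) F, (∀ j ∈ h.vars, j < i) ∧ h.totalDegree ≤ (i : ℕ) ∧
      quadratic ℓ α β i = X i ^ 2 - h := by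
  rcases Nat.eq_zero_or_pos (i : ℕ) with hi | hi
  · exact ⟨C (-α i), by simp, by simp, by simp [quadratic, hi, hβ]⟩
  refine ⟨-(C (α i) + C (β i) * X ⟨i - 1, (Nat.sub_le _ _).trans_lt i.2⟩), fun j hj => ?_, ?_,
    by rw [quadratic, sub_neg_eq_add]⟩
  · rw [vars_neg] at hj
    have hj := vars_add_subset _ _ hj
    rw [vars_C, Finset.empty_union] at hj
    have hj := vars_mul _ _ hj
    rw [vars_C, Finset.empty_union, vars_X, Finset.mem_singleton] at hj
    rw [hj, Fin.lt_def]
    exact Nat.sub_one_lt hi.ne'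
  · rw [totalDegree_neg]
    refine (totalDegree_add _ _).trans (max_le (by simp) ((totalDegree_mul _ _).trans ?_))
    rwa [totalDegree_C, totalDegree_X, zero_add]

theorem adjoin_mk_X_eq_top (I : Ideal (MvPolynomial (Fin ℓ) F)) :
    Algebra.adjoin F (Set.range fun i => Ideal.Quotient.mkₐ F I (X i)) = ⊤ := by
  rw [Set.range_comp' (Ideal.Quotient.mkₐ F I) X, ← AlgHom.map_adjoin, adjoin_range_X,
    Algebra.map_top, AlgHom.range_eq_top]
  exact Ideal.Quotient.mkₐ_surjective _ _

theorem span_prod_mk_X_eq_top (hβ : β 0 = 0) :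
    Submodule.span F (Set.range fun s : Finset (Fin ℓ) =>
      ∏ j ∈ s, Ideal.Quotient.mkₐ F (Ideal.span (Set.range (quadratic ℓ α β))) (X j)) = ⊤ := by
  refine span_squarefree_eq_top (α := α) hβ (fun i => ?_) (adjoin_mk_X_eq_top _)
  have hzero : Ideal.Quotient.mkₐ F (Ideal.span (Set.range (quadratic ℓ α β)))
      (quadratic ℓ α β i) = 0 :=
    Ideal.Quotient.eq_zero_iff_mem.2 (Ideal.subset_span ⟨i, rfl⟩)
  simp only [quadratic, map_add, map_mul, map_pow] at hzero
  simp only [← algebraMap_eq, AlgHom.commutes] at hzero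
  linear_combination hzero

theorem exists_algHom_mk_X {K : Type*} [Field K] [Algebra F K] {w : ℕ → K}
    (hw : ∀ i, w i ^ 2 = -(algebraMap F K (α i) + algebraMap F K (β i) * w (i - 1))) :
    ∃ φ : MvPolynomial (Fin ℓ) F ⧸ Ideal.span (Set.range (quadratic ℓ α β)) →ₐ[F] K,
      ∀ i : Fin ℓ, w i ∈ φ.range := by
  have hle : Ideal.span (Set.range (quadratic ℓ α β)) ≤
      RingHom.ker (aeval fun i : Fin ℓ => w i : _ →ₐ[F] K) := by
    rw [Ideal.span_le]
    rintro _ ⟨i, rfl⟩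
    simp [quadratic, hw i]
  refine ⟨Ideal.Quotient.liftₐ _ (aeval fun i : Fin ℓ => w i) fun a ha => hle ha, fun i =>
    ⟨Ideal.Quotient.mk _ (X i), ?_⟩⟩
  exact (Ideal.Quotient.lift_mk _ _ _).trans (aeval_X _ i)

theorem QuadraticCoeffs.isQuadraticTower [Fintype F] (h : QuadraticCoeffs α β) (ℓ : ℕ) :
    IsQuadraticTower (quadratic ℓ α β) := by
  obtain ⟨w, hw⟩ := exists_sq_eq_neg_add_mul (K := AlgebraicClosure F) α β h.zero
  obtain ⟨φ, hφ⟩ := exists_algHom_mk_X (ℓ := ℓ) hw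
  let I := Ideal.span (Set.range (quadratic ℓ α β))
  have hspan := span_prod_mk_X_eq_top (ℓ := ℓ) (α := α) h.zero
  have : Module.Finite F (MvPolynomial (Fin ℓ) F ⧸ I) :=
    ⟨hspan ▸ Submodule.fg_span (Set.finite_range _)⟩
  have : Finite (MvPolynomial (Fin ℓ) F ⧸ I) := Module.finite_of_finite F
  have : Finite φ.range := .of_surjective _ φ.rangeRestrict_surjective
  have finrank_le : Module.finrank F (MvPolynomial (Fin ℓ) F ⧸ I) ≤ 2 ^ ℓ := by
    have := finrank_range_le_card (R := F) fun s : Finset (Fin ℓ) =>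
      ∏ j ∈ s, Ideal.Quotient.mkₐ F I (X j)
    rw [Set.finrank, hspan, finrank_top] at this
    simpa using this
  have le_finrank : 2 ^ ℓ ≤ Module.finrank F φ.range :=
    h.two_pow_le_finrank hw fun i hi => hφ ⟨i, hi⟩
  obtain ⟨hfield, hrank⟩ := isField_of_finrank_le_finrank_range φ (finrank_le.trans le_finrank)
  exact ⟨Ideal.Quotient.maximal_of_isField _ hfield, hfield,
    finrank_le.antisymm (le_finrank.trans hrank.ge), exists_quadratic_eq_sub h.zero⟩

end Quotient

end Tower

/-! ### Correct outputs encode towers -/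

namespace Tower

open Finset

theorem ofFn_eq_map_range {α : Type*} (n : ℕ) (g : ℕ → α) :
    (List.ofFn fun j : Fin n => g j) = (List.range n).map g :=
  List.ext_getElem (by simp) (by simp)

theorem sum_oneDigits {F : Type*} [Field F] {u : ℕ} (hu : 0 < u) (θ : F) :
    ∑ j ∈ range u, (oneDigits j : F) * θ ^ j = 1 := by
  obtain ⟨v, rfl⟩ := Nat.exists_eq_add_one.2 hu
  rw [sum_range_succ']
  simp [oneDigits]

theorem IsTowerCoeffs.quadraticCoeffs {F : Type*} [Field F] [Fintype F] {p u : ℕ} {θ : F}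
    {f₀ f₁ g₁ : ℕ → ℕ} (hu : 0 < u) (hcard : Fintype.card F = p ^ u)
    (h : IsTowerCoeffs θ p u f₀ f₁ g₁) :
    QuadraticCoeffs (fun i => ∑ j ∈ range u, (coeffs f₀ f₁ (fun _ => 0) i j : F) * θ ^ j)
      (fun i => ∑ j ∈ range u, (coeffs (fun _ => 0) g₁ oneDigits i j : F) * θ ^ j) where
  left i hi := by
    obtain ⟨i, rfl⟩ := Nat.exists_eq_add_of_le' hi
    simp [coeffs]
  right i hi := by
    obtain ⟨i, rfl⟩ := Nat.exists_eq_add_of_le' hi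
    exact sum_oneDigits hu θ
  zero := by simp [coeffs]
  cases := by
    obtain ⟨x, y, hgood, ⟨hq, hf₀, rfl, rfl⟩ | ⟨hq, rfl, hf₁, hg₁⟩⟩ := h.of_good
    · refine .inl ⟨hcard ▸ hq, ?_, by simp [coeffs], sum_oneDigits hu θ⟩
      simp only [coeffs, hf₀, hcard]
      exact hgood
    · refine .inr ⟨hcard ▸ hq, sum_oneDigits hu θ, ?_⟩
      simp only [coeffs, hf₁, hg₁, hcard]
      exact hgood

section Presentation

variable {p : ℕ} [Fact p.Prime] {F : Type*} [Field F] [Finite F] [Algebra (ZMod p) F]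

theorem presents_minpoly (hp : p ≠ 2) (θ : F) :
    Presents p (minpoly (ZMod p) θ).natDegree (fun j => ((minpoly (ZMod p) θ).coeff j).val) θ := by
  have hprime : p.Prime := Fact.out
  have : Module.Finite (ZMod p) F := .of_finite
  have hint : IsIntegral (ZMod p) θ := .of_finite _ _
  have hcast (n : ℕ) : (n : F) = algebraMap (ZMod p) F n := (map_natCast _ n).symm
  refine ⟨lt_of_le_of_ne hprime.two_le hp.symm, minpoly.natDegree_pos hint,
    fun j _ => ZMod.val_lt _, by rw [hcast, ZMod.natCast_self, map_zero], ?_, ?_⟩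
  · have haeval := minpoly.aeval (ZMod p) θ
    rw [(minpoly.monic hint).as_sum] at haeval
    simp only [map_add, map_pow, Polynomial.aeval_X, map_sum, map_mul, Polynomial.aeval_C] at haeval
    simpa only [hcast, ZMod.natCast_zmod_val] using haeval
  · intro f g hf hg hfg i hi
    have hli := Fintype.linearIndependent_iff.1 (linearIndependent_pow (K := ZMod p) θ)
    have hcast_eq : (f i : ZMod p) = g i := sub_eq_zero.1 <|
      hli (fun i => (f i : ZMod p) - g i) (by
        rw [sum_range, sum_range] at hfg
        simp only [Algebra.smul_def, map_sub, map_natCast, sub_mul, sum_sub_distrib]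
        rw [hfg, sub_self]) ⟨i, hi⟩
    simpa only [ZMod.val_cast_of_lt (hf i hi), ZMod.val_cast_of_lt (hg i hi)] using
      congrArg ZMod.val hcast_eq

theorem card_eq_pow_natDegree {θ : F} (hθ : Algebra.adjoin (ZMod p) {θ} = ⊤) :
    Nat.card F = p ^ (minpoly (ZMod p) θ).natDegree := by
  have : Module.Finite (ZMod p) F := .of_finite
  have hdim := (Algebra.adjoin.powerBasis (IsIntegral.of_finite (ZMod p) θ)).finrank
  rw [Algebra.adjoin.powerBasis_dim, hθ] at hdim
  rw [Module.natCard_eq_pow_finrank (K := ZMod p), Nat.card_zmod, ← hdim]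
  exact congrArg (p ^ ·) Subalgebra.topEquiv.toLinearEquiv.finrank_eq.symm

end Presentation

section Code

variable {p : ℕ} {F : Type*} [Field F] [Algebra (ZMod p) F]

theorem inputTape_eq (θ : F) (ℓ e : ℕ) :
    inputTape (p := p) θ ℓ e = [p, (minpoly (ZMod p) θ).natDegree, ℓ, e] ++
      (List.range (minpoly (ZMod p) θ).natDegree).map
        (fun j => ((minpoly (ZMod p) θ).coeff j).val) := by
  rw [inputTape, ofFn_eq_map_range _ fun j => ((minpoly (ZMod p) θ).coeff j).val]

/-- The term `(∑ f_j θ ^ j) * w_i ^ v`. -/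
def mkTerm (p ℓ u v i : ℕ) (f : ℕ → ℕ) : Term p ℓ u :=
  (fun j => if (j : ℕ) = i then v else 0, fun j => f j)

/-- The terms of `w_i ^ 2 + ∑ f_j θ ^ j + (∑ g_j θ ^ j) * w_{i-1}`. -/
def quadraticTerms (p ℓ u i : ℕ) (f g : ℕ → ℕ) : List (Term p ℓ u) :=
  [mkTerm p ℓ u 2 i oneDigits, mkTerm p ℓ u 0 i f, mkTerm p ℓ u 1 (i - 1) g]

theorem code_mkTerm {ℓ u v i : ℕ} {f : ℕ → ℕ} (hf : ∀ j < u, f j < p) :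
    (List.ofFn (mkTerm p ℓ u v i f).1 ++
      List.ofFn fun j : Fin u => ((mkTerm p ℓ u v i f).2 j).val) = termCode ℓ u v i f := by
  rw [termCode, ← ofFn_eq_map_range, ← ofFn_eq_map_range]
  congr 2
  funext j
  exact ZMod.val_cast_of_lt (hf j j.2)

theorem codeTerms_quadraticTerms (hp : 1 < p) {ℓ u : ℕ} (i : ℕ) {f g : ℕ → ℕ}
    (hf : ∀ j < u, f j < p) (hg : ∀ j < u, g j < p) :
    codeTerms (quadraticTerms p ℓ u i f g) = polyCode ℓ u i f g := by
  simp only [codeTerms, quadraticTerms, List.flatMap_cons, List.flatMap_nil, List.append_nil,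
    polyCode, code_mkTerm hf, code_mkTerm hg, code_mkTerm fun j _ => oneDigits_lt hp j]
  rfl

theorem monomial_mkTerm {ℓ u v : ℕ} (θ : F) (i : Fin ℓ) (f : ℕ → ℕ) :
    MvPolynomial.monomial (Finsupp.equivFunOnFinite.symm (mkTerm p ℓ u v i f).1)
      (∑ j : Fin u, algebraMap (ZMod p) F ((mkTerm p ℓ u v i f).2 j) * θ ^ (j : ℕ)) =
    MvPolynomial.C (∑ j ∈ range u, (f j : F) * θ ^ j) * MvPolynomial.X i ^ v := by
  rw [MvPolynomial.C_mul_X_pow_eq_monomial, sum_range]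
  congr 1
  · congr 1
    ext j
    simp only [mkTerm, Finsupp.equivFunOnFinite_symm_apply_apply, Finsupp.single_apply, Fin.ext_iff,
      eq_comm]
  · simp [mkTerm]

theorem polyOf_quadraticTerms {ℓ u : ℕ} (hu : 0 < u) (θ : F) (f g : ℕ → ℕ → ℕ) (i : Fin ℓ) :
    polyOf θ (quadraticTerms p ℓ u i (f i) (g i)) =
      quadratic ℓ (fun i => ∑ j ∈ range u, (f i j : F) * θ ^ j)
        (fun i => ∑ j ∈ range u, (g i j : F) * θ ^ j) i := by
  have hlast := monomial_mkTerm (p := p) (u := u) (v := 1) θ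
    (⟨i - 1, (Nat.sub_le _ _).trans_lt i.2⟩ : Fin ℓ) (g i)
  simp only [polyOf, quadraticTerms, List.map_cons, List.map_nil, List.sum_cons, List.sum_nil]
  rw [hlast, monomial_mkTerm θ i, monomial_mkTerm θ i, sum_oneDigits hu, quadratic]
  simp

theorem IsTowerCode.isSuccess [Fact p.Prime] [Fintype F] (hp : p ≠ 2) {θ : F} {ℓ : ℕ}
    (hcard : Fintype.card F = p ^ (minpoly (ZMod p) θ).natDegree) {out : List ℕ}
    (h : IsTowerCode θ p (minpoly (ZMod p) θ).natDegree ℓ out) : IsSuccess p θ ℓ out := by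
  have hpres := presents_minpoly hp θ
  have hp1 : 1 < p := one_lt_two.trans hpres.two_lt
  obtain ⟨f₀, f₁, g₁, hcoeffs, rfl⟩ := h
  refine ⟨_, ⟨_, polyOf_quadraticTerms (p := p) hpres.pos θ (coeffs f₀ f₁ fun _ => 0)
    (coeffs (fun _ => 0) g₁ oneDigits), ?_⟩,
    (hcoeffs.quadraticCoeffs hpres.pos hcard).isQuadraticTower ℓ⟩
  have hpos : ∀ j < (minpoly (ZMod p) θ).natDegree, 0 < p := fun _ _ => hp1.le
  simp only [codeTerms_quadraticTerms hp1 _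
    (coeffs_lt hcoeffs.fst_zero_lt hcoeffs.fst_one_lt hpos _)
    (coeffs_lt hpos hcoeffs.snd_one_lt (fun j _ => oneDigits_lt hp1 j) _)]
  rw [towerCode, List.flatMap_def, ofFn_eq_map_range ℓ fun i => polyCode ℓ _ i _ _]

end Code

end Tower

/-! ### Expansion of the translations and shears of the torus -/

namespace Expander

open Finset ZMod

section Spectrum

variable {M : ℕ} [NeZero M]

/-- The Fourier transform of a function on the square of `ZMod M`. -/
noncomputable def fourier (f : ZMod M × ZMod M → ℝ) (ξ : ZMod M × ZMod M) : ℂ :=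
  ∑ v : ZMod M × ZMod M, (f v : ℂ) * stdAddChar (ξ.1 * v.1 + ξ.2 * v.2)

theorem fourier_sub (f g : ZMod M × ZMod M → ℝ) (ξ : ZMod M × ZMod M) :
    fourier (f - g) ξ = fourier f ξ - fourier g ξ := by
  simp [fourier, sub_mul, sum_sub_distrib]

theorem fourier_zero_right (f : ZMod M × ZMod M → ℝ) : fourier f 0 = ((∑ v, f v : ℝ) : ℂ) := by
  simp [fourier]

theorem sum_stdAddChar (a b : ZMod M) :
    ∑ ξ : ZMod M × ZMod M, (stdAddChar (ξ.1 * a + ξ.2 * b) : ℂ) =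
      if a = 0 ∧ b = 0 then (M : ℂ) ^ 2 else 0 := by
  have h := isPrimitive_stdAddChar M
  simp only [AddChar.map_add_eq_mul, Fintype.sum_prod_type, ← mul_sum, ← sum_mul]
  rw [AddChar.sum_mulShift a h, AddChar.sum_mulShift b h]
  by_cases ha : a = 0 <;> by_cases hb : b = 0 <;> simp [ha, hb, ZMod.card, sq]

theorem fourier_mul_conj (f : ZMod M × ZMod M → ℝ) (ξ : ZMod M × ZMod M) :
    fourier f ξ * (starRingEnd ℂ) (fourier f ξ) =
      ∑ v : ZMod M × ZMod M, ∑ w : ZMod M × ZMod M,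
        (f v : ℂ) * f w * stdAddChar (ξ.1 * (v.1 - w.1) + ξ.2 * (v.2 - w.2)) := by
  rw [fourier, map_sum, sum_mul_sum]
  refine sum_congr rfl fun v _ => sum_congr rfl fun w _ => ?_
  have harg : ξ.1 * (v.1 - w.1) + ξ.2 * (v.2 - w.2) =
      (ξ.1 * v.1 + ξ.2 * v.2) + -(ξ.1 * w.1 + ξ.2 * w.2) := by ring
  rw [map_mul, Complex.conj_ofReal, ← AddChar.map_neg_eq_conj, harg,
    AddChar.map_add_eq_mul _ (ξ.1 * v.1 + ξ.2 * v.2)]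
  ring

theorem parseval (f : ZMod M × ZMod M → ℝ) :
    ∑ ξ, ‖fourier f ξ‖ ^ 2 = (M : ℝ) ^ 2 * ∑ v, f v ^ 2 := by
  have hdiag (v : ZMod M × ZMod M) :
      ∑ w : ZMod M × ZMod M, (f v : ℂ) * f w *
        (if v.1 - w.1 = 0 ∧ v.2 - w.2 = 0 then (M : ℂ) ^ 2 else 0) =
      (M : ℂ) ^ 2 * (f v : ℂ) ^ 2 := by
    simp only [sub_eq_zero, ← Prod.ext_iff, mul_ite, mul_zero, sum_ite_eq, mem_univ, if_true]
    ring
  have hcomplex : ((∑ ξ, ‖fourier f ξ‖ ^ 2 : ℝ) : ℂ) =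
      (((M : ℝ) ^ 2 * ∑ v, f v ^ 2 : ℝ) : ℂ) := by
    push_cast
    simp only [← Complex.mul_conj', fourier_mul_conj]
    rw [sum_comm, mul_sum]
    refine sum_congr rfl fun v _ => ?_
    rw [sum_comm, ← hdiag v]
    simp only [← mul_sum, sum_stdAddChar]
  exact_mod_cast hcomplex

theorem sum_norm_fourier_comp_sub (f : ZMod M × ZMod M → ℝ)
    (g : ZMod M × ZMod M → ZMod M × ZMod M) :
    ∑ ξ, ‖fourier (f ∘ g) ξ - fourier f ξ‖ ^ 2 = (M : ℝ) ^ 2 * ∑ v, (f (g v) - f v) ^ 2 := by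
  simp only [← fourier_sub, parseval, Pi.sub_apply, Function.comp_apply]

/-- The shear `(a, b) ↦ (a + b, b)` of the torus. -/
def shearFst : Equiv.Perm (ZMod M × ZMod M) where
  toFun v := (v.1 + v.2, v.2)
  invFun v := (v.1 - v.2, v.2)
  left_inv v := by simp
  right_inv v := by simp

/-- The shear `(a, b) ↦ (a, b + a)` of the torus. -/
def shearSnd : Equiv.Perm (ZMod M × ZMod M) where
  toFun v := (v.1, v.2 + v.1)
  invFun v := (v.1, v.2 - v.1)
  left_inv v := by simp
  right_inv v := by simp

/-- The generators of the expander on the torus: two translations and two shears. -/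
def gen : Fin 4 → Equiv.Perm (ZMod M × ZMod M) :=
  ![(Equiv.addRight 1).prodCongr (Equiv.refl _), (Equiv.refl _).prodCongr (Equiv.addRight 1),
    shearFst, shearSnd]

variable (f : ZMod M × ZMod M → ℝ) (ξ : ZMod M × ZMod M)

theorem fourier_comp_gen_zero :
    fourier (f ∘ gen 0) ξ = stdAddChar (-ξ.1) * fourier f ξ := by
  rw [fourier, fourier, mul_sum]
  refine Fintype.sum_equiv (gen 0) _ _ fun v => ?_
  rw [mul_left_comm, ← AddChar.map_add_eq_mul]
  congr 2
  simp only [gen, Matrix.cons_val, Equiv.prodCongr_apply, Prod.map, Equiv.coe_addRight,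
    Equiv.refl_apply]
  ring

theorem fourier_comp_gen_one :
    fourier (f ∘ gen 1) ξ = stdAddChar (-ξ.2) * fourier f ξ := by
  rw [fourier, fourier, mul_sum]
  refine Fintype.sum_equiv (gen 1) _ _ fun v => ?_
  rw [mul_left_comm, ← AddChar.map_add_eq_mul]
  congr 2
  simp only [gen, Matrix.cons_val, Equiv.prodCongr_apply, Prod.map, Equiv.coe_addRight,
    Equiv.refl_apply]
  ring

theorem fourier_comp_shearFst : fourier (f ∘ shearFst) ξ = fourier f (shearSnd.symm ξ) := by
  refine Fintype.sum_equiv shearFst _ _ fun v => ?_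
  simp only [Function.comp_apply, shearFst, shearSnd, Equiv.coe_fn_mk, Equiv.coe_fn_symm_mk]
  congr 2
  ring

theorem fourier_comp_shearSnd : fourier (f ∘ shearSnd) ξ = fourier f (shearFst.symm ξ) := by
  refine Fintype.sum_equiv shearSnd _ _ fun v => ?_
  simp only [Function.comp_apply, shearFst, shearSnd, Equiv.coe_fn_mk, Equiv.coe_fn_symm_mk]
  congr 2
  ring

theorem two_mul_abs_valMinAbs_le (a : ZMod M) : 2 * |a.valMinAbs| ≤ M := by
  have hmem := a.valMinAbs_mem_Ioc
  have hlt := hmem.1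
  have hle := hmem.2
  rcases abs_cases a.valMinAbs with h | h <;> omega

theorem two_le_norm_stdAddChar_neg_sub_one (a : ZMod M) (ha : (M : ℤ) ≤ 4 * |a.valMinAbs|) :
    2 ≤ ‖(stdAddChar (-a) : ℂ) - 1‖ ^ 2 := by
  have hM : (0 : ℝ) < M := by exact_mod_cast Nat.pos_of_ne_zero (NeZero.ne M)
  set t : ℝ := 2 * Real.pi * (-a.valMinAbs : ℤ) / M with ht
  have hchar : (stdAddChar (-a) : ℂ) = Complex.exp ((t : ℂ) * Complex.I) := by
    have hneg : -a = ((-a.valMinAbs : ℤ) : ZMod M) := by rw [Int.cast_neg, coe_valMinAbs]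
    rw [hneg, stdAddChar_coe, ht]
    congr 1
    push_cast
    ring
  have habs : |t| = 2 * Real.pi * |(a.valMinAbs : ℝ)| / M := by
    rw [ht, abs_div, abs_mul, abs_of_pos hM, abs_of_pos (by positivity : 0 < 2 * Real.pi)]
    simp
  have hle : 2 * |(a.valMinAbs : ℝ)| ≤ M := by exact_mod_cast two_mul_abs_valMinAbs_le a
  have hge : (M : ℝ) ≤ 4 * |(a.valMinAbs : ℝ)| := by exact_mod_cast ha
  have hcos : Real.cos t ≤ 0 := by
    rw [← Real.cos_abs, habs]
    apply Real.cos_nonpos_of_pi_div_two_le_of_le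
    · rw [div_le_div_iff₀ two_pos hM]
      nlinarith [Real.pi_pos]
    · rw [div_le_iff₀ hM]
      nlinarith [Real.pi_pos]
  rw [hchar, ← Complex.normSq_eq_norm_sq, Complex.normSq_sub, Complex.normSq_eq_norm_sq,
    Complex.norm_exp_ofReal_mul_I]
  simp only [map_one, mul_one, Complex.exp_ofReal_mul_I_re]
  linarith

end Spectrum

section Shifts

variable {V E : Type*} [SeminormedAddCommGroup E]

theorem sum_add_sum_le_of_disjoint {μ : V → ℝ} (hμ : ∀ x, 0 ≤ μ x)
    {s t : Finset V} {ρ σ : Equiv.Perm V} (hρ : ∀ x ∈ s, ρ x ∈ t) (hσ : ∀ x ∈ s, σ x ∈ t)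
    (hne : ∀ x ∈ s, ∀ y ∈ s, ρ x ≠ σ y) :
    ∑ x ∈ s, μ (ρ x) + ∑ x ∈ s, μ (σ x) ≤ ∑ x ∈ t, μ x := by
  classical
  have hdisj : Disjoint (s.image ρ) (s.image σ) := by
    rw [disjoint_left]
    rintro x hx hx'
    obtain ⟨y, hy, rfl⟩ := mem_image.1 hx
    obtain ⟨z, hz, hzy⟩ := mem_image.1 hx'
    exact hne y hy z hz hzy.symm
  rw [← sum_image (s := s) (g := ρ) (f := μ) ρ.injective.injOn,
    ← sum_image (s := s) (g := σ) (f := μ) σ.injective.injOn, ← sum_union hdisj]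
  exact sum_le_sum_of_subset_of_nonneg
    (union_subset (image_subset_iff.2 hρ) (image_subset_iff.2 hσ)) fun x _ _ => hμ x

theorem sq_sub_sq_le {a b d c : ℝ} (hc : 0 < c) (ha : 0 ≤ a) (hb : 0 ≤ b) (hd : a - b ≤ d) :
    a ^ 2 - b ^ 2 ≤ d ^ 2 / c + c / 2 * (b ^ 2 + a ^ 2) := by
  have hcd : d ^ 2 / c * c = d ^ 2 := div_mul_cancel₀ _ hc.ne'
  refine le_of_mul_le_mul_right (a := c) ?_ hc
  nlinarith [sq_nonneg (d - c / 2 * (a + b)), mul_nonneg (sq_nonneg c) (sq_nonneg (a - b)),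
    mul_le_mul_of_nonneg_right hd (mul_nonneg (add_nonneg ha hb) hc.le)]

theorem sum_norm_sq_le_of_shift [Fintype V] {F : V → E} {ρ : Equiv.Perm V} {c : ℝ} (hc : 0 < c)
    (h : ∑ x, ‖F (ρ x) - F x‖ ^ 2 ≤ c ^ 2 * ∑ x, ‖F x‖ ^ 2) (s : Finset V) :
    ∑ x ∈ s, ‖F x‖ ^ 2 ≤ ∑ x ∈ s, ‖F (ρ x)‖ ^ 2 + 2 * c * ∑ x, ‖F x‖ ^ 2 := by
  have hpoint (x : V) : ‖F x‖ ^ 2 - ‖F (ρ x)‖ ^ 2 ≤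
      ‖F (ρ x) - F x‖ ^ 2 / c + c / 2 * (‖F (ρ x)‖ ^ 2 + ‖F x‖ ^ 2) :=
    sq_sub_sq_le hc (norm_nonneg _) (norm_nonneg _)
      ((norm_sub_norm_le _ _).trans_eq (norm_sub_rev _ _))
  have hsum : ∑ x ∈ s, (‖F x‖ ^ 2 - ‖F (ρ x)‖ ^ 2) ≤
      ∑ x, (‖F (ρ x) - F x‖ ^ 2 / c + c / 2 * (‖F (ρ x)‖ ^ 2 + ‖F x‖ ^ 2)) :=
    (sum_le_sum fun x _ => hpoint x).trans
      (sum_le_sum_of_subset_of_nonneg (subset_univ _) fun x _ _ => by positivity)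
  rw [sum_sub_distrib, sum_add_distrib, ← sum_div, ← mul_sum, sum_add_distrib,
    Equiv.sum_comp ρ fun x => ‖F x‖ ^ 2] at hsum
  have hdiv : (∑ x, ‖F (ρ x) - F x‖ ^ 2) / c ≤ c * ∑ x, ‖F x‖ ^ 2 := by
    rw [div_le_iff₀ hc]
    linarith
  linarith

theorem sum_union_norm_sq_le [DecidableEq V] (F : V → E) (s t : Finset V) :
    ∑ x ∈ s ∪ t, ‖F x‖ ^ 2 ≤ ∑ x ∈ s, ‖F x‖ ^ 2 + ∑ x ∈ t, ‖F x‖ ^ 2 := by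
  rw [← sum_union_inter]
  exact le_add_of_nonneg_right (sum_nonneg fun _ _ => sq_nonneg _)

/-- Two permutations that hardly change `F` and map `s` to disjoint sets would double the mass of
`F` on `s`, so if they leave `s` only into `t`, then this mass is controlled by the one on `t`. -/
theorem sum_norm_sq_le_of_shifts [Fintype V] [DecidableEq V] {F : V → E} {ρ σ : Equiv.Perm V}
    {c : ℝ} (hc : 0 < c) (hFρ : ∑ x, ‖F (ρ x) - F x‖ ^ 2 ≤ c ^ 2 * ∑ x, ‖F x‖ ^ 2)
    (hFσ : ∑ x, ‖F (σ x) - F x‖ ^ 2 ≤ c ^ 2 * ∑ x, ‖F x‖ ^ 2) {s t : Finset V}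
    (hρ : ∀ x ∈ s, ρ x ∈ s ∪ t) (hσ : ∀ x ∈ s, σ x ∈ s ∪ t)
    (hne : ∀ x ∈ s, ∀ y ∈ s, ρ x ≠ σ y) :
    ∑ x ∈ s, ‖F x‖ ^ 2 ≤ 4 * c * ∑ x, ‖F x‖ ^ 2 + ∑ x ∈ t, ‖F x‖ ^ 2 := by
  have hdouble := sum_add_sum_le_of_disjoint (fun x => sq_nonneg ‖F x‖) hρ hσ hne
  have hunion := sum_union_norm_sq_le F s t
  have hs := sum_norm_sq_le_of_shift hc hFρ s
  have hs' := sum_norm_sq_le_of_shift hc hFσ s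
  linarith

theorem sum_norm_sub_symm [Fintype V] (F : V → E) (ρ : Equiv.Perm V) :
    ∑ x, ‖F (ρ x) - F x‖ ^ 2 = ∑ x, ‖F (ρ.symm x) - F x‖ ^ 2 := by
  rw [← Equiv.sum_comp ρ fun x => ‖F (ρ.symm x) - F x‖ ^ 2]
  simp only [Equiv.symm_apply_apply, norm_sub_rev]

end Shifts

section Gap

variable {M : ℕ} [NeZero M]

theorem valMinAbs_add {a b : ZMod M} (ha : 4 * |a.valMinAbs| < M) (hb : 4 * |b.valMinAbs| < M) :
    (a + b).valMinAbs = a.valMinAbs + b.valMinAbs := by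
  rw [valMinAbs_spec]
  refine ⟨by simp, ?_, ?_⟩ <;>
    rcases abs_cases a.valMinAbs with h | h <;> rcases abs_cases b.valMinAbs with h' | h' <;> omega

theorem valMinAbs_sub {a b : ZMod M} (ha : 4 * |a.valMinAbs| < M) (hb : 4 * |b.valMinAbs| < M) :
    (a - b).valMinAbs = a.valMinAbs - b.valMinAbs := by
  rw [valMinAbs_spec]
  refine ⟨by simp, ?_, ?_⟩ <;>
    rcases abs_cases a.valMinAbs with h | h <;> rcases abs_cases b.valMinAbs with h' | h' <;> omega

/-- The open square around the origin on which the shears do not wrap around the torus. -/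
def central : Finset (ZMod M × ZMod M) :=
  {ξ | 4 * |ξ.1.valMinAbs| < M ∧ 4 * |ξ.2.valMinAbs| < M}

/-- The central points of the second and the fourth quadrant, with half of the axes. -/
def oppositeSigns : Finset (ZMod M × ZMod M) :=
  {ξ ∈ central | (0 < ξ.1.valMinAbs ∧ ξ.2.valMinAbs ≤ 0) ∨
    (ξ.1.valMinAbs < 0 ∧ 0 ≤ ξ.2.valMinAbs)}

/-- The central points of the first and the third quadrant, with the other half of the axes. -/
def equalSigns : Finset (ZMod M × ZMod M) :=
  {ξ ∈ central | (0 ≤ ξ.1.valMinAbs ∧ 0 < ξ.2.valMinAbs) ∨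
    (ξ.1.valMinAbs ≤ 0 ∧ ξ.2.valMinAbs < 0)}

theorem mem_central {ξ : ZMod M × ZMod M} :
    ξ ∈ central ↔ 4 * |ξ.1.valMinAbs| < M ∧ 4 * |ξ.2.valMinAbs| < M :=
  mem_filter_univ _

theorem mem_filter_central_union {Q : ZMod M × ZMod M → Prop} [DecidablePred Q]
    {ξ : ZMod M × ZMod M} (h : Q ξ) : ξ ∈ central.filter Q ∪ centralᶜ := by
  by_cases hξ : ξ ∈ central
  · exact mem_union_left _ (mem_filter.2 ⟨hξ, h⟩)
  · exact mem_union_right _ (mem_compl.2 hξ)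

theorem sum_oppositeSigns_le {E : Type*} [SeminormedAddCommGroup E] {F : ZMod M × ZMod M → E}
    {c : ℝ} (hc : 0 < c)
    (hfst : ∑ x, ‖F (shearFst.symm x) - F x‖ ^ 2 ≤ c ^ 2 * ∑ x, ‖F x‖ ^ 2)
    (hsnd : ∑ x, ‖F (shearSnd.symm x) - F x‖ ^ 2 ≤ c ^ 2 * ∑ x, ‖F x‖ ^ 2) :
    ∑ x ∈ oppositeSigns, ‖F x‖ ^ 2 ≤ 4 * c * ∑ x, ‖F x‖ ^ 2 + ∑ x ∈ centralᶜ, ‖F x‖ ^ 2 := by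
  refine sum_norm_sq_le_of_shifts hc hfst hsnd (fun ξ hξ => ?_) (fun ξ hξ => ?_)
    fun ξ hξ η hη heq => ?_ <;> obtain ⟨hcentral, hsigns⟩ := mem_filter.1 hξ <;>
    rw [mem_central] at hcentral
  · refine mem_filter_central_union ?_
    simp only [shearFst, Equiv.coe_fn_symm_mk, valMinAbs_sub hcentral.1 hcentral.2]
    omega
  · refine mem_filter_central_union ?_
    simp only [shearSnd, Equiv.coe_fn_symm_mk, valMinAbs_sub hcentral.2 hcentral.1]
    omega
  · obtain ⟨hcentral', hsigns'⟩ := mem_filter.1 hη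
    rw [mem_central] at hcentral'
    have heq₁ := congrArg (fun v => v.1.valMinAbs) heq
    have heq₂ := congrArg (fun v => v.2.valMinAbs) heq
    simp only [shearFst, shearSnd, Equiv.coe_fn_symm_mk, valMinAbs_sub hcentral.1 hcentral.2,
      valMinAbs_sub hcentral'.2 hcentral'.1] at heq₁ heq₂
    omega

theorem sum_equalSigns_le {E : Type*} [SeminormedAddCommGroup E] {F : ZMod M × ZMod M → E}
    {c : ℝ} (hc : 0 < c)
    (hfst : ∑ x, ‖F (shearFst x) - F x‖ ^ 2 ≤ c ^ 2 * ∑ x, ‖F x‖ ^ 2)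
    (hsnd : ∑ x, ‖F (shearSnd x) - F x‖ ^ 2 ≤ c ^ 2 * ∑ x, ‖F x‖ ^ 2) :
    ∑ x ∈ equalSigns, ‖F x‖ ^ 2 ≤ 4 * c * ∑ x, ‖F x‖ ^ 2 + ∑ x ∈ centralᶜ, ‖F x‖ ^ 2 := by
  refine sum_norm_sq_le_of_shifts hc hfst hsnd (fun ξ hξ => ?_) (fun ξ hξ => ?_)
    fun ξ hξ η hη heq => ?_ <;> obtain ⟨hcentral, hsigns⟩ := mem_filter.1 hξ <;>
    rw [mem_central] at hcentral
  · refine mem_filter_central_union ?_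
    simp only [shearFst, Equiv.coe_fn_mk, valMinAbs_add hcentral.1 hcentral.2]
    omega
  · refine mem_filter_central_union ?_
    simp only [shearSnd, Equiv.coe_fn_mk, valMinAbs_add hcentral.2 hcentral.1]
    omega
  · obtain ⟨hcentral', hsigns'⟩ := mem_filter.1 hη
    rw [mem_central] at hcentral'
    have heq₁ := congrArg (fun v => v.1.valMinAbs) heq
    have heq₂ := congrArg (fun v => v.2.valMinAbs) heq
    simp only [shearFst, shearSnd, Equiv.coe_fn_mk, valMinAbs_add hcentral.1 hcentral.2,
      valMinAbs_add hcentral'.2 hcentral'.1] at heq₁ heq₂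
    omega

theorem sum_compl_central_le (f : ZMod M × ZMod M → ℝ) :
    2 * ∑ ξ ∈ centralᶜ, ‖fourier f ξ‖ ^ 2 ≤
      ∑ ξ, ‖fourier (f ∘ gen 0) ξ - fourier f ξ‖ ^ 2 +
        ∑ ξ, ‖fourier (f ∘ gen 1) ξ - fourier f ξ‖ ^ 2 := by
  rw [mul_sum, ← sum_add_distrib]
  refine (sum_le_sum fun ξ hξ => ?_).trans
    (sum_le_sum_of_subset_of_nonneg (subset_univ _) fun ξ _ _ => by positivity)
  rw [fourier_comp_gen_zero, fourier_comp_gen_one, ← sub_one_mul, ← sub_one_mul, norm_mul,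
    norm_mul, mul_pow, mul_pow, ← add_mul]
  refine mul_le_mul_of_nonneg_right ?_ (sq_nonneg _)
  rw [mem_compl, mem_central, not_and_or, not_lt, not_lt] at hξ
  rcases hξ with hξ | hξ
  · exact (two_le_norm_stdAddChar_neg_sub_one _ hξ).trans (le_add_of_nonneg_right (sq_nonneg _))
  · exact (two_le_norm_stdAddChar_neg_sub_one _ hξ).trans (le_add_of_nonneg_left (sq_nonneg _))

theorem univ_subset_insert_zero_signs :
    (univ : Finset (ZMod M × ZMod M)) ⊆ insert 0 ((oppositeSigns ∪ equalSigns) ∪ centralᶜ) := by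
  intro ξ _
  by_cases hcentral : ξ ∈ central
  · by_cases hzero : ξ = 0
    · simp [hzero]
    · refine mem_insert_of_mem (mem_union_left _ (mem_union.2 ?_))
      have hne : ξ.1.valMinAbs ≠ 0 ∨ ξ.2.valMinAbs ≠ 0 := by
        by_contra! h
        exact hzero (Prod.ext ((valMinAbs_eq_zero _).1 h.1) ((valMinAbs_eq_zero _).1 h.2))
      simp only [oppositeSigns, equalSigns, mem_filter, hcentral, true_and]
      omega
  · exact mem_insert_of_mem (mem_union_right _ (mem_compl.2 hcentral))

theorem sum_norm_sq_le_signs {E : Type*} [SeminormedAddCommGroup E] {F : ZMod M × ZMod M → E}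
    (hF : F 0 = 0) :
    ∑ x, ‖F x‖ ^ 2 ≤ ∑ x ∈ oppositeSigns, ‖F x‖ ^ 2 + ∑ x ∈ equalSigns, ‖F x‖ ^ 2 +
      ∑ x ∈ centralᶜ, ‖F x‖ ^ 2 := by
  have hcover : ∑ x, ‖F x‖ ^ 2 ≤
      ∑ x ∈ insert 0 ((oppositeSigns ∪ equalSigns) ∪ centralᶜ), ‖F x‖ ^ 2 :=
    sum_le_sum_of_subset_of_nonneg univ_subset_insert_zero_signs fun _ _ _ => sq_nonneg _
  rw [sum_insert_zero (by simp [hF])] at hcover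
  exact hcover.trans ((sum_union_norm_sq_le F _ _).trans
    (add_le_add_left (sum_union_norm_sq_le F _ _) _))

theorem exists_gen_le_sum_sq_sub (f : ZMod M × ZMod M → ℝ) (hf : ∑ v, f v = 0) :
    ∃ i, 1 / 81 * ∑ v, f v ^ 2 ≤ ∑ v, (f (gen i v) - f v) ^ 2 := by
  by_contra! hcon
  have hM : (0 : ℝ) < (M : ℝ) ^ 2 := by
    have : (0 : ℝ) < M := by exact_mod_cast Nat.pos_of_ne_zero (NeZero.ne M)
    positivity
  have hpos : 0 < ∑ ξ, ‖fourier f ξ‖ ^ 2 := by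
    rw [parseval]
    have hnonneg : 0 ≤ ∑ v, (f (gen 0 v) - f v) ^ 2 := sum_nonneg fun _ _ => sq_nonneg _
    exact mul_pos hM (by linarith [hcon 0])
  have hgen (i : Fin 4) : ∑ ξ, ‖fourier (f ∘ gen i) ξ - fourier f ξ‖ ^ 2 ≤
      (1 / 9) ^ 2 * ∑ ξ, ‖fourier f ξ‖ ^ 2 := by
    rw [sum_norm_fourier_comp_sub, parseval]
    linarith [mul_lt_mul_of_pos_left (hcon i) hM]
  have hfst := hgen 3
  have hsnd := hgen 2
  simp only [gen, Matrix.cons_val, fourier_comp_shearFst, fourier_comp_shearSnd] at hfst hsnd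
  have hopposite := sum_oppositeSigns_le (by norm_num) hfst hsnd
  rw [← sum_norm_sub_symm] at hfst hsnd
  have hequal := sum_equalSigns_le (by norm_num) hfst hsnd
  have hcompl := sum_compl_central_le f
  have hall := sum_norm_sq_le_signs (F := fourier f) (by rw [fourier_zero_right, hf]; simp)
  linarith [hgen 0, hgen 1]

end Gap

end Expander

/-! ### Random walks avoid a small set with exponentially small probability only -/

namespace Expander

open Finset

section Move

variable {M : ℕ}

/-- The sixteen maps of the walk, indexed by the random bits of one step: each coordinate in turn is
sheared or not, then translated or not. -/
def move (b : Bool × Bool × Bool × Bool) (v : ZMod M × ZMod M) : ZMod M × ZMod M :=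
  (v.1 + b.1.toNat * v.2 + b.2.1.toNat,
    v.2 + b.2.2.1.toNat * (v.1 + b.1.toNat * v.2 + b.2.1.toNat) + b.2.2.2.toNat)

theorem move_false (v : ZMod M × ZMod M) : move (false, false, false, false) v = v := by
  simp [move]

theorem exists_move_eq_gen (i : Fin 4) :
    ∃ b, b ≠ (false, false, false, false) ∧ ∀ v : ZMod M × ZMod M, move b v = gen i v := by
  fin_cases i
  · exact ⟨(false, true, false, false), by decide, fun v => by simp [move, gen, Prod.map]⟩
  · exact ⟨(false, false, false, true), by decide, fun v => by simp [move, gen, Prod.map]⟩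
  · exact ⟨(true, false, false, false), by decide, fun v => by simp [move, gen, shearFst]⟩
  · exact ⟨(false, false, true, false), by decide, fun v => by simp [move, gen, shearSnd]⟩

variable [NeZero M]

theorem move_bijective (b : Bool × Bool × Bool × Bool) :
    Function.Bijective (move b : ZMod M × ZMod M → ZMod M × ZMod M) := by
  rw [← Finite.injective_iff_bijective]
  rintro ⟨x, y⟩ ⟨x', y'⟩ h
  simp only [move, Prod.mk.injEq] at h
  obtain ⟨hfst, hsnd⟩ := h
  rw [hfst] at hsnd
  obtain rfl : y = y' := by linear_combination hsnd
  exact Prod.ext (by linear_combination hfst) rfl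

theorem sum_sum_move (g : ZMod M × ZMod M → ℝ) :
    ∑ v, ∑ b, g (move b v) = 16 * ∑ v, g v := by
  rw [sum_comm]
  simp only [(move_bijective _).sum_comp g, sum_const, card_univ, nsmul_eq_mul]
  simp

end Move

section Sums

variable {ι : Type*} [Fintype ι]

theorem sq_sum_le_card_mul_sub_sq_sub (y : ι → ℝ) {i j : ι} (hij : i ≠ j) :
    (∑ k, y k) ^ 2 ≤ Fintype.card ι * ∑ k, y k ^ 2 - (y i - y j) ^ 2 := by
  classical
  have hvariance : ∑ k, ∑ l, (y k - y l) ^ 2 =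
      2 * (Fintype.card ι * ∑ k, y k ^ 2 - (∑ k, y k) ^ 2) := by
    simp only [sub_sq, sum_add_distrib, sum_sub_distrib, ← mul_sum, ← sum_mul, sum_const, card_univ,
      nsmul_eq_mul]
    ring
  have hterm (k l : ι) : (y k - y l) ^ 2 ≤ ∑ m, (y k - y m) ^ 2 :=
    single_le_sum (f := fun m => (y k - y m) ^ 2) (fun _ _ => sq_nonneg _) (mem_univ l)
  have hpair : ∑ k ∈ {i, j}, ∑ l, (y k - y l) ^ 2 ≤ ∑ k, ∑ l, (y k - y l) ^ 2 :=
    sum_le_sum_of_subset_of_nonneg (subset_univ _) fun _ _ _ => sum_nonneg fun _ _ => sq_nonneg _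
  rw [sum_pair hij] at hpair
  linarith [hterm i j, hterm j i, sub_sq_comm (y i) (y j)]

theorem sum_add_const_sq {g : ι → ℝ} (hg : ∑ i, g i = 0) (a : ℝ) :
    ∑ i, (g i + a) ^ 2 = ∑ i, g i ^ 2 + Fintype.card ι * a ^ 2 := by
  simp only [add_sq, sum_add_distrib, ← sum_mul, ← mul_sum, hg, sum_const, card_univ, nsmul_eq_mul]
  ring

theorem sq_sum_le_card_support_mul {f : ι → ℝ} {s : Finset ι} (hf : ∀ i ∉ s, f i = 0) :
    (∑ i, f i) ^ 2 ≤ #s * ∑ i, f i ^ 2 := by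
  rw [← sum_subset (subset_univ s) fun i _ hi => hf i hi]
  exact sq_sum_le_card_mul_sum_sq.trans (mul_le_mul_of_nonneg_left
    (sum_le_sum_of_subset_of_nonneg (subset_univ _) fun _ _ _ => sq_nonneg _) (Nat.cast_nonneg _))

end Sums

section Walk

variable {M : ℕ}

open Classical in
/-- The number of strings of random bits for which the first `n` vertices of the walk from `v`
all lie in `B`. -/
noncomputable def stay (B : Finset (ZMod M × ZMod M)) : ℕ → ZMod M × ZMod M → ℕ
  | 0, _ => 1
  | n + 1, v => if v ∈ B then ∑ b, stay B n (move b v) else 0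

theorem stay_succ_of_notMem {B : Finset (ZMod M × ZMod M)} {v : ZMod M × ZMod M} (hv : v ∉ B)
    (n : ℕ) : stay B (n + 1) v = 0 :=
  if_neg hv

theorem stay_succ_le (B : Finset (ZMod M × ZMod M)) (n : ℕ) (v : ZMod M × ZMod M) :
    stay B (n + 1) v ≤ ∑ b, stay B n (move b v) := by
  rw [stay]
  split_ifs
  exacts [le_rfl, Nat.zero_le _]

variable [NeZero M]

theorem sum_sq_move_le_of_sum_eq_zero {f : ZMod M × ZMod M → ℝ} (hf : ∑ v, f v = 0) :
    ∑ v, (∑ b, f (move b v)) ^ 2 ≤ (256 - 1 / 81) * ∑ v, f v ^ 2 := by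
  obtain ⟨i, hi⟩ := exists_gen_le_sum_sq_sub f hf
  obtain ⟨b, hb, hbi⟩ := exists_move_eq_gen (M := M) i
  have hpoint (v : ZMod M × ZMod M) : (∑ b, f (move b v)) ^ 2 ≤
      16 * ∑ b, f (move b v) ^ 2 - (f (gen i v) - f v) ^ 2 := by
    have hsq := sq_sum_le_card_mul_sub_sq_sub (fun b => f (move b v)) hb
    rw [hbi, move_false] at hsq
    simpa using hsq
  have hsum := sum_le_sum fun v (_ : v ∈ univ) => hpoint v
  rw [sum_sub_distrib, ← mul_sum, sum_sum_move fun v => f v ^ 2] at hsum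
  linarith

theorem card_torus : (Fintype.card (ZMod M × ZMod M) : ℝ) = (M : ℝ) ^ 2 := by
  simp [ZMod.card, sq]

/-- A function supported on a proper part of the torus is not nearly constant, so its component of
mean zero is a substantial part of it. -/
theorem sum_sq_move_le {f : ZMod M × ZMod M → ℝ} {B : Finset (ZMod M × ZMod M)}
    (hB : (#B : ℝ) ≤ 9 / 10 * (M : ℝ) ^ 2) (hf : ∀ v ∉ B, f v = 0) :
    ∑ v, (∑ b, f (move b v)) ^ 2 ≤ (256 - 1 / 810) * ∑ v, f v ^ 2 := by
  have hM : (0 : ℝ) < (M : ℝ) ^ 2 := by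
    have : (0 : ℝ) < M := by exact_mod_cast Nat.pos_of_ne_zero (NeZero.ne M)
    positivity
  obtain ⟨m, hm⟩ : ∃ m, (M : ℝ) ^ 2 * m = ∑ v, f v := ⟨_, mul_div_cancel₀ _ hM.ne'⟩
  obtain ⟨g, hfg⟩ : ∃ g : ZMod M × ZMod M → ℝ, ∀ v, f v = g v + m :=
    ⟨fun v => f v - m, fun v => (sub_add_cancel _ _).symm⟩
  have hg : ∑ v, g v = 0 := by
    simp only [hfg, sum_add_distrib, sum_const, card_univ, nsmul_eq_mul, card_torus] at hm
    linarith
  have hmove (v : ZMod M × ZMod M) :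
      ∑ b, f (move b v) = ∑ b, g (move b v) + 16 * m := by
    simp [hfg, sum_add_distrib]
  have hmean : (M : ℝ) ^ 2 * m ^ 2 ≤ 9 / 10 * ∑ v, f v ^ 2 := by
    have hsq : ((M : ℝ) ^ 2 * m) ^ 2 ≤ 9 / 10 * (M : ℝ) ^ 2 * ∑ v, f v ^ 2 := by
      rw [hm]
      exact (sq_sum_le_card_support_mul hf).trans
        (mul_le_mul_of_nonneg_right hB (sum_nonneg fun _ _ => sq_nonneg _))
    refine le_of_mul_le_mul_left ?_ hM
    linarith
  have hvariance : ∑ v, f v ^ 2 = ∑ v, g v ^ 2 + (M : ℝ) ^ 2 * m ^ 2 := by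
    simp only [hfg, sum_add_const_sq hg, card_torus]
  have hvariance' : ∑ v, (∑ b, f (move b v)) ^ 2 =
      ∑ v, (∑ b, g (move b v)) ^ 2 + (M : ℝ) ^ 2 * (16 * m) ^ 2 := by
    simp only [hmove]
    rw [sum_add_const_sq (by rw [sum_sum_move, hg, mul_zero]), card_torus]
  linarith [sum_sq_move_le_of_sum_eq_zero hg]

theorem sum_sq_stay_le {B : Finset (ZMod M × ZMod M)} (hB : (#B : ℝ) ≤ 9 / 10 * (M : ℝ) ^ 2)
    (n : ℕ) :
    ∑ v, (stay B (n + 1) v : ℝ) ^ 2 ≤ (256 - 1 / 810) ^ n * (256 * (M : ℝ) ^ 2) := by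
  have hstep (n : ℕ) : ∑ v, (stay B (n + 1) v : ℝ) ^ 2 ≤
      ∑ v, (∑ b, (stay B n (move b v) : ℝ)) ^ 2 :=
    sum_le_sum fun v _ =>
      pow_le_pow_left₀ (Nat.cast_nonneg _) (by exact_mod_cast stay_succ_le B n v) 2
  induction n with
  | zero =>
    refine (hstep 0).trans_eq ?_
    simp only [stay, Nat.cast_one, sum_const, card_univ, nsmul_eq_mul, card_torus]
    norm_num
    ring
  | succ n ih =>
    refine (hstep (n + 1)).trans
      ((sum_sq_move_le (f := fun v => (stay B (n + 1) v : ℝ)) hB fun v hv => ?_).trans ?_)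
    · rw [stay_succ_of_notMem hv, Nat.cast_zero]
    · rw [pow_succ', mul_assoc]
      exact mul_le_mul_of_nonneg_left ih (by norm_num)

theorem one_sub_pow_le_quarter : (1 - 1 / 207360 : ℝ) ^ (2 ^ 19) ≤ 1 / 4 := by
  have hexp : (1 - 1 / 207360 : ℝ) ≤ Real.exp (-(1 / 207360)) := Real.one_sub_le_exp_neg _
  calc (1 - 1 / 207360 : ℝ) ^ (2 ^ 19) ≤ Real.exp (-(1 / 207360)) ^ (2 ^ 19) := by gcongr
    _ = Real.exp (((2 ^ 19 : ℕ) : ℝ) * -(1 / 207360)) := (Real.exp_nat_mul _ _).symm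
    _ ≤ Real.exp (-1) * Real.exp (-1) := by
        rw [← Real.exp_add]
        exact Real.exp_le_exp.2 (by norm_num)
    _ ≤ 1 / 2 * (1 / 2) := by
        have hhalf : Real.exp (-1) ≤ 1 / 2 := by
          rw [Real.exp_neg, one_div]
          exact inv_anti₀ two_pos (by linarith [Real.add_one_le_exp (1 : ℝ)])
        gcongr
    _ = 1 / 4 := by norm_num

theorem spectral_pow_le (e : ℕ) :
    (256 - 1 / 810 : ℝ) ^ (e * 2 ^ 19) ≤ (16 ^ (e * 2 ^ 19) * (1 / 2) ^ e) ^ 2 := by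
  have hfactor : (256 - 1 / 810 : ℝ) = 16 ^ 2 * (1 - 1 / 207360) := by norm_num
  rw [hfactor, mul_pow, mul_pow, ← pow_mul, ← pow_mul, mul_comm 2, ← pow_mul (1 / 2 : ℝ),
    mul_comm e, mul_comm e, pow_mul (1 - 1 / 207360 : ℝ), pow_mul (1 / 2 : ℝ)]
  refine mul_le_mul_of_nonneg_left (pow_le_pow_left₀ ?_ ?_ _) (by positivity)
  · exact pow_nonneg (by norm_num) _
  · exact one_sub_pow_le_quarter.trans (by norm_num)

theorem sum_stay_le {B : Finset (ZMod M × ZMod M)} (hB : (#B : ℝ) ≤ 9 / 10 * (M : ℝ) ^ 2)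
    (e : ℕ) :
    ∑ v, (stay B (e * 2 ^ 19 + 1) v : ℝ) ≤
      (1 / 2) ^ e * (16 ^ (e * 2 ^ 19 + 1) * (M : ℝ) ^ 2) := by
  have hsq := sum_sq_stay_le hB (e * 2 ^ 19)
  have hpow := spectral_pow_le e
  generalize e * 2 ^ 19 = n at *
  refine le_of_sq_le_sq ?_ (by positivity)
  calc (∑ v, (stay B (n + 1) v : ℝ)) ^ 2 ≤ (M : ℝ) ^ 2 * ∑ v, (stay B (n + 1) v : ℝ) ^ 2 := by
        rw [← card_torus]
        exact sq_sum_le_card_mul_sum_sq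
    _ ≤ (M : ℝ) ^ 2 * ((16 ^ n * (1 / 2) ^ e) ^ 2 * (256 * (M : ℝ) ^ 2)) := by
        refine mul_le_mul_of_nonneg_left (hsq.trans ?_) (sq_nonneg _)
        exact mul_le_mul_of_nonneg_right hpow (by positivity)
    _ = ((1 / 2) ^ e * (16 ^ (n + 1) * (M : ℝ) ^ 2)) ^ 2 := by ring

end Walk

end Expander

/-! ### Counting good pairs -/

namespace Tower

open Finset

theorem exists_mul_self_add_mul_self_eq {F : Type*} [Field F] [Finite F]
    (hF : ringChar F ≠ 2) (g : F) : ∃ a b : F, a * a + b * b = g := by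
  have := Fintype.ofFinite F
  obtain ⟨a, b, hab⟩ := FiniteField.exists_root_sum_quadratic
    (f := (Polynomial.X ^ 2 : Polynomial F)) (g := Polynomial.X ^ 2 - Polynomial.C g)
    (by simp) (Polynomial.degree_X_pow_sub_C two_pos g) (FiniteField.odd_card_of_char_ne_two hF)
  simp only [Polynomial.eval_pow, Polynomial.eval_X, Polynomial.eval_sub, Polynomial.eval_C] at hab
  exact ⟨a, b, by linear_combination hab⟩

section SumSq

variable {F : Type*} [Field F] [Fintype F]

theorem card_mul_self_add_eq_zero_le [DecidableEq F] (c : F) : #{b : F | c + b * b = 0} ≤ 2 := by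
  by_contra! h
  obtain ⟨x, y, z, hx, hy, hz, hxy, hxz, hyz⟩ := two_lt_card_iff.1 h
  simp only [mem_filter_univ] at hx hy hz
  have hneg {v w : F} (hv : c + v * v = 0) (hw : c + w * w = 0) (hvw : v ≠ w) : v + w = 0 :=
    (mul_eq_zero.1 (by linear_combination hv - hw : (v - w) * (v + w) = 0)).resolve_left
      (sub_ne_zero.2 hvw)
  exact hyz (by linear_combination hneg hx hy hxy - hneg hx hz hxz)

theorem card_sumSq_eq_zero_lt [DecidableEq F] :
    #{v : F × F | v.1 * v.1 + v.2 * v.2 = 0} < 2 * Fintype.card F := by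
  have hfibres : #{v : F × F | v.1 * v.1 + v.2 * v.2 = 0} =
      ∑ a : F, #{b : F | a * a + b * b = 0} := by
    rw [card_filter, ← univ_product_univ, sum_product]
    simp only [card_filter]
  have hzero : #{b : F | (0 : F) * 0 + b * b = 0} = 1 := card_eq_one.2 ⟨0, by ext; simp⟩
  rw [hfibres, mul_comm, ← smul_eq_mul, ← card_univ, ← sum_const]
  exact sum_lt_sum (fun a _ => card_mul_self_add_eq_zero_le _)
    ⟨0, mem_univ _, hzero.trans_lt one_lt_two⟩

theorem exists_pow_half_card_eq_neg_one (hF : ringChar F ≠ 2) :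
    ∃ g : F, g ≠ 0 ∧ g ^ (Fintype.card F / 2) = -1 := by
  obtain ⟨g, hg⟩ := FiniteField.exists_nonsquare hF
  have hg0 : g ≠ 0 := fun h => hg (h ▸ .zero)
  exact ⟨g, hg0, (FiniteField.pow_dichotomy hF hg0).resolve_left fun h =>
    hg ((FiniteField.isSquare_iff hF hg0).2 h)⟩

/-- Multiplication by a pair `(a, b)` whose sum of squares is not a square, as for Gaussian
integers, maps the first set into the second one. -/
theorem card_sumSq_pow_eq_one_le [DecidableEq F] (hF : ringChar F ≠ 2) :
    #{v : F × F | (v.1 * v.1 + v.2 * v.2) ^ (Fintype.card F / 2) = 1} ≤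
      #{v : F × F | (v.1 * v.1 + v.2 * v.2) ^ (Fintype.card F / 2) = -1} := by
  obtain ⟨g, hg0, hg⟩ := exists_pow_half_card_eq_neg_one hF
  obtain ⟨a, b, hab⟩ := exists_mul_self_add_mul_self_eq hF g
  refine card_le_card_of_injOn (fun v => (v.1 * a - v.2 * b, v.1 * b + v.2 * a)) ?_ ?_
  · intro v hv
    simp only [coe_filter, mem_univ, true_and, Set.mem_ofPred_eq] at hv ⊢
    have hnorm : (v.1 * a - v.2 * b) * (v.1 * a - v.2 * b) +
        (v.1 * b + v.2 * a) * (v.1 * b + v.2 * a) = (v.1 * v.1 + v.2 * v.2) * g := by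
      rw [← hab]
      ring
    rw [hnorm, mul_pow, hv, hg, one_mul]
  · rintro ⟨x, y⟩ - ⟨x', y'⟩ - h
    obtain ⟨hfst, hsnd⟩ := Prod.mk.inj h
    have hx : (x - x') * g = 0 := by rw [← hab]; linear_combination a * hfst + b * hsnd
    have hy : (y - y') * g = 0 := by rw [← hab]; linear_combination a * hsnd - b * hfst
    exact Prod.ext (sub_eq_zero.1 ((mul_eq_zero.1 hx).resolve_right hg0))
      (sub_eq_zero.1 ((mul_eq_zero.1 hy).resolve_right hg0))

theorem card_sumSq_pow_ne_neg_one_lt [DecidableEq F] (hF : ringChar F ≠ 2) :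
    2 * #{v : F × F | (v.1 * v.1 + v.2 * v.2) ^ (Fintype.card F / 2) ≠ -1} <
      Fintype.card F ^ 2 + 2 * Fintype.card F := by
  have hsplit : #{v : F × F | (v.1 * v.1 + v.2 * v.2) ^ (Fintype.card F / 2) ≠ -1} ≤
      #{v : F × F | v.1 * v.1 + v.2 * v.2 = 0} +
        #{v : F × F | (v.1 * v.1 + v.2 * v.2) ^ (Fintype.card F / 2) = 1} := by
    refine (card_le_card fun v hv => ?_).trans (card_union_le _ _)
    simp only [mem_union, mem_filter_univ] at hv ⊢
    exact or_iff_not_imp_left.2 fun h0 => (FiniteField.pow_dichotomy hF h0).resolve_right hv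
  have htotal : #{v : F × F | (v.1 * v.1 + v.2 * v.2) ^ (Fintype.card F / 2) = -1} +
      #{v : F × F | (v.1 * v.1 + v.2 * v.2) ^ (Fintype.card F / 2) ≠ -1} =
        Fintype.card F ^ 2 := by
    rw [card_filter_add_card_filter_not, card_univ, Fintype.card_prod, sq]
  have hone := card_sumSq_pow_eq_one_le hF
  have hzero := card_sumSq_eq_zero_lt (F := F)
  omega

end SumSq

section Digits

variable {F : Type*} {p u M : ℕ} {c : ℕ → ℕ} {θ : F}

theorem mod_pow_eq_of_digits_eq {x y : ℕ} (h : ∀ i < u, x / p ^ i % p = y / p ^ i % p) :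
    x % p ^ u = y % p ^ u := by
  induction u with
  | zero => simp [Nat.mod_one]
  | succ u ih =>
    rw [Nat.mod_pow_succ, Nat.mod_pow_succ, ih fun i hi => h i (by omega), h u (by omega)]

theorem Presents.mod_eq_of_elt_eq [CommRing F] (h : Presents p u c θ) {x y : ℕ}
    (hxy : elt θ p u x = elt θ p u y) : x % p ^ u = y % p ^ u := by
  have hp : 0 < p := two_pos.trans h.two_lt
  exact mod_pow_eq_of_digits_eq
    (h.inj _ _ (fun i _ => Nat.mod_lt _ hp) (fun i _ => Nat.mod_lt _ hp) hxy)

theorem Presents.card_elt_eq_le [CommRing F] [DecidableEq F] [NeZero M] (h : Presents p u c θ)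
    (a : F) : #{x : ZMod M | elt θ p u x.val = a} ≤ M / p ^ u + 1 := by
  rw [← card_range (M / p ^ u + 1)]
  refine card_le_card_of_injOn (fun x => x.val / p ^ u) (fun x _ => ?_) fun x hx y hy hxy => ?_
  · simp only [coe_range, Set.mem_Iio]
    exact Nat.lt_succ_of_le (Nat.div_le_div_right (ZMod.val_lt x).le)
  · simp only [coe_filter, mem_univ, true_and, Set.mem_ofPred_eq] at hx hy
    apply ZMod.val_injective
    dsimp only at hxy
    rw [← Nat.mod_add_div x.val (p ^ u), ← Nat.mod_add_div y.val (p ^ u), hxy,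
      h.mod_eq_of_elt_eq (hx.trans hy.symm)]

open Classical in
theorem Presents.card_not_good_le_mul [CommRing F] [Fintype F] [NeZero M]
    (h : Presents p u c θ) :
    #{v : ZMod M × ZMod M | ¬ Good θ p u v.1.val v.2.val} ≤
      (M / p ^ u + 1) ^ 2 *
        #{v : F × F | (v.1 * v.1 + v.2 * v.2) ^ (p ^ u / 2) ≠ -1} := by
  refine card_le_mul_card_image_of_maps_to
    (f := fun v : ZMod M × ZMod M => (elt θ p u v.1.val, elt θ p u v.2.val))
    (fun v hv => ?_) _ fun v _ => ?_
  · exact mem_filter.2 ⟨mem_univ _, (mem_filter.1 hv).2⟩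
  calc _ ≤ #(({x | elt θ p u x.val = v.1} : Finset (ZMod M)) ×ˢ
          ({x | elt θ p u x.val = v.2} : Finset (ZMod M))) := by
        refine card_le_card fun w hw => ?_
        simp only [mem_filter, Prod.ext_iff] at hw
        simp [hw.2]
    _ ≤ (M / p ^ u + 1) ^ 2 := by
        rw [card_product, sq]
        exact Nat.mul_le_mul (h.card_elt_eq_le _) (h.card_elt_eq_le _)

theorem sq_div_add_one_mul_le {q n : ℕ} (hq : 3 ≤ q) (hM : 16 * q ≤ M)
    (hn : 2 * n < q ^ 2 + 2 * q) :
    (((M / q + 1) ^ 2 * n : ℕ) : ℝ) ≤ 9 / 10 * (M : ℝ) ^ 2 := by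
  have hn' : 9 * (n : ℝ) ≤ 7 * q ^ 2 := by
    have hn'' : 9 * n ≤ 7 * q ^ 2 := by nlinarith
    exact_mod_cast hn''
  have hdiv : ((M / q + 1 : ℕ) : ℝ) * q ≤ 17 / 16 * M := by
    have hle : ((M / q * q : ℕ) : ℝ) ≤ M := by exact_mod_cast Nat.div_mul_le_self M q
    have hM' : (16 : ℝ) * q ≤ M := by exact_mod_cast hM
    push_cast at hle ⊢
    linarith
  calc (((M / q + 1) ^ 2 * n : ℕ) : ℝ) = ((M / q + 1 : ℕ) : ℝ) ^ 2 * n := by push_cast; ring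
    _ ≤ ((M / q + 1 : ℕ) : ℝ) ^ 2 * (7 / 9 * q ^ 2) := by gcongr; linarith
    _ = 7 / 9 * (((M / q + 1 : ℕ) : ℝ) * q) ^ 2 := by ring
    _ ≤ 7 / 9 * (17 / 16 * M) ^ 2 := by gcongr
    _ ≤ 9 / 10 * (M : ℝ) ^ 2 := by nlinarith [sq_nonneg (M : ℝ)]

open Classical in
theorem Presents.card_not_good_le [Field F] [Fintype F] [NeZero M] (h : Presents p u c θ)
    (hcard : Fintype.card F = p ^ u) (hF : ringChar F ≠ 2) (hM : 16 * p ^ u ≤ M) :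
    (#{v : ZMod M × ZMod M | ¬ Good θ p u v.1.val v.2.val} : ℝ) ≤ 9 / 10 * (M : ℝ) ^ 2 := by
  have hlt := card_sumSq_pow_ne_neg_one_lt hF
  rw [hcard] at hlt
  exact (Nat.cast_le.2 h.card_not_good_le_mul).trans
    (sq_div_add_one_mul_le (h.two_lt.trans_le (Nat.le_self_pow h.pos.ne' p)) hM hlt)

end Digits

end Tower

/-! ### Counting strings of random bits -/

namespace Tower

open Finset Expander

/-- The number of strings of `n` bits with the property `P`. -/
noncomputable def countStrings (n : ℕ) (P : List Bool → Prop) : ℕ :=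
  Nat.card {ω : Fin n → Bool // P (List.ofFn ω)}

theorem countStrings_zero {P : List Bool → Prop} (hP : P []) : countStrings 0 P = 1 := by
  have : Unique {ω : Fin 0 → Bool // P (List.ofFn ω)} := ⟨⟨⟨Fin.elim0, hP⟩⟩, fun _ => Subtype.ext
    (Subsingleton.elim _ _)⟩
  exact Nat.card_unique

theorem countStrings_succ (n : ℕ) (P : List Bool → Prop) :
    countStrings (n + 1) P = ∑ b, countStrings n fun w => P (b :: w) := by
  classical
  simp only [countStrings, Nat.card_eq_fintype_card, Fintype.card_subtype, card_filter]
  rw [← (Fin.consEquiv fun _ : Fin (n + 1) => Bool).sum_comp, Fintype.sum_prod_type]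
  simp [Fin.consEquiv, List.ofFn_succ]

theorem countStrings_false (n : ℕ) : countStrings n (fun _ => False) = 0 := by
  simp [countStrings]

theorem countStrings_add_not (n : ℕ) (P : List Bool → Prop) :
    countStrings n P + countStrings n (fun w => ¬ P w) = 2 ^ n := by
  classical
  simp only [countStrings, Nat.card_eq_fintype_card, Fintype.card_subtype]
  rw [card_filter_add_card_filter_not, card_univ]
  simp

theorem sum_range_two_pow_succ {N : Type*} [AddCommMonoid N] (g : ℕ → N) (n x : ℕ) :
    ∑ i ∈ range (2 ^ (n + 1)), g (x * 2 ^ (n + 1) + i) =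
      ∑ b : Bool, ∑ i ∈ range (2 ^ n), g ((x * 2 + b.toNat) * 2 ^ n + i) := by
  rw [pow_succ, mul_two, sum_range_add, Fintype.sum_bool, add_comm]
  congr 1 <;> refine sum_congr rfl fun i _ => congrArg g ?_
  · simp only [Bool.toNat_true]; ring
  · simp only [Bool.toNat_false]; ring

theorem countStrings_draw (P : ℕ × ℕ × List Bool → Prop) (R n x y : ℕ) :
    countStrings (R + 2 * n) (fun w => P (draw n x y w)) =
      ∑ i ∈ range (2 ^ n), ∑ j ∈ range (2 ^ n),
        countStrings R fun w => P (x * 2 ^ n + i, y * 2 ^ n + j, w) := by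
  induction n generalizing x y with
  | zero => simp [draw]
  | succ n ih =>
    rw [sum_range_two_pow_succ (fun a => ∑ j ∈ range (2 ^ (n + 1)),
      countStrings R fun w => P (a, y * 2 ^ (n + 1) + j, w)), mul_add, mul_one, ← add_assoc,
      countStrings_succ]
    refine sum_congr rfl fun b₁ _ => ?_
    simp only [countStrings_succ, draw, ih]
    rw [sum_comm]
    refine sum_congr rfl fun i _ => ?_
    rw [sum_range_two_pow_succ (fun a => countStrings R fun w =>
      P ((x * 2 + b₁.toNat) * 2 ^ n + i, a, w))]

section Walk

variable {M : ℕ} [NeZero M]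

open Classical in
theorem countStrings_not_walk (good : ℕ → ℕ → Prop) (n : ℕ) {x y : ℕ} (hx : x < M) (hy : y < M) :
    countStrings (4 * n) (fun w => ¬ Walk good M n x y w) =
      stay {v : ZMod M × ZMod M | ¬ good v.1.val v.2.val} n (x, y) := by
  induction n generalizing x y with
  | zero => exact countStrings_zero (by simp [Walk])
  | succ n ih =>
    have hM : 0 < M := Nat.pos_of_ne_zero (NeZero.ne M)
    simp only [mul_add, mul_one, countStrings_succ, Walk, stay]
    by_cases hg : good x y
    · simp [hg, countStrings_false, ZMod.val_cast_of_lt hx, ZMod.val_cast_of_lt hy]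
    · rw [if_pos (by simp [hg, ZMod.val_cast_of_lt hx, ZMod.val_cast_of_lt hy])]
      simp only [Fintype.sum_prod_type, hg, false_or]
      refine sum_congr rfl fun b₁ _ => sum_congr rfl fun b₂ _ => sum_congr rfl fun b₃ _ =>
        sum_congr rfl fun b₄ _ => ?_
      rw [ih (shifted_lt hM ..) (shifted_lt hM ..)]
      congr 1
      simp [move, shifted]

theorem sum_range_eq_sum_zmod {N : Type*} [AddCommMonoid N] (g : ZMod M → N) :
    ∑ i ∈ range M, g i = ∑ x, g x :=
  sum_nbij' (fun i => (i : ZMod M)) ZMod.val (fun _ _ => mem_univ _)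
    (fun x _ => mem_range.2 (ZMod.val_lt x)) (fun _ hi => ZMod.val_cast_of_lt (mem_range.1 hi))
    (fun x _ => ZMod.natCast_zmod_val x) fun _ _ => rfl

open Classical in
theorem countStrings_not_walk_draw (good : ℕ → ℕ → Prop) (b n : ℕ) :
    countStrings (4 * n + 2 * b) (fun w => ¬ Walk good (2 ^ b) n
      (draw b 0 0 w).1 (draw b 0 0 w).2.1 (draw b 0 0 w).2.2) =
      ∑ v, stay {v : ZMod (2 ^ b) × ZMod (2 ^ b) | ¬ good v.1.val v.2.val} n v := by
  rw [countStrings_draw (fun v => ¬ Walk good (2 ^ b) n v.1 v.2.1 v.2.2), Fintype.sum_prod_type,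
    ← sum_range_eq_sum_zmod]
  refine sum_congr rfl fun i hi => ?_
  rw [← sum_range_eq_sum_zmod]
  refine sum_congr rfl fun j hj => ?_
  rw [zero_mul, zero_add, zero_add]
  exact countStrings_not_walk _ _ (mem_range.1 hi) (mem_range.1 hj)

end Walk

theorem Presents.countStrings_not_walk_le {F : Type*} [Field F] [Fintype F] {p u : ℕ} {c : ℕ → ℕ}
    {θ : F} (h : Presents p u c θ) (hcard : Fintype.card F = p ^ u) (hF : ringChar F ≠ 2)
    {b : ℕ} (hb : 16 * p ^ u ≤ 2 ^ b) (e : ℕ) :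
    (countStrings (4 * walkLength e + 2 * b) (fun w => ¬ Walk (Good θ p u) (2 ^ b) (walkLength e)
      (draw b 0 0 w).1 (draw b 0 0 w).2.1 (draw b 0 0 w).2.2) : ℝ) ≤
      (1 / 2) ^ e * 2 ^ (4 * walkLength e + 2 * b) := by
  classical
  rw [countStrings_not_walk_draw]
  push_cast
  refine (sum_stay_le (h.card_not_good_le hcard hF hb) e).trans_eq ?_
  rw [← walkLength, pow_add, pow_mul, mul_comm 2 b, pow_mul]
  push_cast
  norm_num

end Tower

/-! ### Resources and reliability -/

namespace Tower

theorem stepBound_le {u ℓ e b k n : ℕ} (hn : 1 ≤ n) (hu : u ≤ n) (hℓ : ℓ ≤ n) (he : e ≤ n)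
    (hb : b ≤ n + 4) (hk : k ≤ n) : stepBound u ℓ e b k ≤ 10 ^ 8 * n ^ 3 := by
  have hmono : stepBound u ℓ e b k ≤ stepBound n n n (n + 4) n := by
    unfold stepBound walkLength
    gcongr
  refine hmono.trans ?_
  have hone : 1 ≤ n ^ 3 := Nat.one_le_pow _ _ hn
  have hlinear : n ≤ n ^ 3 := Nat.le_self_pow (by norm_num) n
  have hsquare : n ^ 2 ≤ n ^ 3 := Nat.pow_le_pow_right hn (by norm_num)
  unfold stepBound walkLength
  ring_nf at hone hlinear hsquare ⊢
  omega

theorem base_le_two_pow {p u n : ℕ} (hu : u ≤ n) (hp : p ≤ 2 ^ n) :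
    base p u ≤ 2 ^ (3 * n + 2) := by
  calc base p u ≤ 4 * 2 ^ n * (2 ^ n) ^ 2 := by
        unfold base
        gcongr
        exact hu.trans Nat.lt_two_pow_self.le
    _ = 2 ^ (3 * n + 2) := by ring

theorem Presents.setup {F : Type*} [CommRing F] {p u ℓ e n : ℕ} {c : ℕ → ℕ} {θ : F}
    (h : Presents p u c θ) (hu : u ≤ n) (hℓ : ℓ ≤ n) (he : e ≤ n) (hp : p ≤ 2 ^ n) :
    Setup p u ℓ e ((3 * n + 2) * (2 * n + 2) + 25) c θ := by
  have hn : n < 2 ^ n := Nat.lt_two_pow_self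
  refine { h with base_pow_le := ?_, trials_le := ?_, length_le := ?_ }
  · calc base p u ^ (2 * u + 2) ≤ (2 ^ (3 * n + 2)) ^ (2 * u + 2) :=
          Nat.pow_le_pow_left (base_le_two_pow hu hp) _
      _ ≤ (2 ^ (3 * n + 2)) ^ (2 * n + 2) := Nat.pow_le_pow_right (by positivity) (by omega)
      _ = 2 ^ ((3 * n + 2) * (2 * n + 2)) := (pow_mul _ _ _).symm
      _ ≤ _ := Nat.pow_le_pow_right (by norm_num) (by omega)
  · calc (e + 1) * 2 ^ 20 ≤ 2 ^ n * 2 ^ 20 := by gcongr; omega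
      _ = 2 ^ (n + 20) := (pow_add _ _ _).symm
      _ ≤ _ := Nat.pow_le_pow_right (by norm_num) (by nlinarith)
  · calc ℓ + 4 ≤ 2 ^ n * 2 ^ 2 := by omega
      _ = 2 ^ (n + 2) := (pow_add _ _ _).symm
      _ ≤ _ := Nat.pow_le_pow_right (by norm_num) (by nlinarith)

theorem exists_le_two_pow {q n : ℕ} (hq : q ≤ 2 ^ n) :
    ∃ b ≤ n + 4, 16 * q ≤ 2 ^ b ∧ ∀ j < b, 2 ^ j < 16 * q :=
  ⟨Nat.clog 2 (16 * q), Nat.clog_le_of_le_pow (by rw [pow_add]; omega),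
    Nat.le_pow_clog one_lt_two _, fun _ hj => (Nat.lt_clog_iff_pow_lt one_lt_two).1 hj⟩

theorem countStrings_mono {n : ℕ} {P Q : List Bool → Prop}
    (h : ∀ w, w.length = n → P w → Q w) : countStrings n P ≤ countStrings n Q :=
  Nat.card_le_card_of_injective (Subtype.map id fun _ => h _ List.length_ofFn)
    (Subtype.map_injective _ Function.injective_id)

section Reliability

variable {F : Type*} [Field F] [Fintype F] {p u : ℕ} {c : ℕ → ℕ} {θ : F}

theorem Presents.countStrings_walk_ge (h : Presents p u c θ) (hcard : Fintype.card F = p ^ u)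
    (hF : ringChar F ≠ 2) {b : ℕ} (hb : 16 * p ^ u ≤ 2 ^ b) (e : ℕ) :
    (1 - (1 / 2) ^ e) * 2 ^ (4 * walkLength e + 2 * b) ≤
      (countStrings (4 * walkLength e + 2 * b) fun w => Walk (Good θ p u) (2 ^ b) (walkLength e)
        (draw b 0 0 w).1 (draw b 0 0 w).2.1 (draw b 0 0 w).2.2 : ℝ) := by
  have htotal := congrArg (Nat.cast (R := ℝ)) (countStrings_add_not (4 * walkLength e + 2 * b)
    fun w => Walk (Good θ p u) (2 ^ b) (walkLength e)
      (draw b 0 0 w).1 (draw b 0 0 w).2.1 (draw b 0 0 w).2.2)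
  push_cast at htotal
  linarith [h.countStrings_not_walk_le hcard hF hb e]

theorem Presents.exists_randomBits (h : Presents p u c θ) (hcard : Fintype.card F = p ^ u)
    (hF : ringChar F ≠ 2) {ℓ e n : ℕ} (hn : 1 ≤ n) (hu : u ≤ n) (hℓ : ℓ ≤ n) (he : e ≤ n)
    (hq : p ^ u ≤ 2 ^ n) :
    ∃ r ≤ 10 ^ 7 * n,
      (∀ w : List Bool, w.length = r → ∃ out t,
        towerProgram.Outputs ([p, u, ℓ, e] ++ (List.range u).map c) w out t ∧
        t ≤ 136 * 10 ^ 8 * n ^ 5 ∧ (IsTowerCode θ p u ℓ out ∨ out = failure)) ∧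
      (1 - (1 / 2) ^ e) * 2 ^ r ≤ (countStrings r fun w => ∃ out t,
        towerProgram.Outputs ([p, u, ℓ, e] ++ (List.range u).map c) w out t ∧
        IsTowerCode θ p u ℓ out : ℝ) := by
  obtain ⟨b, hbn, hb, hb'⟩ := exists_le_two_pow hq
  have hodd : p ^ u % 2 = 1 := hcard ▸ FiniteField.odd_card_of_char_ne_two hF
  have hsetup := h.setup hu hℓ he ((Nat.le_self_pow h.pos.ne' p).trans hq)
  have hrun (w : List Bool) (hw : w.length = 4 * walkLength e + 2 * b) :=
    towerProgram_outputs hsetup hodd hb hb' (hw.trans (add_comm _ _))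
  refine ⟨4 * walkLength e + 2 * b, ?_, fun w hw => ?_, ?_⟩
  · unfold walkLength
    omega
  · obtain ⟨out, t, hout, ht, hcode, -⟩ := hrun w hw
    refine ⟨out, t, hout, ht.trans ?_, hcode⟩
    have hsize : (p ^ u / 2).size ≤ n := Nat.size_le.2 (by have := h.two_lt; omega)
    calc _ ≤ 10 ^ 8 * n ^ 3 * (136 * n ^ 2) :=
          Nat.mul_le_mul (stepBound_le hn hu hℓ he hbn hsize) (by nlinarith)
      _ = 136 * 10 ^ 8 * n ^ 5 := by ring
  · refine (h.countStrings_walk_ge hcard hF hb e).trans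
      (Nat.cast_le.2 (countStrings_mono fun w hw hwalk => ?_))
    obtain ⟨out, t, hout, -, -, hcode⟩ := hrun w hw
    exact ⟨out, t, hout, hcode hwalk⟩

end Reliability

theorem natCast_le_of_le_two_mul {r n : ℕ} {N : ℝ} (hr : r ≤ 10 ^ 7 * n) (hnN : n ≤ 2 * N) :
    (r : ℝ) ≤ 10 ^ 12 * N := by
  have hr' : (r : ℝ) ≤ 10 ^ 7 * n := by exact_mod_cast hr
  linarith [(Nat.cast_nonneg n : (0 : ℝ) ≤ n)]

theorem natCast_le_pow_of_le_two_mul {t n : ℕ} {N : ℝ} (ht : t ≤ 136 * 10 ^ 8 * n ^ 5)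
    (hnN : n ≤ 2 * N) : (t : ℝ) ≤ 10 ^ 12 * N ^ 5 := by
  have hN : 0 ≤ N := by linarith [(Nat.cast_nonneg n : (0 : ℝ) ≤ n)]
  calc (t : ℝ) ≤ 136 * 10 ^ 8 * n ^ 5 := by exact_mod_cast ht
    _ ≤ 136 * 10 ^ 8 * (2 * N) ^ 5 := by gcongr
    _ ≤ 10 ^ 12 * N ^ 5 := by linarith [pow_nonneg hN 5]

theorem exists_parameter_bound {q u : ℕ} (hu : 0 < u) (hq : 2 ^ u ≤ q) (ℓ : ℕ) {δ : ℝ}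
    (hδ : 0 < δ) (hδ' : δ ≤ 1) :
    ∃ n : ℕ, 1 ≤ n ∧ u ≤ n ∧ ℓ ≤ n ∧ ⌈Real.logb 2 (1 / δ)⌉₊ ≤ n ∧ q ≤ 2 ^ n ∧
      (n : ℝ) ≤ 2 * (2 ^ ℓ * Real.logb 2 q + Real.logb 2 (1 / δ)) := by
  set D := Real.logb 2 (1 / δ)
  set l := Real.logb 2 q
  have hD : 0 ≤ D := Real.logb_nonneg one_lt_two ((one_le_div hδ).2 hδ')
  have hqpos : (0 : ℝ) < q := by exact_mod_cast (Nat.two_pow_pos u).trans_le hq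
  have hul : (u : ℝ) ≤ l := (Real.le_logb_iff_rpow_le one_lt_two hqpos).2 (by
    rw [Real.rpow_natCast]
    exact_mod_cast hq)
  have hone : (1 : ℝ) ≤ u := by exact_mod_cast hu
  have hk : (1 : ℝ) ≤ 2 ^ ℓ := one_le_pow₀ one_le_two
  have hℓk : (ℓ : ℝ) ≤ 2 ^ ℓ := by exact_mod_cast (Nat.lt_two_pow_self (n := ℓ)).le
  have hlN : l ≤ 2 ^ ℓ * l := le_mul_of_one_le_left (by linarith) hk
  have hkN : 2 ^ ℓ ≤ 2 ^ ℓ * l := le_mul_of_one_le_right (by linarith) (by linarith)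
  set N := 2 ^ ℓ * l + D
  have hceil : N ≤ ⌈N⌉₊ := Nat.le_ceil N
  have hle {m : ℕ} (hm : (m : ℝ) ≤ N) : m ≤ ⌈N⌉₊ := by exact_mod_cast hm.trans hceil
  refine ⟨⌈N⌉₊, hle (by push_cast; linarith), hle (by linarith), hle (by linarith),
    Nat.ceil_mono (by linarith), ?_, ?_⟩
  · have hqN := (Real.logb_le_iff_le_rpow one_lt_two hqpos).1 (by linarith : l ≤ (⌈N⌉₊ : ℕ))
    rw [Real.rpow_natCast] at hqN
    exact_mod_cast hqN
  · linarith [Nat.ceil_lt_add_one (by linarith : 0 ≤ N)]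

theorem half_pow_ceil_logb_le {δ : ℝ} (hδ : 0 < δ) :
    (1 / 2 : ℝ) ^ ⌈Real.logb 2 (1 / δ)⌉₊ ≤ δ := by
  have hle := (Real.logb_le_iff_le_rpow one_lt_two (one_div_pos.2 hδ)).1
    (Nat.le_ceil (Real.logb 2 (1 / δ)))
  rw [Real.rpow_natCast] at hle
  rw [one_div_pow]
  exact (one_div_le (by positivity) hδ).2 hle

end Tower

theorem mainTheorem5 :
    ∃ (A : RAM.Prog) (C : ℝ) (c : ℕ),
      ∀ (p : ℕ) [Fact p.Prime] (F : Type*) [Field F] [Finite F] [Algebra (ZMod p) F] (θ : F)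
        (ℓ : ℕ) (δ : ℝ),
        p ≠ 2 → Algebra.adjoin (ZMod p) {θ} = ⊤ → 0 < δ → δ ≤ 1 →
        ∃ r : ℕ,
          -- number of random bits
          (r : ℝ) ≤ C * (2 ^ ℓ * Real.logb 2 (Nat.card F) + Real.logb 2 (1 / δ)) ∧
          -- on each string of random bits: running time, and a correct output or failure
          (∀ ω : Fin r → Bool, ∃ (out : List ℕ) (t : ℕ),
            A.Outputs (Tower.inputTape (p := p) θ ℓ ⌈Real.logb 2 (1 / δ)⌉₊) (List.ofFn ω) out t ∧
            (t : ℝ) ≤ C * (2 ^ ℓ * Real.logb 2 (Nat.card F) + Real.logb 2 (1 / δ)) ^ c ∧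
            (Tower.IsSuccess p θ ℓ out ∨ out = Tower.failure)) ∧
          -- probability of success
          1 - δ ≤ (Nat.card {ω : Fin r → Bool // ∃ (out : List ℕ) (t : ℕ),
            A.Outputs (Tower.inputTape (p := p) θ ℓ ⌈Real.logb 2 (1 / δ)⌉₊) (List.ofFn ω) out t ∧
            Tower.IsSuccess p θ ℓ out} : ℝ) / 2 ^ r := by
  refine ⟨Tower.towerProgram, 10 ^ 12, 5, fun p _ F _ _ _ θ ℓ δ hp hθ hδ hδ' => ?_⟩
  have := Fintype.ofFinite F
  have hpres := Tower.presents_minpoly hp θ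
  have hNatCard := Tower.card_eq_pow_natDegree hθ
  have hcard := Nat.card_eq_fintype_card.symm.trans hNatCard
  have hchar : ringChar F ≠ 2 := by
    have := charP_of_injective_algebraMap (algebraMap (ZMod p) F).injective p
    rwa [ringChar.eq F p]
  have hcode {out : List ℕ} := Tower.IsTowerCode.isSuccess hp (ℓ := ℓ) (out := out) hcard
  obtain ⟨n, hn, hu, hℓ, he, hq, hnN⟩ := Tower.exists_parameter_bound hpres.pos
    (hNatCard ▸ Nat.pow_le_pow_left hpres.two_lt.le _) ℓ hδ hδ'
  obtain ⟨r, hr, hrun, hprob⟩ :=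
    hpres.exists_randomBits hcard hchar hn hu hℓ he (hNatCard ▸ hq)
  rw [Tower.inputTape_eq]
  refine ⟨r, Tower.natCast_le_of_le_two_mul hr hnN, fun ω => ?_, ?_⟩
  · obtain ⟨out, t, hout, ht, hsucc⟩ := hrun (List.ofFn ω) List.length_ofFn
    exact ⟨out, t, hout, Tower.natCast_le_pow_of_le_two_mul ht hnN, hsucc.imp_left hcode⟩
  · rw [le_div_iff₀ (by positivity)]
    calc (1 - δ) * 2 ^ r ≤ (1 - (1 / 2) ^ ⌈Real.logb 2 (1 / δ)⌉₊) * 2 ^ r := by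
          gcongr
          exact Tower.half_pow_ceil_logb_le hδ
      _ ≤ _ := hprob.trans (Nat.cast_le.2 (Nat.card_le_card_of_injective
          (Subtype.map id fun _ => Exists.imp fun _ => Exists.imp fun _ => And.imp_right hcode)
          (Subtype.map_injective _ Function.injective_id)))
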